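/- Virtual link diagrams are oriented, have ordered components, and are considered up to planar isotopy and detour moves, i.e. they are given by their Gauss diagrams. Diagrams $D,D'$ are equivalent if they are related by Reidemeister moves (and detour moves). A *short arc* runs along a component from one classical crossing to the next. An *Alexander numbering* of $D$ is an integer labeling of its short arcs such that at each classical crossing, drawn with both strands pointing upwards, the incoming and the outgoing arc on the left are both labeled $m+1$ and those on the right are both labeled $m$, for some $m\in\mathbb{Z}$. $D$ is *almost classical* if it is equivalent to a diagram that has an Alexander numbering. Two $(n+1)$-component diagrams with last component $\omega$ are *semi-welded equivalent* if they are related by Reidemeister moves, detour moves, and moves that exchange two consecutive over-crossing passages along $\omega$. For an $n$-component diagram $D$, the $(n+1)$-component diagram $\mathrm{Zh}^{\mathrm{op}}(D)=D\cup\omega^{\mathrm{op}}$ is formed as follows. At each classical crossing of $D$ (both strands pointing upwards) choose a side and draw two over-crossing arcs of $\omega^{\mathrm{op}}$ across the incoming and the outgoing arc of $D$ on that side. On the right, they cross the incoming arc with sign $-1$ and the outgoing arc with sign $+1$; on the left, with signs $+1$ and $-1$, respectively. Connect all these arcs in any order to one closed component $\omega^{\mathrm{op}}$, where all further crossings are virtual.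 An *Alexander system* for an $n$-component diagram $D$ is a triple $(D,\gamma,\Gamma)$, where $D\cup\gamma$ is an $(n+1)$-component diagram, at every classical crossing involving $\gamma$ the over-crossing arc lies in $\gamma$ and the under-crossing arcs lie in $D$, and $\Gamma$ is an integer labeling of the short arcs of $D\cup\gamma$ contained in $D$ that satisfies the rule for Alexander numberings at every classical crossing of $D$ with itself and that increases by $1$ (decreases by $1$) when $D$ passes under $\gamma$ at a positive (negative) crossing. Let $D\sqcup\bigcirc$ denote $D$ together with a disjoint circle without crossings as last component. **Corollary.** Let $D$ be a virtual link diagram, and let $\mathrm{Zh}^{\mathrm{op}}(D)$ be drawn with any choice of the sides and of the order of connection. Then $D$ is almost classical if and only if there is a virtual link diagram $D'$ such that $\mathrm{Zh}^{\mathrm{op}}(D)$ is semi-welded equivalent to the split diagram $D'\sqcup\bigcirc$ and there is a labeling $\Gamma'$ for which $(D',\bigcirc,\Gamma')$ is an Alexander system. Moreover, if $D$ is almost classical, then $\mathrm{Zh}^{\mathrm{op}}(D)$ is semi-welded equivalent to $D\sqcup\bigcirc$. -/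

import Mathlib

/-- An endpoint of an arrow of a Gauss diagram: one of the two passages through a classical
crossing. The crossing has a name `label` and a `sign` (`1` or `-1`); `isOver = true` is the passage
along the over-crossing strand (the tail of the arrow), `isOver = false` the passage along the
under-crossing strand (the head of the arrow). -/
@[ext] structure Endpoint where
  label : ℕ
  isOver : Bool
  sign : ℤˣ
  deriving DecidableEq

namespace Endpoint

/-- The other endpoint of the same arrow. -/
def partner (e : Endpoint) : Endpoint := { e with isOver := !e.isOver }

/-- An endpoint without its sign; in a diagram each such pair occurs at most once. -/
def key (e : Endpoint) : ℕ × Bool := (e.label, e.isOver)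

/-- Rename crossings. -/
def relabel (f : ℕ → ℕ) (e : Endpoint) : Endpoint := { e with label := f e.label }

end Endpoint

/-- An oriented virtual link diagram with `n` ordered components, considered up to planar isotopy
and detour moves, that is, given by its Gauss diagram: `word i` lists the passages through
classical crossings met along the `i`-th oriented circle, starting at an arbitrary base point.
Each crossing is passed exactly once over and exactly once under, and both passages carry its
sign. A component without classical crossings has the empty word. -/
structure VirtualLinkDiagram (n : ℕ) where
  word : Fin n → List Endpoint
  nodup : ∀ i, ((word i).map Endpoint.key).Nodup
  unique : ∀ i j, ∀ e ∈ word i, ∀ f ∈ word j, e.key = f.key → i = j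
  partner_mem : ∀ i, ∀ e ∈ word i, ∃ j, e.partner ∈ word j

namespace VirtualLinkDiagram

variable {n : ℕ}

/-! ### Equivalence of virtual link diagrams -/

/-- Isomorphism of Gauss diagrams: change the base points on the circles and the names of the
arrows. -/
def Iso (D E : VirtualLinkDiagram n) : Prop :=
  ∃ f : Equiv.Perm ℕ, ∀ i, (E.word i).IsRotated ((D.word i).map (Endpoint.relabel f))

/-- `y` comes immediately after `x` on one of the oriented circles. -/
def Adj (D : VirtualLinkDiagram n) (x y : Endpoint) : Prop :=
  ∃ i, ∃ l, (D.word i).IsRotated (x :: y :: l)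

/-- `x` and `y` are neighbours on one of the circles, with `x` first if `s = 1`,
and with `y` first if `s = -1`. -/
def AdjSigned (D : VirtualLinkDiagram n) (s : ℤˣ) (x y : Endpoint) : Prop :=
  if s = 1 then D.Adj x y else D.Adj y x

/-- First Reidemeister move: `D` is obtained from `E` by deleting an arrow whose two endpoints are
adjacent. -/
def Omega1 (D E : VirtualLinkDiagram n) : Prop :=
  ∃ x : Endpoint, E.Adj x x.partner ∧
    ∀ i, D.word i = (E.word i).filter (fun e => e.label ≠ x.label)

/-- Second Reidemeister move: `D` is obtained from `E` by deleting two arrows of opposite signs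
with adjacent tails `a`, `b` and adjacent heads (the two strands may run in the same direction
or in opposite directions). -/
def Omega2 (D E : VirtualLinkDiagram n) : Prop :=
  ∃ a b : Endpoint, a.isOver = true ∧ b.isOver = true ∧ a.label ≠ b.label ∧ b.sign = -a.sign ∧
    E.Adj a b ∧ (E.Adj a.partner b.partner ∨ E.Adj b.partner a.partner) ∧
    ∀ i, D.word i = (E.word i).filter (fun e => e.label ≠ a.label ∧ e.label ≠ b.label)

/-- Third Reidemeister move, for a top, a middle and a bottom strand: `a`, `b`, `c` are the tails
of the arrows top-middle, top-bottom and middle-bottom. The move exchanges the two passages on each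
of the three strands. Three oriented lines in the plane in general position, which cross with
given signs, determine the order of the two crossings on each line up to the simultaneous reversal
of all three orders (the parameter `δ`); the orders are those stated here. -/
def Omega3 (D E : VirtualLinkDiagram n) : Prop :=
  ∃ a b c : Endpoint, a.isOver = true ∧ b.isOver = true ∧ c.isOver = true ∧
    a.label ≠ b.label ∧ a.label ≠ c.label ∧ b.label ≠ c.label ∧
    (∃ δ : ℤˣ, D.AdjSigned (δ * a.sign * b.sign * c.sign) a b ∧
      D.AdjSigned (δ * a.sign) a.partner c ∧
      D.AdjSigned (δ * b.sign) b.partner c.partner) ∧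
    ∀ i, E.word i = (D.word i).map (fun e =>
      Equiv.swap a b (Equiv.swap a.partner c (Equiv.swap b.partner c.partner e)))

/-- A single step of virtual Reidemeister equivalence. -/
def ReidemeisterStep (D E : VirtualLinkDiagram n) : Prop :=
  Iso D E ∨ Omega1 D E ∨ Omega2 D E ∨ Omega3 D E

/-- Virtual Reidemeister equivalence. -/
def Equivalent (D E : VirtualLinkDiagram n) : Prop :=
  Relation.EqvGen ReidemeisterStep D E

/-- The `ω`-over-crossings-commute move: two adjacent over-crossing passages on the last
component `ω` are exchanged. -/
def OmegaOCC (D E : VirtualLinkDiagram (n + 1)) : Prop :=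
  ∃ a b : Endpoint, a.isOver = true ∧ b.isOver = true ∧
    (∃ l, (D.word (Fin.last n)).IsRotated (a :: b :: l)) ∧
    ∀ i, E.word i = (D.word i).map (Equiv.swap a b)

/-- Semi-welded equivalence of diagrams with `n + 1` components, the last of which is `ω`. -/
def SemiWeldedEquivalent (D E : VirtualLinkDiagram (n + 1)) : Prop :=
  Relation.EqvGen (fun D E => ReidemeisterStep D E ∨ OmegaOCC D E) D E

/-! ### Alexander numberings and almost classical links -/

/-- The positions of the passages through classical crossings along the circles. -/
abbrev Position (D : VirtualLinkDiagram n) : Type := Σ i : Fin n, Fin (D.word i).length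

/-- The endpoint at a position. -/
def endpointAt (D : VirtualLinkDiagram n) (p : D.Position) : Endpoint := (D.word p.1).get p.2

/-- A short arc runs from one classical crossing to the next one along a component. We name it by
the position where it starts. -/
abbrev ShortArc (D : VirtualLinkDiagram n) : Type := D.Position

/-- The short arc that leaves the crossing at position `p`. -/
def arcOut (D : VirtualLinkDiagram n) (p : D.Position) : D.ShortArc := p

/-- The short arc that enters the crossing at position `p`: the one that starts at the cyclically
preceding position of the same component. -/
def arcIn (D : VirtualLinkDiagram n) (p : D.Position) : D.ShortArc :=
  ⟨p.1, (finRotate (D.word p.1).length).symm p.2⟩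

/-- The rule for Alexander numberings at a classical crossing of sign `s`. If the crossing is
drawn with both strands pointing upwards, then the incoming and the outgoing arc on the left are
both labelled `m + 1` and those on the right are both labelled `m`. For `s = 1` the
over-crossing strand enters on the left and the under-crossing strand on the right; for `s = -1`
it is the other way around. -/
def AlexanderRule (s : ℤˣ) (overIn overOut underIn underOut : ℤ) : Prop :=
  if s = 1 then ∃ m : ℤ, overIn = m + 1 ∧ underOut = m + 1 ∧ underIn = m ∧ overOut = m
  else ∃ m : ℤ, underIn = m + 1 ∧ overOut = m + 1 ∧ overIn = m ∧ underOut = m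

/-- `f` is an Alexander numbering of `D`. -/
def IsAlexanderNumbering (D : VirtualLinkDiagram n) (f : D.ShortArc → ℤ) : Prop :=
  ∀ p q : D.Position, (D.endpointAt p).isOver = true →
    D.endpointAt q = (D.endpointAt p).partner →
    AlexanderRule (D.endpointAt p).sign
      (f (D.arcIn p)) (f (D.arcOut p)) (f (D.arcIn q)) (f (D.arcOut q))

/-- `D` is Alexander numerable. -/
def AlexanderNumerable (D : VirtualLinkDiagram n) : Prop :=
  ∃ f : D.ShortArc → ℤ, D.IsAlexanderNumbering f

/-- `D` is a diagram of an almost classical link. -/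
def AlmostClassical (D : VirtualLinkDiagram n) : Prop :=
  ∃ D' : VirtualLinkDiagram n, Equivalent D D' ∧ D'.AlexanderNumerable

/-! ### Alexander systems -/

/-- Delete the last component, with all the classical crossings in which it takes part. -/
def base (E : VirtualLinkDiagram (n + 1)) : VirtualLinkDiagram n where
  word i := (E.word i.castSucc).filter
    (fun e => e.label ∉ (E.word (Fin.last n)).map Endpoint.label)
  nodup i := (E.nodup i.castSucc).sublist (List.filter_sublist.map _)
  unique i j e he f hf h := by
    rw [List.mem_filter] at he hf
    exact Fin.castSucc_injective n (E.unique _ _ e he.1 f hf.1 h)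
  partner_mem i e he := by
    rw [List.mem_filter] at he
    obtain ⟨j, hj⟩ := E.partner_mem _ e he.1
    have hl := of_decide_eq_true he.2
    induction j using Fin.lastCases with
    | last => exact absurd (List.mem_map.2 ⟨_, hj, rfl⟩) hl
    | cast j => exact ⟨j, List.mem_filter.2 ⟨hj, decide_eq_true hl⟩⟩

/-- The short arcs of `E = D ∪ γ` that are contained in `D`, where `γ` is the last component. -/
abbrev BaseArc (E : VirtualLinkDiagram (n + 1)) : Type :=
  {p : E.ShortArc // p.1 ≠ Fin.last n}

/-- The triple `(D, γ, Γ)` is an Alexander system for `D`, where `E = D ∪ γ`. -/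
structure IsAlexanderSystem (D : VirtualLinkDiagram n) (E : VirtualLinkDiagram (n + 1))
    (Γ : E.BaseArc → ℤ) : Prop where
  /-- `E` is the union of `D` and one further component `γ`. -/
  base_eq : E.base = D
  /-- At every classical crossing that involves `γ`, the over-crossing arc lies in `γ`... -/
  over_mem : ∀ p q : E.Position, (E.endpointAt p).isOver = true →
    E.endpointAt q = (E.endpointAt p).partner →
    (p.1 = Fin.last n ∨ q.1 = Fin.last n) → p.1 = Fin.last n
  /-- ... and the under-crossing arcs lie in `D`. -/
  under_mem : ∀ p q : E.Position, (E.endpointAt p).isOver = true →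
    E.endpointAt q = (E.endpointAt p).partner →
    (p.1 = Fin.last n ∨ q.1 = Fin.last n) → q.1 ≠ Fin.last n
  /-- At a crossing of `γ` over `D`, the label of the arc of `D` to the left of `γ` exceeds the
  one to the right of `γ` as in an Alexander numbering: on passing under `γ`, the label
  increases by one at a positive and decreases by one at a negative crossing. -/
  mixed : ∀ p q : E.Position, (E.endpointAt p).isOver = true →
    E.endpointAt q = (E.endpointAt p).partner →
    p.1 = Fin.last n → ∀ hq : q.1 ≠ Fin.last n,
    Γ ⟨E.arcOut q, hq⟩ = Γ ⟨E.arcIn q, hq⟩ + ((E.endpointAt p).sign : ℤ)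
  /-- At a crossing of `D` with itself, `Γ` follows the rule for Alexander numberings. -/
  self : ∀ p q : E.Position, (E.endpointAt p).isOver = true →
    E.endpointAt q = (E.endpointAt p).partner →
    ∀ (hp : p.1 ≠ Fin.last n) (hq : q.1 ≠ Fin.last n),
    AlexanderRule (E.endpointAt p).sign
      (Γ ⟨E.arcIn p, hp⟩) (Γ ⟨E.arcOut p, hp⟩) (Γ ⟨E.arcIn q, hq⟩) (Γ ⟨E.arcOut q, hq⟩)

/-- The split diagram `D ⊔ ○`: add a circle without classical crossings. -/
def split (D : VirtualLinkDiagram n) : VirtualLinkDiagram (n + 1) where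
  word := Fin.snoc (α := fun _ => List Endpoint) D.word []
  nodup i := by
    induction i using Fin.lastCases with
    | last => simp
    | cast i => simpa using D.nodup i
  unique i j e he f hf h := by
    induction i using Fin.lastCases with
    | last => simp at he
    | cast i =>
      induction j using Fin.lastCases with
      | last => simp at hf
      | cast j =>
        simp only [Fin.snoc_castSucc] at he hf
        rw [D.unique i j e he f hf h]
  partner_mem i e he := by
    induction i using Fin.lastCases with
    | last => simp at he
    | cast i =>
      simp only [Fin.snoc_castSucc] at he
      obtain ⟨j, hj⟩ := D.partner_mem i e he
      exact ⟨j.castSucc, by simpa using hj⟩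

/-! ### The `Zh`-construction with reversed orientation

Two over-crossing arcs of the new component are placed next to each classical crossing of `D`.
With the crossing drawn such that both of its strands point upwards, they cross the incoming and
the outgoing arc of `D` on the right, or else the incoming and the outgoing arc on the left. So
every passage of `D` through a classical crossing gets exactly one new crossing, either
immediately before or immediately after it. -/

/-- On which side of a crossing the two new over-crossing arcs are drawn. -/
inductive Side
  | left
  | right
  deriving DecidableEq

/-- The side on which the strand of the passage `e` enters the crossing (both strands pointing
upwards); it leaves the crossing on the other side. -/
def sideIn (e : Endpoint) : Side :=
  if e.isOver = true then (if e.sign = 1 then .left else .right)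
  else (if e.sign = 1 then .right else .left)

/-- The passage of `D` under the new component that is placed next to the passage `e`, if the new
arcs are drawn on the side `s`. On the right, the new component crosses the incoming arc
negatively and the outgoing arc positively; on the left, it is the other way around. The crossings
of `D` are renamed from `c` to `3 * c`, to make room for the names of the new ones. -/
def zhUnder (s : Side) (e : Endpoint) : Endpoint where
  label := 3 * e.label + (if e.isOver = true then 1 else 2)
  isOver := false
  sign := if s = .right then (if sideIn e = s then -1 else 1) else (if sideIn e = s then 1 else -1)

/-- The piece of `D ∪ ω` that replaces the passage `e` of `D`. -/
def zhPiece (s : Side) (e : Endpoint) : List Endpoint :=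
  if sideIn e = s then [zhUnder s e, e.relabel (3 * ·)] else [e.relabel (3 * ·), zhUnder s e]

/-- All the over-crossing passages of the new component, in some order. -/
def zhOvers (D : VirtualLinkDiagram n) (side : ℕ → Side) : List Endpoint :=
  (List.ofFn D.word).flatten.map (fun e => (zhUnder (side e.label) e).partner)

theorem zhUnder_key_inj {s t : Side} {e f : Endpoint}
    (h : (zhUnder s e).key = (zhUnder t f).key) : e.key = f.key := by
  simp only [zhUnder, Endpoint.key, Prod.mk.injEq, and_true] at h ⊢
  rcases he : e.isOver <;> rcases hf : f.isOver <;> simp [he, hf] at h ⊢ <;> omega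

theorem key_of_mem_zhPiece {s t : Side} {e f x y : Endpoint}
    (hx : x ∈ zhPiece s e) (hy : y ∈ zhPiece t f) (h : x.key = y.key) : e.key = f.key := by
  have hx' : x = zhUnder s e ∨ x = e.relabel (3 * ·) := by
    unfold zhPiece at hx; split_ifs at hx <;> simp at hx <;> tauto
  have hy' : y = zhUnder t f ∨ y = f.relabel (3 * ·) := by
    unfold zhPiece at hy; split_ifs at hy <;> simp at hy <;> tauto
  rcases hx' with rfl | rfl <;> rcases hy' with rfl | rfl
  · exact zhUnder_key_inj h
  · exfalso
    simp only [zhUnder, Endpoint.key, Endpoint.relabel, Prod.mk.injEq] at h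
    have := h.1
    split_ifs at this <;> omega
  · exfalso
    simp only [zhUnder, Endpoint.key, Endpoint.relabel, Prod.mk.injEq] at h
    have := h.1
    split_ifs at this <;> omega
  · simp only [Endpoint.key, Endpoint.relabel, Prod.mk.injEq] at h ⊢
    exact ⟨by omega, h.2⟩

theorem zhPiece_nodup (s : Side) (e : Endpoint) :
    ((zhPiece s e).map Endpoint.key).Nodup := by
  have : (zhUnder s e).label ≠ (e.relabel (3 * ·)).label := by
    simp only [zhUnder, Endpoint.relabel]
    split_ifs <;> omega
  unfold zhPiece
  split_ifs <;> simp [Endpoint.key, this, this.symm]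

theorem mem_zhOvers {D : VirtualLinkDiagram n} {side : ℕ → Side} {x : Endpoint} :
    x ∈ D.zhOvers side ↔ ∃ i, ∃ e ∈ D.word i, (zhUnder (side e.label) e).partner = x := by
  simp only [zhOvers, List.mem_map, List.mem_flatten, List.mem_ofFn]
  constructor
  · rintro ⟨e, ⟨_, ⟨i, rfl⟩, he⟩, rfl⟩
    exact ⟨i, e, he, rfl⟩
  · rintro ⟨i, e, he, rfl⟩
    exact ⟨e, ⟨_, ⟨i, rfl⟩, he⟩, rfl⟩

theorem zhOvers_nodup (D : VirtualLinkDiagram n) (side : ℕ → Side) :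
    ((D.zhOvers side).map Endpoint.key).Nodup := by
  have h : ((List.ofFn D.word).flatten.map Endpoint.key).Nodup := by
    rw [List.map_flatten, List.nodup_flatten]
    refine ⟨?_, ?_⟩
    · intro l hl
      simp only [List.mem_map, List.mem_ofFn] at hl
      obtain ⟨_, ⟨i, rfl⟩, rfl⟩ := hl
      exact D.nodup i
    · rw [List.map_ofFn, List.pairwise_ofFn]
      intro i j hij x hx hy
      obtain ⟨e, he, rfl⟩ := List.mem_map.1 hx
      obtain ⟨f, hf, hfe⟩ := List.mem_map.1 hy
      exact hij.ne (D.unique i j e he f hf hfe.symm)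
  rw [zhOvers, List.map_map]
  refine List.Nodup.map_on ?_ (List.Nodup.of_map _ h)
  intro e he f hf hef
  refine List.inj_on_of_nodup_map h he hf (zhUnder_key_inj (s := side e.label)
    (t := side f.label) ?_)
  simpa [Endpoint.key, Endpoint.partner, zhUnder] using hef

theorem mem_zhWord {D : VirtualLinkDiagram n} {side : ℕ → Side} {i : Fin n} {x : Endpoint}
    (hx : x ∈ (D.word i).flatMap (fun e => zhPiece (side e.label) e)) :
    ∃ e ∈ D.word i, x = zhUnder (side e.label) e ∨ x = e.relabel (3 * ·) := by
  obtain ⟨e, he, hx⟩ := List.mem_flatMap.1 hx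
  refine ⟨e, he, ?_⟩
  unfold zhPiece at hx
  split_ifs at hx <;> simp at hx <;> tauto

theorem mem_zhPiece (s : Side) (e : Endpoint) :
    zhUnder s e ∈ zhPiece s e ∧ e.relabel (3 * ·) ∈ zhPiece s e := by
  unfold zhPiece
  split_ifs <;> simp

theorem over_of_mem_zhOvers {D : VirtualLinkDiagram n} {side : ℕ → Side} {x : Endpoint}
    (hx : x ∈ D.zhOvers side) : x.isOver = true ∧ x.label % 3 ≠ 0 := by
  obtain ⟨i, e, -, rfl⟩ := mem_zhOvers.1 hx
  refine ⟨by simp [zhUnder, Endpoint.partner], ?_⟩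
  simp only [zhUnder, Endpoint.partner]
  split_ifs <;> omega

theorem zh_disjoint {D : VirtualLinkDiagram n} {side : ℕ → Side} {i : Fin n}
    {x y : Endpoint} (hx : x ∈ (D.word i).flatMap (fun e => zhPiece (side e.label) e))
    (hy : y ∈ D.zhOvers side) (h : x.key = y.key) : False := by
  obtain ⟨hy1, hy2⟩ := over_of_mem_zhOvers hy
  simp only [Endpoint.key, Prod.mk.injEq] at h
  obtain ⟨e, -, rfl | rfl⟩ := mem_zhWord hx
  · have := h.2
    simp [zhUnder, hy1] at this
  · have := h.1
    simp only [Endpoint.relabel] at this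
    omega

/-- The diagram `D ∪ ω^op`. For every classical crossing, `side` selects one of the two ways to
draw the new over-crossing arcs, and `ω` is the order in which these arcs are connected
to form the last component; all further crossings are virtual. (Reversing the last component
gives the `Zh`-construction with its original orientation.) -/
def zhOp (D : VirtualLinkDiagram n) (side : ℕ → Side) (ω : List Endpoint)
    (hω : ω.Perm (D.zhOvers side)) : VirtualLinkDiagram (n + 1) where
  word := Fin.snoc (α := fun _ => List Endpoint)
    (fun i => (D.word i).flatMap (fun e => zhPiece (side e.label) e)) ω
  nodup i := by
    induction i using Fin.lastCases with
    | last => simpa using ((hω.map Endpoint.key).nodup_iff).2 (D.zhOvers_nodup side)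
    | cast i =>
      simp only [Fin.snoc_castSucc, List.map_flatMap]
      rw [List.nodup_flatMap]
      refine ⟨fun e _ => zhPiece_nodup _ e, ?_⟩
      have := D.nodup i
      rw [List.Nodup, List.pairwise_map] at this
      refine this.imp ?_
      intro e f hef x hx hy
      obtain ⟨a, ha, rfl⟩ := List.mem_map.1 hx
      obtain ⟨b, hb, hba⟩ := List.mem_map.1 hy
      exact hef (key_of_mem_zhPiece ha hb hba.symm)
  unique i j e he f hf h := by
    induction i using Fin.lastCases with
    | last =>
      induction j using Fin.lastCases with
      | last => rfl
      | cast j =>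
        simp only [Fin.snoc_castSucc, Fin.snoc_last] at he hf
        exact (zh_disjoint hf (hω.mem_iff.1 he) h.symm).elim
    | cast i =>
      induction j using Fin.lastCases with
      | last =>
        simp only [Fin.snoc_castSucc, Fin.snoc_last] at he hf
        exact (zh_disjoint he (hω.mem_iff.1 hf) h).elim
      | cast j =>
        simp only [Fin.snoc_castSucc] at he hf
        obtain ⟨a, ha, hea⟩ := List.mem_flatMap.1 he
        obtain ⟨b, hb, hfb⟩ := List.mem_flatMap.1 hf
        rw [D.unique i j a ha b hb (key_of_mem_zhPiece hea hfb h)]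
  partner_mem i e he := by
    induction i using Fin.lastCases with
    | last =>
      simp only [Fin.snoc_last] at he
      obtain ⟨j, a, ha, rfl⟩ := mem_zhOvers.1 (hω.mem_iff.1 he)
      refine ⟨j.castSucc, ?_⟩
      simp only [Fin.snoc_castSucc]
      refine List.mem_flatMap.2 ⟨a, ha, ?_⟩
      simpa [Endpoint.partner] using (mem_zhPiece (side a.label) a).1
    | cast i =>
      simp only [Fin.snoc_castSucc] at he
      obtain ⟨a, ha, rfl | rfl⟩ := mem_zhWord he
      · refine ⟨Fin.last n, ?_⟩
        simp only [Fin.snoc_last]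
        exact hω.mem_iff.2 (mem_zhOvers.2 ⟨i, a, ha, rfl⟩)
      · obtain ⟨j, hj⟩ := D.partner_mem i a ha
        refine ⟨j.castSucc, ?_⟩
        simp only [Fin.snoc_castSucc]
        refine List.mem_flatMap.2 ⟨a.partner, hj, ?_⟩
        exact (mem_zhPiece (side a.label) a.partner).2

end VirtualLinkDiagram

/-! Call a diagram `E = D ∪ ω` an Alexander system for `D` if `ω` only passes over `D` and the arcs
of `D` carry integers that obey the Alexander rule at the crossings of `D` and change by the sign at
each passage under `ω`. The heart of the matter is that Alexander systems of equivalent diagrams are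
semi-welded equivalent (`Equivalent.semiWeldedEquivalent`). The construction `zhOp` is an Alexander
system for a renamed copy of `D`, and `D' ⊔ ○` is one as soon as `D'` has an Alexander numbering.
This gives the forward direction. For the converse, deleting the last component turns semi-welded
equivalence into equivalence (`SemiWeldedEquivalent.base`), and with a circle free of crossings the
labels of an Alexander system form an Alexander numbering.

Since over-crossings on `ω` commute, `E` is determined up to semi-welded equivalence by its
decorated words, which record for each passage under `ω` only its sign
(`Realizes.semiWeldedEquivalent`). Two moves act on these words. Adjacent opposite signs cancel by a
second Reidemeister move. Equal signs in front of both passages through a crossing of `D` slide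
behind them by a third one (`Reach.slide`).

By the Alexander rule, the label `μ` of the incoming lower arc determines all four labels at a
crossing of `D`. Given `μ`, the signs between consecutive passages have a prescribed sum, so the
decoration is unique up to cancellation and rotation (`red_of_path`). Sliding a sign through a
crossing changes `μ` there by one, so the choice of `μ` does not matter either (`reach_dec_dec`).
Hence any two Alexander systems of one diagram are semi-welded equivalent
(`Augments.semiWeldedEquivalent`).

It remains to follow a Reidemeister move of `D`. By uniqueness, the labels may be chosen so that no
sign stands between the neighbouring passages that take part in the move. Then the move can be
performed in the presence of `ω`, and the result is again an Alexander system
(`Omega1.exists_augments`, `Omega2.exists_augments`, `Omega3.exists_augments`). -/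

open List (IsRotated)

/-! ### Lists up to rotation -/

namespace List

variable {α β : Type*}

theorem isRotated_iff_exists_append {l l' : List α} :
    l ~r l' ↔ ∃ u v, l = u ++ v ∧ l' = v ++ u := by
  constructor
  · rintro ⟨k, rfl⟩
    exact ⟨l.take (k % l.length), l.drop (k % l.length), by simp,
      rotate_eq_drop_append_take_mod⟩
  · rintro ⟨u, v, rfl, rfl⟩
    exact isRotated_append

theorem IsRotated.filter {l l' : List α} (h : l ~r l') (p : α → Bool) :
    l.filter p ~r l'.filter p := by
  obtain ⟨u, v, rfl, rfl⟩ := isRotated_iff_exists_append.1 h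
  simpa using isRotated_append

theorem IsRotated.flatMap {l l' : List α} (h : l ~r l') (f : α → List β) :
    l.flatMap f ~r l'.flatMap f := by
  obtain ⟨u, v, rfl, rfl⟩ := isRotated_iff_exists_append.1 h
  simpa using isRotated_append

/-- Without repetitions, a cyclic list can be cut open in front of `x` in one way only. -/
theorem Nodup.eq_of_cons_isRotated_cons {x : α} {t t' : List α} (hd : (x :: t).Nodup)
    (h : (x :: t) ~r (x :: t')) : t = t' := by
  obtain ⟨u, v, h1, h2⟩ := isRotated_iff_exists_append.1 h
  rcases u with _ | ⟨y, u⟩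
  · exact (List.cons.inj (h1.trans (by simpa using h2.symm))).2
  · rcases v with _ | ⟨z, v⟩
    · simp_all
    · simp only [cons_append, cons.injEq] at h1 h2
      obtain ⟨rfl, rfl⟩ := h1
      obtain ⟨rfl, -⟩ := h2
      simp at hd

theorem map_eq_self {f : α → α} {l : List α} (h : ∀ x ∈ l, f x = x) : l.map f = l := by
  simpa using map_congr_left (f := f) (g := id) h

theorem map_swap_cons_cons [DecidableEq α] {x y : α} {t : List α}
    (hd : (x :: y :: t).Nodup) : (x :: y :: t).map (Equiv.swap x y) = y :: x :: t := by
  simp only [nodup_cons, mem_cons, not_or] at hd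
  simp only [map_cons, Equiv.swap_apply_left, Equiv.swap_apply_right, cons.injEq, true_and]
  refine map_eq_self fun z hz => Equiv.swap_apply_of_ne_of_ne ?_ ?_
  · rintro rfl; exact hd.1.2 hz
  · rintro rfl; exact hd.2.1 hz

theorem map_swap_eq_self [DecidableEq α] {x y : α} {l : List α} (hx : x ∉ l) (hy : y ∉ l) :
    l.map (Equiv.swap x y) = l := by
  refine map_eq_self fun z hz => Equiv.swap_apply_of_ne_of_ne ?_ ?_
  · rintro rfl; exact hx hz
  · rintro rfl; exact hy hz

/-- Exchanging two cyclically adjacent entries, at most one of which satisfies `p`, does not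
change the cyclic order of the entries that satisfy `p`. -/
theorem filter_map_swap_isRotated [DecidableEq α] {x y : α} {l t : List α} (hd : l.Nodup)
    (h : l ~r (x :: y :: t)) (p : α → Bool) (hp : ¬ (p x = true ∧ p y = true)) :
    (l.map (Equiv.swap x y)).filter p ~r l.filter p := by
  have h1 := (h.map (Equiv.swap x y)).filter p
  rw [map_swap_cons_cons (h.nodup_iff.1 hd)] at h1
  refine h1.trans ?_
  refine IsRotated.trans ?_ (h.filter p).symm
  have : (y :: x :: t).filter p = (x :: y :: t).filter p := by
    rcases hx : p x <;> rcases hy : p y <;> simp_all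
  rw [this]

end List

/-- An injection defined on a finite set of natural numbers extends to a permutation. -/
theorem exists_perm_extending (S : Finset ℕ) (g : ℕ → ℕ) (hg : Set.InjOn g S) :
    ∃ f : Equiv.Perm ℕ, ∀ x ∈ S, f x = g x := by
  -- With `N` above `S` and its image, the extension takes place inside the finite set `Fin N`; the
  -- permutation is the identity from `N` on.
  obtain ⟨N, hN⟩ : ∃ N, ∀ x ∈ S ∪ S.image g, x < N :=
    ⟨(S ∪ S.image g).sup id + 1, fun x hx => Nat.lt_succ_of_le (Finset.le_sup (f := id) hx)⟩
  let S' : Finset (Fin N) := Finset.univ.filter (fun k => (k : ℕ) ∈ S)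
  let g' : Fin N → Fin N := fun k => if h : (k : ℕ) ∈ S then
    ⟨g k, hN _ (Finset.mem_union_right _ (Finset.mem_image_of_mem _ h))⟩ else k
  have hg' : Set.InjOn g' S' := by
    intro a ha b hb hab
    simp only [S', Finset.coe_filter, Finset.mem_univ, true_and, Set.mem_ofPred_eq] at ha hb
    simp only [g', ha, hb, dif_pos, Fin.mk.injEq] at hab
    exact Fin.ext (hg ha hb hab)
  obtain ⟨e, he⟩ := Finset.exists_equiv_extend_of_card_eq (t := Finset.univ) (by simp)
    (s := S') (f := g') (by intro x _; simp) hg'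
  let e₂ : Equiv.Perm (Fin N) := e.trans (Equiv.subtypeUnivEquiv (by simp))
  refine ⟨e₂.viaFintypeEmbedding ⟨Fin.val, Fin.val_injective⟩, fun x hx => ?_⟩
  have hx' : x < N := hN _ (Finset.mem_union_left _ hx)
  have := e₂.viaFintypeEmbedding_apply_image ⟨Fin.val, Fin.val_injective⟩ ⟨x, hx'⟩
  simp only [Function.Embedding.coeFn_mk] at this
  rw [this]
  have h2 : e₂ ⟨x, hx'⟩ = g' ⟨x, hx'⟩ := by
    simpa [e₂] using he ⟨x, hx'⟩ (by simp [S', hx])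
  rw [h2]
  simp [g', hx]

/-! ### Endpoints and Gauss diagrams: basic facts and constructions -/

namespace Endpoint

@[simp] theorem partner_partner (e : Endpoint) : e.partner.partner = e := by
  simp [partner]

@[simp] theorem label_partner (e : Endpoint) : e.partner.label = e.label := rfl
@[simp] theorem sign_partner (e : Endpoint) : e.partner.sign = e.sign := rfl
@[simp] theorem isOver_partner (e : Endpoint) : e.partner.isOver = !e.isOver := rfl
@[simp] theorem label_relabel (f : ℕ → ℕ) (e : Endpoint) : (e.relabel f).label = f e.label := rfl
@[simp] theorem sign_relabel (f : ℕ → ℕ) (e : Endpoint) : (e.relabel f).sign = e.sign := rfl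
@[simp] theorem isOver_relabel (f : ℕ → ℕ) (e : Endpoint) : (e.relabel f).isOver = e.isOver := rfl
theorem partner_relabel (f : ℕ → ℕ) (e : Endpoint) :
    (e.relabel f).partner = e.partner.relabel f := rfl

theorem partner_ne (e : Endpoint) : e.partner ≠ e := by
  intro h
  have := congrArg isOver h
  simp at this

theorem key_eq_or_key_partner_eq {e f : Endpoint} (h : e.label = f.label) :
    e.key = f.key ∨ e.key = f.partner.key := by
  rcases he : e.isOver <;> rcases hf : f.isOver <;> simp [key, h, he, hf]

end Endpoint

namespace VirtualLinkDiagram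

variable {n : ℕ}

theorem ext_word {D E : VirtualLinkDiagram n} (h : ∀ i, D.word i = E.word i) : D = E := by
  rcases D with ⟨w, _, _, _⟩
  rcases E with ⟨w', _, _, _⟩
  obtain rfl : w = w' := funext h
  rfl

/-- `e` occurs on one of the circles of `D`. -/
def Mem (D : VirtualLinkDiagram n) (e : Endpoint) : Prop := ∃ i, e ∈ D.word i

theorem nodup_word (D : VirtualLinkDiagram n) (i : Fin n) : (D.word i).Nodup :=
  List.Nodup.of_map _ (D.nodup i)

theorem Mem.partner {D : VirtualLinkDiagram n} {e : Endpoint} (h : D.Mem e) :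
    D.Mem e.partner := by
  obtain ⟨i, hi⟩ := h
  exact D.partner_mem i e hi

theorem Mem.eq_of_key {D : VirtualLinkDiagram n} {e f : Endpoint} (he : D.Mem e) (hf : D.Mem f)
    (h : e.key = f.key) : e = f := by
  obtain ⟨i, hi⟩ := he
  obtain ⟨j, hj⟩ := hf
  obtain rfl := D.unique i j e hi f hj h
  exact List.inj_on_of_nodup_map (D.nodup i) hi hj h

theorem Mem.eq_or_eq_partner {D : VirtualLinkDiagram n} {e f : Endpoint} (he : D.Mem e)
    (hf : D.Mem f) (h : e.label = f.label) : e = f ∨ e = f.partner :=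
  (Endpoint.key_eq_or_key_partner_eq h).imp (he.eq_of_key hf) (he.eq_of_key hf.partner)

theorem comp_unique {D : VirtualLinkDiagram n} {e : Endpoint} {i j : Fin n}
    (hi : e ∈ D.word i) (hj : e ∈ D.word j) : i = j :=
  D.unique i j e hi e hj rfl

theorem Adj.exists_mem {D : VirtualLinkDiagram n} {x y : Endpoint} (h : D.Adj x y) :
    ∃ i, x ∈ D.word i ∧ y ∈ D.word i := by
  obtain ⟨i, l, h⟩ := h
  exact ⟨i, h.mem_iff.2 (by simp), h.mem_iff.2 (by simp)⟩

theorem Adj.mem_left {D : VirtualLinkDiagram n} {x y : Endpoint} (h : D.Adj x y) : D.Mem x :=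
  let ⟨i, hx, _⟩ := h.exists_mem; ⟨i, hx⟩

theorem Adj.mem_right {D : VirtualLinkDiagram n} {x y : Endpoint} (h : D.Adj x y) : D.Mem y :=
  let ⟨i, _, hy⟩ := h.exists_mem; ⟨i, hy⟩

theorem Adj.mem_word_iff {D : VirtualLinkDiagram n} {x y : Endpoint} (h : D.Adj x y)
    (i : Fin n) : x ∈ D.word i ↔ y ∈ D.word i := by
  obtain ⟨j, hx, hy⟩ := h.exists_mem
  constructor <;> intro h'
  · obtain rfl := comp_unique hx h'; exact hy
  · obtain rfl := comp_unique hy h'; exact hx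

theorem AdjSigned.mem_word_iff {D : VirtualLinkDiagram n} {s : ℤˣ} {x y : Endpoint}
    (h : D.AdjSigned s x y) (i : Fin n) : x ∈ D.word i ↔ y ∈ D.word i := by
  unfold AdjSigned at h
  split_ifs at h
  · exact h.mem_word_iff i
  · exact (h.mem_word_iff i).symm

theorem AdjSigned.mem_left {D : VirtualLinkDiagram n} {s : ℤˣ} {x y : Endpoint}
    (h : D.AdjSigned s x y) : D.Mem x := by
  unfold AdjSigned at h
  split_ifs at h
  exacts [h.mem_left, h.mem_right]

theorem AdjSigned.mem_right {D : VirtualLinkDiagram n} {s : ℤˣ} {x y : Endpoint}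
    (h : D.AdjSigned s x y) : D.Mem y := by
  unfold AdjSigned at h
  split_ifs at h
  exacts [h.mem_right, h.mem_left]

/-- Rearrange the passages on each circle. -/
def ofPerm (E : VirtualLinkDiagram n) (W : Fin n → List Endpoint)
    (h : ∀ i, (W i).Perm (E.word i)) : VirtualLinkDiagram n where
  word := W
  nodup i := (((h i).map _).nodup_iff).2 (E.nodup i)
  unique i j e he f hf := E.unique i j e ((h i).mem_iff.1 he) f ((h j).mem_iff.1 hf)
  partner_mem i e he := by
    obtain ⟨j, hj⟩ := E.partner_mem i e ((h i).mem_iff.1 he)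
    exact ⟨j, (h j).mem_iff.2 hj⟩

/-- Delete all crossings whose name does not satisfy `p`. -/
def restrict (E : VirtualLinkDiagram n) (p : ℕ → Bool) : VirtualLinkDiagram n where
  word i := (E.word i).filter (fun e => p e.label)
  nodup i := (E.nodup i).sublist (List.filter_sublist.map _)
  unique i j e he f hf h := E.unique i j e (List.mem_filter.1 he).1 f (List.mem_filter.1 hf).1 h
  partner_mem i e he := by
    rw [List.mem_filter] at he
    obtain ⟨j, hj⟩ := E.partner_mem _ e he.1
    exact ⟨j, List.mem_filter.2 ⟨hj, he.2⟩⟩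

/-- Permute the endpoints. -/
def permute (E : VirtualLinkDiagram n) (σ : Equiv.Perm Endpoint)
    (hσ : ∀ e, E.Mem (σ e) ↔ E.Mem e) : VirtualLinkDiagram n where
  word i := (E.word i).map σ
  nodup i := by
    rw [List.map_map]
    refine List.Nodup.map_on ?_ (E.nodup_word i)
    intro x hx y hy h
    exact σ.injective (((hσ x).2 ⟨i, hx⟩).eq_of_key ((hσ y).2 ⟨i, hy⟩) h)
  unique i j e he f hf h := by
    obtain ⟨x, hx, rfl⟩ := List.mem_map.1 he
    obtain ⟨y, hy, rfl⟩ := List.mem_map.1 hf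
    obtain rfl := σ.injective (((hσ x).2 ⟨i, hx⟩).eq_of_key ((hσ y).2 ⟨j, hy⟩) h)
    exact comp_unique hx hy
  partner_mem i e he := by
    obtain ⟨x, hx, rfl⟩ := List.mem_map.1 he
    have h1 : E.Mem (σ x).partner := ((hσ x).2 ⟨i, hx⟩).partner
    obtain ⟨j, hj⟩ := (hσ (σ.symm (σ x).partner)).1 (by simpa using h1)
    exact ⟨j, List.mem_map.2 ⟨_, hj, by simp⟩⟩

/-- Rename the crossings. -/
def rename (E : VirtualLinkDiagram n) (f : Equiv.Perm ℕ) : VirtualLinkDiagram n where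
  word i := (E.word i).map (Endpoint.relabel f)
  nodup i := by
    rw [List.map_map]
    refine List.Nodup.map_on ?_ (E.nodup_word i)
    intro x hx y hy h
    refine Mem.eq_of_key ⟨i, hx⟩ ⟨i, hy⟩ ?_
    simpa [Endpoint.key] using h
  unique i j e he f' hf h := by
    obtain ⟨x, hx, rfl⟩ := List.mem_map.1 he
    obtain ⟨y, hy, rfl⟩ := List.mem_map.1 hf
    exact E.unique i j x hx y hy (by simpa [Endpoint.key] using h)
  partner_mem i e he := by
    obtain ⟨x, hx, rfl⟩ := List.mem_map.1 he
    obtain ⟨j, hj⟩ := E.partner_mem i x hx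
    exact ⟨j, List.mem_map.2 ⟨_, hj, rfl⟩⟩

theorem Iso.of_isRotated {D E : VirtualLinkDiagram n} (h : ∀ i, E.word i ~r D.word i) :
    Iso D E := by
  refine ⟨1, fun i => ?_⟩
  have : (Endpoint.relabel ⇑(1 : Equiv.Perm ℕ)) = id := by
    funext e; rfl
  rw [this, List.map_id]
  exact h i

theorem iso_rename (E : VirtualLinkDiagram n) (f : Equiv.Perm ℕ) : Iso E (E.rename f) :=
  ⟨f, fun _ => List.IsRotated.refl _⟩

theorem Iso.symm {D E : VirtualLinkDiagram n} (h : Iso D E) : Iso E D := by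
  obtain ⟨f, h⟩ := h
  refine ⟨f.symm, fun i => ?_⟩
  have := (h i).map (Endpoint.relabel f.symm)
  rw [List.map_map] at this
  have h2 : Endpoint.relabel f.symm ∘ Endpoint.relabel f = id := by
    funext e; simp [Endpoint.relabel]
  rw [h2, List.map_id] at this
  exact this.symm

theorem exists_label_lt (E : VirtualLinkDiagram n) : ∃ N, ∀ e, E.Mem e → e.label < N := by
  refine ⟨(Finset.univ.biUnion fun i => ((E.word i).map Endpoint.label).toFinset).sup id + 1,
    fun e ⟨i, he⟩ => Nat.lt_succ_of_le (Finset.le_sup (f := id) ?_)⟩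
  simp only [Finset.mem_biUnion, Finset.mem_univ, true_and, List.mem_toFinset, List.mem_map]
  exact ⟨i, e, he, rfl⟩

/-! ### Deleting the last component -/

/-- `l` is the name of a crossing in which the last component takes part. -/
def LastLabel (E : VirtualLinkDiagram (n + 1)) (l : ℕ) : Prop :=
  l ∈ (E.word (Fin.last n)).map Endpoint.label

theorem lastLabel_iff {E : VirtualLinkDiagram (n + 1)} {e : Endpoint} (he : E.Mem e) :
    E.LastLabel e.label ↔ e ∈ E.word (Fin.last n) ∨ e.partner ∈ E.word (Fin.last n) := by
  unfold LastLabel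
  rw [List.mem_map]
  constructor
  · rintro ⟨z, hz, hl⟩
    rcases Mem.eq_or_eq_partner ⟨_, hz⟩ he hl with rfl | rfl
    exacts [Or.inl hz, Or.inr hz]
  · rintro (h | h)
    exacts [⟨_, h, rfl⟩, ⟨_, h, rfl⟩]

theorem mem_base_word {E : VirtualLinkDiagram (n + 1)} {i : Fin n} {e : Endpoint} :
    e ∈ E.base.word i ↔ e ∈ E.word i.castSucc ∧ ¬ E.LastLabel e.label := by
  simp [base, LastLabel]

theorem base_word_congr {D E : VirtualLinkDiagram (n + 1)}
    (h : ∀ l, D.LastLabel l ↔ E.LastLabel l) (i : Fin n) :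
    D.base.word i = (D.word i.castSucc).filter
      (fun e => e.label ∉ (E.word (Fin.last n)).map Endpoint.label) := by
  refine List.filter_congr fun e _ => ?_
  have := h e.label
  unfold LastLabel at this
  simp only [this]

theorem Adj.base {E : VirtualLinkDiagram (n + 1)} {x y : Endpoint} (h : E.Adj x y)
    (hx : ¬ E.LastLabel x.label) (hy : ¬ E.LastLabel y.label) : E.base.Adj x y := by
  obtain ⟨i, l, hl⟩ := h
  induction i using Fin.lastCases with
  | last => exact absurd (List.mem_map.2 ⟨x, hl.mem_iff.2 (by simp), rfl⟩) hx
  | cast i =>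
    unfold LastLabel at hx hy
    refine ⟨i, l.filter
      (fun e => e.label ∉ (E.word (Fin.last n)).map Endpoint.label), ?_⟩
    have := hl.filter (fun e => e.label ∉ (E.word (Fin.last n)).map Endpoint.label)
    rwa [List.filter_cons_of_pos (by simpa using hx), List.filter_cons_of_pos (by simpa using hy)]
      at this

theorem AdjSigned.base {E : VirtualLinkDiagram (n + 1)} {s : ℤˣ} {x y : Endpoint}
    (h : E.AdjSigned s x y)
    (hx : ¬ E.LastLabel x.label) (hy : ¬ E.LastLabel y.label) : E.base.AdjSigned s x y := by
  unfold AdjSigned at h ⊢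
  split_ifs at h ⊢
  exacts [h.base hx hy, h.base hy hx]

theorem base_word_of_filter {D E : VirtualLinkDiagram (n + 1)} {p : ℕ → Bool}
    (h : ∀ i, D.word i = (E.word i).filter (fun e => p e.label)) (i : Fin n) :
    D.base.word i = (E.base.word i).filter (fun e => p e.label) := by
  simp only [base, h, List.filter_filter]
  refine List.filter_congr fun e _ => ?_
  rcases hp : p e.label
  · simp
  · simp only [Bool.and_true, Bool.true_and, decide_eq_decide, not_iff_not, List.mem_map,
      List.mem_filter]
    refine exists_congr fun z => ⟨fun hz => ⟨hz.1.1, hz.2⟩, fun hz => ⟨⟨hz.1, ?_⟩, hz.2⟩⟩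
    rw [hz.2]
    exact hp

theorem base_eq_of_filter {D E : VirtualLinkDiagram (n + 1)} {p : ℕ → Bool}
    (h : ∀ i, D.word i = (E.word i).filter (fun e => p e.label))
    (hp : ∀ l, ¬ E.LastLabel l → p l = true) : D.base = E.base := by
  refine ext_word fun i => ?_
  rw [base_word_of_filter h, List.filter_eq_self]
  intro e he
  exact hp _ (mem_base_word.1 he).2

theorem Iso.base {D E : VirtualLinkDiagram (n + 1)} (h : Iso D E) : Iso D.base E.base := by
  obtain ⟨f, h⟩ := h
  refine ⟨f, fun i => ?_⟩
  refine ((h i.castSucc).filter _).trans ?_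
  rw [List.filter_map]
  have : (D.word i.castSucc).filter ((fun e => decide (e.label ∉
      (E.word (Fin.last n)).map Endpoint.label)) ∘ Endpoint.relabel f) = D.base.word i := by
    refine List.filter_congr fun e _ => ?_
    simp only [Function.comp, decide_eq_decide, not_iff_not]
    rw [((h (Fin.last n)).map Endpoint.label).mem_iff]
    simp
  rw [this]

theorem Omega1.base {D E : VirtualLinkDiagram (n + 1)} (h : Omega1 D E) :
    Equivalent D.base E.base := by
  obtain ⟨x, hx, h⟩ := h
  by_cases hl : E.LastLabel x.label
  · rw [base_eq_of_filter (p := fun l => decide (l ≠ x.label)) h fun l hl' => ?_]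
    · exact .refl _
    · simp only [decide_eq_true_eq]; rintro rfl; exact hl' hl
  · exact .rel _ _ (Or.inr (Or.inl ⟨x, hx.base hl hl,
      base_word_of_filter (p := fun l => decide (l ≠ x.label)) h⟩))

/-- The two tails lie on one component and so do the two heads. So the last component takes part in
both crossings, and the move disappears, or in neither, and the move survives. -/
theorem Omega2.base {D E : VirtualLinkDiagram (n + 1)} (h : Omega2 D E) :
    Equivalent D.base E.base := by
  obtain ⟨a, b, ha, hb, hab, hs, h1, h2, h⟩ := h
  have hp : ∀ i, a.partner ∈ E.word i ↔ b.partner ∈ E.word i := fun i =>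
    h2.elim (fun h => h.mem_word_iff i) (fun h => (h.mem_word_iff i).symm)
  have hl : E.LastLabel a.label ↔ E.LastLabel b.label := by
    rw [lastLabel_iff h1.mem_left, lastLabel_iff h1.mem_right, h1.mem_word_iff, hp]
  by_cases hl' : E.LastLabel a.label
  · rw [base_eq_of_filter (p := fun l => decide (l ≠ a.label ∧ l ≠ b.label)) h fun l hl'' => ?_]
    · exact .refl _
    · simp only [decide_eq_true_eq]
      constructor <;> rintro rfl
      exacts [hl'' hl', hl'' (hl.1 hl')]
  · have hl'' := mt hl.2 hl'
    exact .rel _ _ (Or.inr (Or.inr (Or.inl ⟨a, b, ha, hb, hab, hs, h1.base hl' hl'',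
      h2.imp (fun h => h.base hl' hl'') (fun h => h.base hl'' hl'),
      base_word_of_filter (p := fun l => decide (l ≠ a.label ∧ l ≠ b.label)) h⟩)))

theorem AdjSigned.exists_isRotated {D : VirtualLinkDiagram n} {s : ℤˣ} {x y : Endpoint}
    (h : D.AdjSigned s x y) :
    ∃ i l, D.word i ~r (x :: y :: l) ∨ D.word i ~r (y :: x :: l) := by
  unfold AdjSigned at h
  split_ifs at h
  · obtain ⟨i, l, h⟩ := h; exact ⟨i, l, Or.inl h⟩
  · obtain ⟨i, l, h⟩ := h; exact ⟨i, l, Or.inr h⟩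

theorem ne_of_label_or_isOver {x y : Endpoint} (h : x.label ≠ y.label ∨ x.isOver ≠ y.isOver) :
    x ≠ y := by
  rintro rfl; simp at h

/-- A permutation of the endpoints that exchanges three disjoint pairs. -/
def swap3 (a a' b b' c c' : Endpoint) : Equiv.Perm Endpoint :=
  (Equiv.swap c c').trans ((Equiv.swap b b').trans (Equiv.swap a a'))

theorem swap3_apply (a a' b b' c c' e : Endpoint) :
    swap3 a a' b b' c c' e =
      Equiv.swap a a' (Equiv.swap b b' (Equiv.swap c c' e)) := rfl

/-- The permutation `σ` stands for exchanges already carried out elsewhere on the word; this allows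
the three exchanges of a third Reidemeister move to be removed one after another. -/
theorem filter_map_swap_isRotated {D : VirtualLinkDiagram n} {s : ℤˣ} {x y : Endpoint}
    (h : D.AdjSigned s x y) (i : Fin n) (σ : Equiv.Perm Endpoint) (hx : σ x = x) (hy : σ y = y)
    (p : Endpoint → Bool) (hp : ¬ (p x = true ∧ p y = true)) :
    (((D.word i).map σ).map (Equiv.swap x y)).filter p ~r ((D.word i).map σ).filter p := by
  have hd : ((D.word i).map σ).Nodup := (D.nodup_word i).map σ.injective
  by_cases hi : x ∈ D.word i
  · have hr : ∃ l, D.word i ~r (x :: y :: l) ∨ D.word i ~r (y :: x :: l) := by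
      obtain ⟨j, l, hl⟩ := h.exists_isRotated
      have : x ∈ D.word j := by
        rcases hl with hl | hl <;> exact hl.mem_iff.2 (by simp)
      obtain rfl := comp_unique hi this
      exact ⟨l, hl⟩
    obtain ⟨l, hl | hl⟩ := hr
    · refine List.filter_map_swap_isRotated hd (t := l.map σ) ?_ p hp
      simpa [hx, hy] using hl.map σ
    · rw [Equiv.swap_comm]
      refine List.filter_map_swap_isRotated hd (t := l.map σ) ?_ p (fun h => hp h.symm)
      simpa [hx, hy] using hl.map σ
  · rw [List.map_swap_eq_self]
    · intro h'
      rw [← hx] at h'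
      exact hi ((List.mem_map_of_injective σ.injective).1 h')
    · intro h'
      rw [← hy] at h'
      exact hi ((h.mem_word_iff i).2 ((List.mem_map_of_injective σ.injective).1 h'))

theorem mem_map_swap {α : Type*} [DecidableEq α] {x y e : α} {l : List α} (h : x ∈ l ↔ y ∈ l) :
    Equiv.swap x y e ∈ l ↔ e ∈ l := by
  rw [Equiv.swap_apply_def]
  split_ifs with h1 h2
  · subst h1; exact h.symm
  · subst h2; exact h
  · rfl

theorem not_lastLabel_swap {D : VirtualLinkDiagram (n + 1)} {x y z : Endpoint}
    (hx : ¬ D.LastLabel x.label) (hy : ¬ D.LastLabel y.label) (hz : ¬ D.LastLabel z.label) :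
    ¬ D.LastLabel (Equiv.swap x y z).label := by
  rw [Equiv.swap_apply_def]
  split_ifs <;> assumption

theorem lastLabel_swap_iff {D : VirtualLinkDiagram (n + 1)} {a b c : Endpoint}
    (na : ¬ D.LastLabel a.label) (nb : ¬ D.LastLabel b.label) (nc : ¬ D.LastLabel c.label)
    (e : Endpoint) : D.LastLabel (Equiv.swap a b (Equiv.swap a.partner c
      (Equiv.swap b.partner c.partner e))).label ↔ D.LastLabel e.label := by
  by_cases he' : e = a ∨ e = b ∨ e = a.partner ∨ e = c ∨ e = b.partner ∨ e = c.partner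
  · have e1 : ¬ D.LastLabel e.label := by
      rcases he' with rfl | rfl | rfl | rfl | rfl | rfl <;> assumption
    refine iff_of_false (not_lastLabel_swap na nb ?_) e1
    refine not_lastLabel_swap (by exact na) nc ?_
    exact not_lastLabel_swap (by exact nb) (by exact nc) e1
  · simp only [not_or] at he'
    rw [Equiv.swap_apply_of_ne_of_ne (x := e) he'.2.2.2.2.1 he'.2.2.2.2.2,
      Equiv.swap_apply_of_ne_of_ne (x := e) he'.2.2.1 he'.2.2.2.1,
      Equiv.swap_apply_of_ne_of_ne (x := e) he'.1 he'.2.1]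

/-- The two passages on each strand of the triangle lie on the same component. If one of the three
crossings involves the last component, then so does a second one (`hA`, `hB`, `hC`). Hence either
the whole triangle survives, or at most one of its crossings does. In the latter case each exchange
involves at most one surviving passage and leaves the cyclic orders unchanged. -/
theorem Omega3.base {D E : VirtualLinkDiagram (n + 1)} (h : Omega3 D E) :
    Equivalent D.base E.base := by
  obtain ⟨a, b, c, ha, hb, hc, hab, hac, hbc, ⟨δ, h1, h2, h3⟩, h⟩ := h
  have hE : ∀ i, E.word i = (D.word i).map (swap3 a b a.partner c b.partner c.partner) := h
  have hm : ∀ i e, swap3 a b a.partner c b.partner c.partner e ∈ D.word i ↔ e ∈ D.word i := by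
    intro i e
    rw [swap3_apply, mem_map_swap (h1.mem_word_iff i), mem_map_swap (h2.mem_word_iff i),
      mem_map_swap (h3.mem_word_iff i)]
  have hme : ∀ i e, e ∈ E.word i ↔ e ∈ D.word i := by
    intro i e
    rw [hE, List.mem_map]
    constructor
    · rintro ⟨z, hz, rfl⟩; exact (hm i z).2 hz
    · intro he
      exact ⟨(swap3 a b a.partner c b.partner c.partner).symm e,
        (hm i _).1 (by simpa using he), by simp⟩
  have hL : ∀ l, E.LastLabel l ↔ D.LastLabel l := by
    intro l
    unfold LastLabel
    simp only [List.mem_map, hme]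
  have ka := lastLabel_iff h1.mem_left
  have kb := lastLabel_iff h1.mem_right
  have kc := lastLabel_iff h2.mem_right
  have hA : D.LastLabel a.label → D.LastLabel b.label ∨ D.LastLabel c.label := fun h =>
    (ka.1 h).imp (fun h => kb.2 (.inl ((h1.mem_word_iff _).1 h)))
      (fun h => kc.2 (.inl ((h2.mem_word_iff _).1 h)))
  have hB : D.LastLabel b.label → D.LastLabel a.label ∨ D.LastLabel c.label := fun h =>
    (kb.1 h).imp (fun h => ka.2 (.inl ((h1.mem_word_iff _).2 h)))
      (fun h => kc.2 (.inr ((h3.mem_word_iff _).1 h)))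
  have hC : D.LastLabel c.label → D.LastLabel a.label ∨ D.LastLabel b.label := fun h =>
    (kc.1 h).imp (fun h => ka.2 (.inr ((h2.mem_word_iff _).2 h)))
      (fun h => kb.2 (.inr ((h3.mem_word_iff _).2 h)))
  clear ka kb kc
  by_cases hn : ¬ D.LastLabel a.label ∧ ¬ D.LastLabel b.label ∧ ¬ D.LastLabel c.label
  · obtain ⟨na, nb, nc⟩ := hn
    refine .rel _ _ (Or.inr (Or.inr (Or.inr ⟨a, b, c, ha, hb, hc, hab, hac, hbc,
      ⟨δ, h1.base na nb, h2.base na nc, h3.base nb nc⟩, fun i => ?_⟩)))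
    rw [base_word_congr hL, h, List.filter_map]
    refine congrArg _ (List.filter_congr fun e he => ?_)
    have := lastLabel_swap_iff na nb nc e
    unfold LastLabel at this
    simp only [Function.comp, this]
  · refine .rel _ _ (Or.inl (Iso.of_isRotated fun i => ?_))
    have ab : ¬ (¬ D.LastLabel a.label ∧ ¬ D.LastLabel b.label) := fun hh =>
      hn ⟨hh.1, hh.2, fun hc => (hC hc).elim hh.1 hh.2⟩
    have ac : ¬ (¬ D.LastLabel a.label ∧ ¬ D.LastLabel c.label) := fun hh =>
      hn ⟨hh.1, fun hb => (hB hb).elim hh.1 hh.2, hh.2⟩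
    have bc : ¬ (¬ D.LastLabel b.label ∧ ¬ D.LastLabel c.label) := fun hh =>
      hn ⟨fun ha => (hA ha).elim hh.1 hh.2, hh.1, hh.2⟩
    rw [base_word_congr hL, h]
    set p : Endpoint → Bool :=
      fun e => e.label ∉ (D.word (Fin.last n)).map Endpoint.label with hp
    have hpx : ∀ e, p e = true ↔ ¬ D.LastLabel e.label := by
      intro e; simp [hp, LastLabel]
    have e1 : (D.word i.castSucc).map (fun e => Equiv.swap a b (Equiv.swap a.partner c
        (Equiv.swap b.partner c.partner e))) =
        (((D.word i.castSucc).map ((Equiv.swap b.partner c.partner).trans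
          (Equiv.swap a.partner c))).map (Equiv.swap a b)) := by
      rw [List.map_map]; rfl
    have e2 : (D.word i.castSucc).map ((Equiv.swap b.partner c.partner).trans
          (Equiv.swap a.partner c)) = ((D.word i.castSucc).map (Equiv.swap b.partner c.partner)).map
          (Equiv.swap a.partner c) := by
      rw [List.map_map]; rfl
    have e3 : (D.word i.castSucc).map (Equiv.swap b.partner c.partner) =
        ((D.word i.castSucc).map (1 : Equiv.Perm Endpoint)).map
          (Equiv.swap b.partner c.partner) := by
      rw [List.map_map]; rfl
    have oc : ∀ x y : Endpoint, x.isOver = true → y.isOver = true → x ≠ y.partner :=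
      fun x y hx hy => ne_of_label_or_isOver (Or.inr (by simp [hx, hy]))
    have nl : ∀ x y : Endpoint, x.label ≠ y.label → x ≠ y :=
      fun x y hx => ne_of_label_or_isOver (Or.inl hx)
    rw [e1]
    refine (filter_map_swap_isRotated h1 _ _ ?_ ?_ p ?_).trans ?_
    · simp only [Equiv.trans_apply]
      rw [Equiv.swap_apply_of_ne_of_ne (oc _ _ ha hb) (oc _ _ ha hc),
        Equiv.swap_apply_of_ne_of_ne (oc _ _ ha ha) (nl _ _ hac)]
    · simp only [Equiv.trans_apply]
      rw [Equiv.swap_apply_of_ne_of_ne (oc _ _ hb hb) (oc _ _ hb hc),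
        Equiv.swap_apply_of_ne_of_ne (oc _ _ hb ha) (nl _ _ hbc)]
    · simpa only [hpx] using ab
    rw [e2]
    refine (filter_map_swap_isRotated h2 _ _ ?_ ?_ p ?_).trans ?_
    · exact Equiv.swap_apply_of_ne_of_ne (nl _ _ hab) (nl _ _ hac)
    · exact Equiv.swap_apply_of_ne_of_ne (oc _ _ hc hb) (oc _ _ hc hc)
    · simpa only [hpx, Endpoint.label_partner] using ac
    rw [e3]
    refine (filter_map_swap_isRotated h3 _ 1 rfl rfl p ?_).trans ?_
    · simpa only [hpx, Endpoint.label_partner] using bc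
    · have : (⇑(1 : Equiv.Perm Endpoint)) = id := rfl
      rw [this, List.map_id]; exact List.IsRotated.refl _

theorem OmegaOCC.base {D E : VirtualLinkDiagram (n + 1)} (h : OmegaOCC D E) :
    E.base = D.base := by
  obtain ⟨a, b, ha, hb, ⟨l, hl⟩, h⟩ := h
  have hal : a ∈ D.word (Fin.last n) := hl.mem_iff.2 (by simp)
  have hbl : b ∈ D.word (Fin.last n) := hl.mem_iff.2 (by simp)
  have hL : ∀ l, E.LastLabel l ↔ D.LastLabel l := by
    intro l
    unfold LastLabel
    rw [h]
    simp only [List.mem_map, exists_exists_and_eq_and]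
    constructor
    · rintro ⟨z, hz, rfl⟩
      exact ⟨_, (mem_map_swap (iff_of_true hal hbl)).2 hz, rfl⟩
    · rintro ⟨z, hz, rfl⟩
      exact ⟨_, (mem_map_swap (iff_of_true hal hbl)).2 hz, by simp⟩
  refine ext_word fun i => ?_
  rw [base_word_congr hL, h, List.map_swap_eq_self]
  · rfl
  · intro hc; exact (Fin.castSucc_lt_last i).ne (comp_unique hc hal)
  · intro hc; exact (Fin.castSucc_lt_last i).ne (comp_unique hc hbl)

/-- Semi-welded equivalent diagrams become equivalent when the last component is deleted. -/
theorem SemiWeldedEquivalent.base {D E : VirtualLinkDiagram (n + 1)}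
    (h : SemiWeldedEquivalent D E) : Equivalent D.base E.base := by
  induction h with
  | rel D E h =>
    rcases h with (h | h | h | h) | h
    · exact .rel _ _ (Or.inl h.base)
    · exact h.base
    · exact h.base
    · exact h.base
    · rw [h.base]; exact .refl _
  | refl D => exact .refl _
  | symm D E _ ih => exact .symm _ _ ih
  | trans D E F _ _ ih1 ih2 => exact .trans _ _ _ ih1 ih2

theorem base_split (D : VirtualLinkDiagram n) : D.split.base = D := by
  refine ext_word fun i => ?_
  simp [base, split]

/-- Isomorphisms rename by permutations of `ℕ`, which `c ↦ 3 * c` is not; only the finitely many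
names in use matter. -/
theorem exists_perm_extending (D : VirtualLinkDiagram n) (g : ℕ → ℕ) (hg : g.Injective) :
    ∃ f : Equiv.Perm ℕ, ∀ e, D.Mem e → f e.label = g e.label := by
  obtain ⟨N, hN⟩ := D.exists_label_lt
  obtain ⟨f, hf⟩ := _root_.exists_perm_extending (Finset.range N) g hg.injOn
  exact ⟨f, fun e he => hf _ (Finset.mem_range.2 (hN e he))⟩

/-- The names divisible by 3 are those of the old crossings, and all the others belong to crossings
with `ω`. -/
theorem base_zhOp_word (D : VirtualLinkDiagram n) (side : ℕ → Side) (ω : List Endpoint)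
    (hω : ω.Perm (D.zhOvers side)) (i : Fin n) :
    (D.zhOp side ω hω).base.word i = (D.word i).map (Endpoint.relabel (3 * ·)) := by
  have hlast : (D.zhOp side ω hω).word (Fin.last n) = ω := by simp [zhOp]
  have hcast : (D.zhOp side ω hω).word i.castSucc =
    (D.word i).flatMap (fun e => zhPiece (side e.label) e) := by simp [zhOp]
  simp only [base, hlast, hcast, List.filter_flatMap, List.map_eq_flatMap]
  refine List.flatMap_congr fun e he => ?_
  have h1 : (zhUnder (side e.label) e).label ∈ ω.map Endpoint.label :=
    List.mem_map.2 ⟨_, hω.mem_iff.2 (mem_zhOvers.2 ⟨i, e, he, rfl⟩), rfl⟩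
  have h2 : (e.relabel (3 * ·)).label ∉ ω.map Endpoint.label := by
    intro h
    obtain ⟨z, hz, hl⟩ := List.mem_map.1 h
    have := (over_of_mem_zhOvers (hω.mem_iff.1 hz)).2
    rw [hl] at this
    simp at this
  unfold zhPiece
  split_ifs
  · rw [List.filter_cons_of_neg (by simpa [eq_comm] using h1), List.filter_cons_of_pos (by simpa [eq_comm] using h2),
      List.filter_nil]
  · rw [List.filter_cons_of_pos (by simpa [eq_comm] using h2), List.filter_cons_of_neg (by simpa [eq_comm] using h1),
      List.filter_nil]

theorem iso_base_zhOp (D : VirtualLinkDiagram n) (side : ℕ → Side) (ω : List Endpoint)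
    (hω : ω.Perm (D.zhOvers side)) : Iso D (D.zhOp side ω hω).base := by
  obtain ⟨f, hf⟩ := D.exists_perm_extending (3 * ·) (fun a b h => by simpa using h)
  refine ⟨f, fun i => ?_⟩
  rw [base_zhOp_word]
  have : (D.word i).map (Endpoint.relabel (3 * ·)) = (D.word i).map (Endpoint.relabel f) :=
    List.map_congr_left fun e he => by
      simp [Endpoint.relabel, hf e ⟨i, he⟩]
  rw [this]

/-! ### Decorated words

If all passages along the last component `ω` are over-crossings, then up to semi-welded equivalence
only the signs of the passages under `ω` matter, not their names nor their order along `ω`. -/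

/-- A letter of a decorated word: a passage through a crossing of the base diagram, or a passage
under the last component at a crossing with the given sign. -/
abbrev Letter : Type := Endpoint ⊕ ℤˣ

instance (E : VirtualLinkDiagram (n + 1)) : DecidablePred E.LastLabel :=
  fun l => inferInstanceAs (Decidable (l ∈ (E.word (Fin.last n)).map Endpoint.label))

/-- The letter of a passage along one of the base components. -/
def letter (E : VirtualLinkDiagram (n + 1)) (e : Endpoint) : Letter :=
  if E.LastLabel e.label then Sum.inr e.sign else Sum.inl e

/-- All passages along the last component of `E` are over-crossings, and the decorated words of
the other components are `w`. -/
structure Realizes (E : VirtualLinkDiagram (n + 1)) (w : Fin n → List Letter) : Prop where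
  isOver : ∀ e ∈ E.word (Fin.last n), e.isOver = true
  word : ∀ i, (E.word i.castSucc).map E.letter = w i

/-- Every diagram with decorated words `w` is semi-welded equivalent to one with decorated
words `w'`. -/
def Reach (w w' : Fin n → List Letter) : Prop :=
  ∀ E, Realizes E w → ∃ E', SemiWeldedEquivalent E E' ∧ Realizes E' w'

theorem Reach.refl (w : Fin n → List Letter) : Reach w w := fun E h => ⟨E, .refl _, h⟩

theorem Reach.trans {w w' w'' : Fin n → List Letter} (h : Reach w w') (h' : Reach w' w'') :
    Reach w w'' := by
  intro E hE
  obtain ⟨E', h1, h2⟩ := h E hE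
  obtain ⟨E'', h3, h4⟩ := h' E' h2
  exact ⟨E'', .trans _ _ _ h1 h3, h4⟩

theorem letter_of_lastLabel {E : VirtualLinkDiagram (n + 1)} {e : Endpoint}
    (h : E.LastLabel e.label) : E.letter e = Sum.inr e.sign := if_pos h

theorem letter_of_not_lastLabel {E : VirtualLinkDiagram (n + 1)} {e : Endpoint}
    (h : ¬ E.LastLabel e.label) : E.letter e = Sum.inl e := if_neg h

theorem letter_eq_inl {E : VirtualLinkDiagram (n + 1)} {e f : Endpoint}
    (h : E.letter e = Sum.inl f) : e = f ∧ ¬ E.LastLabel e.label := by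
  unfold letter at h
  split_ifs at h with h'
  exact ⟨Sum.inl_injective h, h'⟩

theorem letter_eq_inr {E : VirtualLinkDiagram (n + 1)} {e : Endpoint} {s : ℤˣ}
    (h : E.letter e = Sum.inr s) : e.sign = s ∧ E.LastLabel e.label := by
  unfold letter at h
  split_ifs at h with h'
  exact ⟨Sum.inr_injective h, h'⟩

theorem lastLabel_of_mem {E : VirtualLinkDiagram (n + 1)} {e : Endpoint}
    (h : e ∈ E.word (Fin.last n)) : E.LastLabel e.label := List.mem_map.2 ⟨e, h, rfl⟩

theorem not_mem_last_of_mem {E : VirtualLinkDiagram (n + 1)} {e : Endpoint} {i : Fin n}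
    (h : e ∈ E.word i.castSucc) : e ∉ E.word (Fin.last n) := fun h' =>
  (Fin.castSucc_lt_last i).ne (comp_unique h h')

theorem Realizes.partner_mem {E : VirtualLinkDiagram (n + 1)} {w : Fin n → List Letter}
    (_ : Realizes E w) {e : Endpoint} {i : Fin n} (he : e ∈ E.word i.castSucc)
    (hl : E.LastLabel e.label) : e.partner ∈ E.word (Fin.last n) :=
  ((lastLabel_iff ⟨_, he⟩).1 hl).resolve_left (not_mem_last_of_mem he)

theorem Realizes.isOver_eq_false {E : VirtualLinkDiagram (n + 1)} {w : Fin n → List Letter}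
    (h : Realizes E w) {e : Endpoint} {i : Fin n} (he : e ∈ E.word i.castSucc)
    (hl : E.LastLabel e.label) : e.isOver = false := by
  simpa using h.isOver _ (h.partner_mem he hl)

theorem Realizes.of_lastLabel_iff {E E' : VirtualLinkDiagram (n + 1)} {w : Fin n → List Letter}
    (h : Realizes E w) (hl : ∀ l, E'.LastLabel l ↔ E.LastLabel l)
    (ho : ∀ e ∈ E'.word (Fin.last n), e.isOver = true)
    (hw : ∀ i : Fin n, E'.word i.castSucc = E.word i.castSucc) : Realizes E' w := by
  refine ⟨ho, fun i => ?_⟩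
  rw [← h.word, hw]
  refine List.map_congr_left fun e _ => ?_
  simp only [letter, hl]

/-! ### Rotations, and the order of the crossings along the last component -/

theorem Reach.of_isRotated {w w' : Fin n → List Letter} (h : ∀ i, w i ~r w' i) :
    Reach w w' := by
  intro E hE
  have hr : ∀ i : Fin n, ∃ U, U ~r E.word i.castSucc ∧ U.map E.letter = w' i := by
    intro i
    obtain ⟨k, hk⟩ := h i
    exact ⟨(E.word i.castSucc).rotate k, .forall _ _, by rw [List.map_rotate, hE.word, hk]⟩
  choose U hU hU' using hr
  have hV : ∀ i, (Fin.snoc (α := fun _ => List Endpoint) U (E.word (Fin.last n)) :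
      Fin (n + 1) → List Endpoint) i ~r E.word i := by
    intro i
    induction i using Fin.lastCases with
    | last => simpa using List.IsRotated.refl _
    | cast i => simpa using hU i
  refine ⟨E.ofPerm _ fun i => (hV i).perm, .rel _ _ (Or.inl (Or.inl (Iso.of_isRotated hV))), ?_⟩
  have hl : (E.ofPerm _ fun i => (hV i).perm).word (Fin.last n) = E.word (Fin.last n) := by
    simp [ofPerm]
  refine ⟨by rw [hl]; exact hE.isOver, fun i => ?_⟩
  rw [← hU' i]
  have : (E.ofPerm _ fun i => (hV i).perm).word i.castSucc = U i := by simp [ofPerm]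
  rw [this]
  have hL : ∀ l, (E.ofPerm _ fun i => (hV i).perm).LastLabel l ↔ E.LastLabel l := by
    intro l
    unfold LastLabel
    rw [hl]
  refine List.map_congr_left fun e _ => ?_
  simp only [letter, hL]

/-- A permutation is a product of adjacent transpositions, each of which is an exchange of
over-crossings. The prefix `pre` collects the heads that the `cons` case leaves in place. -/
theorem exists_last_eq_aux {l l' : List Endpoint} (h : l.Perm l') :
    ∀ (E : VirtualLinkDiagram (n + 1)) (pre : List Endpoint),
      (∀ e ∈ E.word (Fin.last n), e.isOver = true) → E.word (Fin.last n) = pre ++ l →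
      ∃ E' : VirtualLinkDiagram (n + 1), SemiWeldedEquivalent E E' ∧
        E'.word (Fin.last n) = pre ++ l' ∧ ∀ i : Fin n, E'.word i.castSucc = E.word i.castSucc := by
  induction h with
  | nil => intro E pre _ h; exact ⟨E, .refl _, h, fun _ => rfl⟩
  | cons x _ ih =>
    intro E pre ho h
    obtain ⟨E', h1, h2, h3⟩ := ih E (pre ++ [x]) ho (by simpa using h)
    exact ⟨E', h1, by simpa using h2, h3⟩
  | swap x y l =>
    intro E pre ho h
    have hx : x ∈ E.word (Fin.last n) := by simp [h]
    have hy : y ∈ E.word (Fin.last n) := by simp [h]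
    have hr : E.word (Fin.last n) ~r (y :: x :: (l ++ pre)) := by
      rw [h]; exact List.isRotated_append
    refine ⟨E.permute (Equiv.swap y x) fun e => ?_, .rel _ _ (Or.inr ⟨y, x, ho y hy, ho x hx,
      ⟨_, hr⟩, fun _ => rfl⟩), ?_, fun i => ?_⟩
    · rw [Equiv.swap_apply_def]
      split_ifs with h1 h2
      · subst h1; exact iff_of_true ⟨_, hx⟩ ⟨_, hy⟩
      · subst h2; exact iff_of_true ⟨_, hy⟩ ⟨_, hx⟩
      · rfl
    · have hd := E.nodup_word (Fin.last n)
      change (E.word (Fin.last n)).map _ = _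
      rw [h] at hd ⊢
      rw [List.map_append, List.map_swap_cons_cons (List.nodup_append.1 hd).2.1,
        List.map_swap_eq_self]
      · intro hc; exact (List.nodup_append.1 hd).2.2 y hc y (by simp) rfl
      · intro hc; exact (List.nodup_append.1 hd).2.2 x hc x (by simp) rfl
    · exact List.map_swap_eq_self (fun hc => not_mem_last_of_mem hc hy)
        (fun hc => not_mem_last_of_mem hc hx)
  | trans _ _ ih1 ih2 =>
    intro E pre ho h
    obtain ⟨E', h1, h2, h3⟩ := ih1 E pre ho h
    rename_i l₁ l₂ l₃ hp _
    obtain ⟨E'', h4, h5, h6⟩ := ih2 E' pre (fun e he => ho e (by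
      rw [h2] at he
      rw [h]
      exact ((hp.append_left pre).mem_iff).2 he)) h2
    exact ⟨E'', .trans _ _ _ h1 h4, h5, fun i => (h6 i).trans (h3 i)⟩

/-- The over-crossing passages along the last component can be put in any order. -/
theorem Realizes.exists_last_eq {E : VirtualLinkDiagram (n + 1)} {w : Fin n → List Letter}
    (h : Realizes E w) {l : List Endpoint} (hl : (E.word (Fin.last n)).Perm l) :
    ∃ E' : VirtualLinkDiagram (n + 1), SemiWeldedEquivalent E E' ∧ Realizes E' w ∧
      E'.word (Fin.last n) = l ∧ ∀ i : Fin n, E'.word i.castSucc = E.word i.castSucc := by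
  obtain ⟨E', h1, h2, h3⟩ := exists_last_eq_aux hl E [] h.isOver rfl
  rw [List.nil_append] at h2
  refine ⟨E', h1, h.of_lastLabel_iff (fun k => ?_) (fun e he => ?_) h3, h2, h3⟩
  · unfold LastLabel
    rw [h2, (hl.map _).mem_iff]
  · rw [h2] at he
    exact h.isOver e (hl.mem_iff.2 he)

theorem Realizes.exists_mem_base {E : VirtualLinkDiagram (n + 1)} {w : Fin n → List Letter}
    (h : Realizes E w) {e : Endpoint} (he : e ∈ E.word (Fin.last n)) :
    ∃ i : Fin n, e.partner ∈ E.word i.castSucc := by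
  obtain ⟨j, hj⟩ := E.partner_mem _ e he
  induction j using Fin.lastCases with
  | last =>
    have h1 := h.isOver _ he
    have h2 := h.isOver _ hj
    simp [h1] at h2
  | cast i => exact ⟨i, hj⟩

/-- `e` and `e'` are at the same place of one of the base components. -/
def SamePlace (E E' : VirtualLinkDiagram (n + 1)) (e e' : Endpoint) : Prop :=
  ∃ (i : Fin n) (k : ℕ), (E.word i.castSucc)[k]? = some e ∧ (E'.word i.castSucc)[k]? = some e'

theorem SamePlace.symm {E E' : VirtualLinkDiagram (n + 1)} {e e' : Endpoint}
    (h : SamePlace E E' e e') : SamePlace E' E e' e := by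
  obtain ⟨i, k, h1, h2⟩ := h
  exact ⟨i, k, h2, h1⟩

theorem SamePlace.exists_mem {E E' : VirtualLinkDiagram (n + 1)} {e e' : Endpoint}
    (h : SamePlace E E' e e') : ∃ i : Fin n, e ∈ E.word i.castSucc ∧ e' ∈ E'.word i.castSucc := by
  obtain ⟨i, k, h1, h2⟩ := h
  exact ⟨i, List.mem_of_getElem? h1, List.mem_of_getElem? h2⟩

theorem SamePlace.letter_eq {E E' : VirtualLinkDiagram (n + 1)} {e e' : Endpoint}
    {w : Fin n → List Letter} (h : SamePlace E E' e e') (hE : Realizes E w)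
    (hE' : Realizes E' w) : E.letter e = E'.letter e' := by
  obtain ⟨i, k, h1, h2⟩ := h
  have := congrArg (·[k]?) ((hE.word i).trans (hE'.word i).symm)
  simpa [h1, h2] using this

theorem SamePlace.lastLabel {E E' : VirtualLinkDiagram (n + 1)} {e e' : Endpoint}
    {w : Fin n → List Letter} (h : SamePlace E E' e e') (hE : Realizes E w)
    (hE' : Realizes E' w) (hl : E.LastLabel e.label) : E'.LastLabel e'.label := by
  have := h.letter_eq hE hE'
  rw [letter_of_lastLabel hl] at this
  exact (letter_eq_inr this.symm).2

/-- A letter `inr s` forgets the name and `isOver`, but a passage of the base at a crossing with `ω`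
is always an under-crossing. -/
theorem SamePlace.eq_relabel {E E' : VirtualLinkDiagram (n + 1)} {e e' : Endpoint}
    {w : Fin n → List Letter} (h : SamePlace E E' e e') (hE : Realizes E w)
    (hE' : Realizes E' w) : e' = { e with label := e'.label } := by
  have hle := h.letter_eq hE hE'
  obtain ⟨i, h1, h2⟩ := h.exists_mem
  by_cases hl : E.LastLabel e.label
  · have hl' := h.lastLabel hE hE' hl
    have e1 := hE.isOver_eq_false h1 hl
    have e2 := hE'.isOver_eq_false h2 hl'
    rw [letter_of_lastLabel hl, letter_of_lastLabel hl'] at hle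
    ext
    · rfl
    · simp [e1, e2]
    · simp [Sum.inr_injective hle]
  · rw [letter_of_not_lastLabel hl] at hle
    rw [(letter_eq_inl hle.symm).1]

/-- This makes the renaming by places well defined. At a base crossing the letter contains the name.
A crossing with `ω` is met only once by the base components, so there the two places coincide. -/
theorem SamePlace.label_eq {E E' : VirtualLinkDiagram (n + 1)} {e e' f f' : Endpoint}
    {w : Fin n → List Letter} (he : SamePlace E E' e e') (hf : SamePlace E E' f f')
    (hE : Realizes E w) (hE' : Realizes E' w) (h : e.label = f.label) :
    e'.label = f'.label := by
  by_cases hl : E.LastLabel e.label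
  · obtain ⟨i, k, h1, h2⟩ := he
    obtain ⟨j, m, h3, h4⟩ := hf
    have m1 := List.mem_of_getElem? h1
    have m2 := List.mem_of_getElem? h3
    have o1 := hE.isOver_eq_false m1 hl
    have o2 := hE.isOver_eq_false m2 (h ▸ hl)
    obtain rfl : e = f := Mem.eq_of_key ⟨_, m1⟩ ⟨_, m2⟩ (by simp [Endpoint.key, h, o1, o2])
    obtain rfl : i = j := Fin.castSucc_injective n (comp_unique m1 m2)
    obtain rfl : k = m := by
      obtain ⟨hk, rfl⟩ := List.getElem?_eq_some_iff.1 h1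
      obtain ⟨hm, h5⟩ := List.getElem?_eq_some_iff.1 h3
      exact ((E.nodup_word i.castSucc).getElem_inj_iff.1 h5).symm
    rw [h2] at h4
    rw [Option.some_injective _ h4]
  · have h1 := he.letter_eq hE hE'
    have h2 := hf.letter_eq hE hE'
    rw [letter_of_not_lastLabel hl] at h1
    rw [letter_of_not_lastLabel (h ▸ hl)] at h2
    rw [(letter_eq_inl h1.symm).1, (letter_eq_inl h2.symm).1, h]

/-- Two diagrams with the same decorated words are semi-welded equivalent. -/
theorem Realizes.semiWeldedEquivalent {E E' : VirtualLinkDiagram (n + 1)}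
    {w : Fin n → List Letter} (h : Realizes E w) (h' : Realizes E' w) :
    SemiWeldedEquivalent E E' := by
  classical
  obtain ⟨N, hN⟩ := E.exists_label_lt
  have hex : ∀ (i : Fin n) (k : ℕ) (e : Endpoint), (E.word i.castSucc)[k]? = some e → ∃ e', SamePlace E E' e e' ∧
      (E'.word i.castSucc)[k]? = some e' := by
    intro i k e he
    have := congrArg (·[k]?) ((h.word i).trans (h'.word i).symm)
    simp only [List.getElem?_map, he, Option.map_some] at this
    obtain ⟨e', he', -⟩ := Option.map_eq_some_iff.1 this.symm
    exact ⟨e', ⟨i, k, he, he'⟩, he'⟩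
  -- The name of a crossing of `E` goes to the name found at the same place of `E'`. The default
  -- value is never used, because only the restriction of `g` to `S` is extended.
  let g : ℕ → ℕ := fun l => if hl : ∃ e e', SamePlace E E' e e' ∧ e.label = l then
    hl.choose_spec.choose.label else l
  have hg : ∀ e e', SamePlace E E' e e' → g e.label = e'.label := by
    intro e e' he
    have hl : ∃ f f', SamePlace E E' f f' ∧ f.label = e.label := ⟨e, e', he, rfl⟩
    simp only [g, dif_pos hl]
    exact hl.choose_spec.choose_spec.1.label_eq he h h' hl.choose_spec.choose_spec.2
  let S : Finset ℕ := (Finset.range N).filter fun l => ∃ e e', SamePlace E E' e e' ∧ e.label = l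
  have hS : ∀ e e', SamePlace E E' e e' → e.label ∈ S := by
    intro e e' he
    obtain ⟨i, h1, -⟩ := he.exists_mem
    exact Finset.mem_filter.2 ⟨Finset.mem_range.2 (hN e ⟨_, h1⟩), e, e', he, rfl⟩
  obtain ⟨f, hf⟩ := _root_.exists_perm_extending S g (by
    intro a ha b hb hab
    obtain ⟨-, e, e', he, rfl⟩ := Finset.mem_filter.1 ha
    obtain ⟨-, k, k', hk, rfl⟩ := Finset.mem_filter.1 hb
    rw [hg _ _ he, hg _ _ hk] at hab
    exact he.symm.label_eq hk.symm h' h hab)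
  have hrel : ∀ e e', SamePlace E E' e e' → e.relabel f = e' := by
    intro e e' he
    rw [he.eq_relabel h h', ← hg e e' he, ← hf _ (hS e e' he)]
    rfl
  have hword : ∀ i : Fin n, (E.rename f).word i.castSucc = E'.word i.castSucc := by
    intro i
    refine List.ext_getElem? fun k => ?_
    simp only [rename, List.getElem?_map]
    rcases hk : (E.word i.castSucc)[k]? with _ | e
    · have h1 := congrArg List.length ((h.word i).trans (h'.word i).symm)
      simp only [List.length_map] at h1
      rw [List.getElem?_eq_none_iff] at hk
      rw [Option.map_none, eq_comm, List.getElem?_eq_none_iff]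
      omega
    · obtain ⟨e', he', hk'⟩ := hex i k e hk
      rw [hk', Option.map_some, hrel e e' he']
  -- Both words along `ω` consist of the partners of the same passages under `ω`, so they differ
  -- only in order, and over-crossings commute.
  have hlast : ((E.rename f).word (Fin.last n)).Perm (E'.word (Fin.last n)) := by
    refine (List.perm_ext_iff_of_nodup (nodup_word _ _) (nodup_word _ _)).2 fun z => ?_
    constructor
    · intro hz
      obtain ⟨z, hz', rfl⟩ := List.mem_map.1 hz
      obtain ⟨i, hi⟩ := h.exists_mem_base hz'
      obtain ⟨k, hk⟩ := List.getElem?_of_mem hi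
      obtain ⟨e', he', hk'⟩ := hex i k _ hk
      have := h'.partner_mem (List.mem_of_getElem? hk') (he'.lastLabel h h' (lastLabel_of_mem (e := z) hz'))
      rw [← hrel _ _ he'] at this
      simpa [Endpoint.partner_relabel] using this
    · intro hz
      obtain ⟨i, hi⟩ := h'.exists_mem_base hz
      rw [← hword] at hi
      obtain ⟨e, he, hez⟩ := List.mem_map.1 hi
      obtain ⟨k, hk⟩ := List.getElem?_of_mem he
      obtain ⟨e', he', hk'⟩ := hex i k _ hk
      rw [hrel _ _ he'] at hez
      subst hez
      refine List.mem_map.2 ⟨e.partner, h.partner_mem he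
        (he'.symm.lastLabel h' h (lastLabel_of_mem (e := z) hz)), ?_⟩
      rw [← Endpoint.partner_relabel, hrel _ _ he', Endpoint.partner_partner]
  obtain ⟨E'', h1, h2, h3⟩ := exists_last_eq_aux hlast (E.rename f) [] (by
    intro e he
    obtain ⟨z, hz, rfl⟩ := List.mem_map.1 he
    exact h.isOver z hz) rfl
  have : E'' = E' := by
    refine ext_word fun i => ?_
    induction i using Fin.lastCases with
    | last => exact h2
    | cast i => rw [h3, hword]
  rw [this] at h1
  exact .trans _ _ _ (.rel _ _ (Or.inl (Or.inl (E.iso_rename f)))) h1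

/-! ### Second Reidemeister moves with the last component -/

/-- Let the last component pass over the `i`-th component between the passages `U` and the
passages `V`, in a crossing with over-crossing passage `x`. -/
def insertOver (E : VirtualLinkDiagram (n + 1)) (i : Fin n) (U V : List Endpoint) (x : Endpoint)
    (hi : E.word i.castSucc = U ++ V) (hx : ∀ e, E.Mem e → e.label ≠ x.label) :
    VirtualLinkDiagram (n + 1) :=
  let W : Fin (n + 1) → List Endpoint := Fin.snoc (α := fun _ => List Endpoint)
    (Function.update (fun j => E.word j.castSucc) i (U ++ x.partner :: V))
    (x :: E.word (Fin.last n))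
  -- Up to order each word gains at most one entry, with a fresh name. The conditions on a diagram
  -- then reduce to those of `E`.
  have hW : ∀ j, (W j).Perm (if j = Fin.last n then x :: E.word j else
      if j = i.castSucc then x.partner :: E.word j else E.word j) := by
    intro j
    induction j using Fin.lastCases with
    | last => simp [W, -Fin.snoc_update]
    | cast j =>
      by_cases hj : j = i
      · subst hj; simp [W, hi, (Fin.castSucc_lt_last _).ne, -Fin.snoc_update]
      · simp [W, hj, (Fin.castSucc_lt_last _).ne, -Fin.snoc_update]
  have hm : ∀ j e, e ∈ W j ↔ (j = Fin.last n ∧ e = x) ∨ (j = i.castSucc ∧ e = x.partner) ∨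
      e ∈ E.word j := by
    intro j e
    rw [(hW j).mem_iff]
    have := (Fin.castSucc_lt_last i).ne
    split_ifs with h1 h2
    · subst h1; simp [this.symm]
    · subst h2; simp [this]
    · simp [h1, h2]
  { word := W
    nodup := fun j => by
      have hd := E.nodup j
      have hk : ∀ y : Endpoint, y.label = x.label → y.key ∉ (E.word j).map Endpoint.key := by
        intro y hy h
        obtain ⟨z, hz, h⟩ := List.mem_map.1 h
        exact hx z ⟨j, hz⟩ ((congrArg Prod.fst h).trans hy)
      rw [((hW j).map Endpoint.key).nodup_iff]
      split_ifs
      · exact List.nodup_cons.2 ⟨hk x rfl, hd⟩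
      · exact List.nodup_cons.2 ⟨hk x.partner rfl, hd⟩
      · exact hd
    unique := fun j k e he f hf h => by
      have hl : e.label = f.label := congrArg Prod.fst h
      have ho : e.isOver = f.isOver := congrArg Prod.snd h
      rcases (hm j e).1 he with ⟨rfl, rfl⟩ | ⟨rfl, rfl⟩ | he1 <;>
      rcases (hm k f).1 hf with ⟨rfl, rfl⟩ | ⟨rfl, rfl⟩ | hf1 <;> first
        | rfl
        | exact absurd hl.symm (hx _ ⟨_, hf1⟩)
        | exact absurd hl (hx _ ⟨_, he1⟩)
        | exact E.unique _ _ _ he1 _ hf1 h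
        | simp at ho
    partner_mem := fun j e he => by
      rcases (hm j e).1 he with ⟨rfl, rfl⟩ | ⟨rfl, rfl⟩ | he
      · exact ⟨i.castSucc, (hm _ _).2 (.inr (.inl ⟨rfl, rfl⟩))⟩
      · exact ⟨Fin.last n, (hm _ _).2 (.inl ⟨rfl, by simp⟩)⟩
      · obtain ⟨k, hk⟩ := E.partner_mem j e he
        exact ⟨k, (hm _ _).2 (.inr (.inr hk))⟩ }

section insertOver

variable {E : VirtualLinkDiagram (n + 1)} {i : Fin n} {U V : List Endpoint} {x : Endpoint}
  {hi : E.word i.castSucc = U ++ V} {hx : ∀ e, E.Mem e → e.label ≠ x.label}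

theorem insertOver_word_last :
    (E.insertOver i U V x hi hx).word (Fin.last n) = x :: E.word (Fin.last n) := by
  simp [insertOver, -Fin.snoc_update]

theorem insertOver_word_castSucc (j : Fin n) :
    (E.insertOver i U V x hi hx).word j.castSucc =
      Function.update (fun j => E.word j.castSucc) i (U ++ x.partner :: V) j := by
  simp [insertOver, -Fin.snoc_update]

theorem mem_insertOver {e : Endpoint} (h : (E.insertOver i U V x hi hx).Mem e) :
    E.Mem e ∨ e.label = x.label := by
  obtain ⟨j, hj⟩ := h
  induction j using Fin.lastCases with
  | last =>
    rw [insertOver_word_last] at hj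
    rcases List.mem_cons.1 hj with rfl | hj
    exacts [.inr rfl, .inl ⟨_, hj⟩]
  | cast j =>
    rw [insertOver_word_castSucc] at hj
    by_cases h : j = i
    · subst h
      rw [Function.update_self, List.mem_append, List.mem_cons] at hj
      rcases hj with hj | rfl | hj
      · exact .inl ⟨j.castSucc, by rw [hi]; simp [hj]⟩
      · exact .inr rfl
      · exact .inl ⟨j.castSucc, by rw [hi]; simp [hj]⟩
    · rw [Function.update_of_ne h] at hj
      exact .inl ⟨_, hj⟩

theorem insertOver_filter (p : ℕ → Bool) (hp : p x.label = false) (j : Fin (n + 1)) :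
    ((E.insertOver i U V x hi hx).word j).filter (fun e => p e.label) =
      (E.word j).filter (fun e => p e.label) := by
  induction j using Fin.lastCases with
  | last => rw [insertOver_word_last, List.filter_cons_of_neg (by simp [hp])]
  | cast j =>
    rw [insertOver_word_castSucc]
    by_cases h : j = i
    · subst h
      rw [Function.update_self, hi, List.filter_append, List.filter_append,
        List.filter_cons_of_neg (by simp [hp])]
    · rw [Function.update_of_ne h]

theorem Realizes.insertOver {w : Fin n → List Letter} (h : Realizes E w)
    (ho : x.isOver = true) : Realizes (E.insertOver i U V x hi hx)
      (Function.update w i (U.map E.letter ++ Sum.inr x.sign :: V.map E.letter)) := by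
  have hL : ∀ l, l ≠ x.label → ((E.insertOver i U V x hi hx).LastLabel l ↔ E.LastLabel l) := by
    intro l hl
    unfold LastLabel
    simp [insertOver_word_last, hl]
  have hlet : ∀ (j : Fin n), ∀ e ∈ E.word j.castSucc,
      (E.insertOver i U V x hi hx).letter e = E.letter e := by
    intro j e he
    simp only [letter, hL _ (hx e ⟨_, he⟩)]
  refine ⟨fun e he => ?_, fun j => ?_⟩
  · rw [insertOver_word_last, List.mem_cons] at he
    rcases he with rfl | he
    exacts [ho, h.isOver e he]
  · rw [insertOver_word_castSucc]
    by_cases hj : j = i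
    · subst hj
      have h1 := hlet j
      rw [hi] at h1
      rw [Function.update_self, Function.update_self, List.map_append, List.map_cons,
        List.map_congr_left fun e he => h1 e (List.mem_append_left _ he),
        List.map_congr_left fun e he => h1 e (List.mem_append_right _ he),
        letter_of_lastLabel]
      · rfl
      · exact lastLabel_of_mem (e := x) (by rw [insertOver_word_last]; simp)
    · rw [Function.update_of_ne hj, Function.update_of_ne hj, ← h.word]
      exact List.map_congr_left (hlet j)

end insertOver

/-- A second Reidemeister move pushes a finger of `ω` over the `i`-th component. The last component
may be pulled there from anywhere, since further crossings are virtual. -/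
theorem Reach.insert_pair {w : Fin n → List Letter} {i : Fin n} {u v : List Letter} (s : ℤˣ)
    (hw : w i = u ++ v) :
    Reach w (Function.update w i (u ++ [Sum.inr s, Sum.inr (-s)] ++ v)) := by
  intro E hE
  obtain ⟨U, V, hi, rfl, rfl⟩ := List.map_eq_append_iff.1 ((hE.word i).trans hw)
  obtain ⟨N, hN⟩ := E.exists_label_lt
  have hx : ∀ e, E.Mem e → e.label ≠ (⟨N, true, -s⟩ : Endpoint).label := fun e he =>
    (hN e he).ne
  -- The new names `N` and `N + 1` are unused. The crossing of sign `-s` is inserted first and that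
  -- of sign `s` then in front of it, on the base component and along `ω` alike.
  set x : Endpoint := ⟨N, true, -s⟩ with hxdef
  set E1 := E.insertOver i U V x hi hx with hE1
  have hi1 : E1.word i.castSucc = U ++ x.partner :: V := by
    rw [hE1, insertOver_word_castSucc, Function.update_self]
  have hy : ∀ e, E1.Mem e → e.label ≠ (⟨N + 1, true, s⟩ : Endpoint).label := by
    intro e he
    rcases mem_insertOver he with he | he
    · have := hN e he; simp only; omega
    · rw [he]; simp [hxdef]
  set y : Endpoint := ⟨N + 1, true, s⟩ with hydef
  have hR1 : Realizes E1 _ := hE.insertOver (hi := hi) (hx := hx) rfl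
  have hR2 := hR1.insertOver (hi := hi1) (hx := hy) rfl
  set E2 := E1.insertOver i U (x.partner :: V) y hi1 hy with hE2
  have hword2 : E2.word i.castSucc = U ++ y.partner :: x.partner :: V := by
    rw [hE2, insertOver_word_castSucc, Function.update_self]
  refine ⟨E2, .rel _ _ (Or.inl (Or.inr (Or.inr (Or.inl ⟨y, x, rfl, rfl, by
    simp [hxdef, hydef], rfl, ⟨Fin.last n, E.word (Fin.last n), ?_⟩,
    Or.inl ⟨i.castSucc, V ++ U, ?_⟩, fun j => ?_⟩)))), ?_⟩
  · rw [hE2, insertOver_word_last, hE1, insertOver_word_last]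
  · rw [hword2]; exact List.isRotated_append
  · have h1 := insertOver_filter (hi := hi1) (hx := hy)
      (fun l => decide (l ≠ y.label ∧ l ≠ x.label)) (by simp) j
    have h2 := insertOver_filter (hi := hi) (hx := hx)
      (fun l => decide (l ≠ y.label ∧ l ≠ x.label)) (by simp) j
    refine Eq.trans ?_ (h1.trans h2).symm
    rw [List.filter_eq_self.2]
    intro e he
    simp only [decide_eq_true_eq]
    have := hN e ⟨_, he⟩
    simp only [hxdef, hydef]
    omega
  · convert hR2 using 1
    rw [Function.update_idem]
    congr 1
    have h3 : ∀ e, E.Mem e → E1.letter e = E.letter e := by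
      intro e he
      have : E1.LastLabel e.label ↔ E.LastLabel e.label := by
        unfold LastLabel
        rw [hE1, insertOver_word_last]
        simp [hx e he]
      simp only [letter, this]
    rw [List.map_cons, letter_of_lastLabel, List.map_congr_left fun e he =>
      h3 e ⟨i.castSucc, by rw [hi]; exact List.mem_append_left _ he⟩,
      List.map_congr_left fun e he =>
      h3 e ⟨i.castSucc, by rw [hi]; exact List.mem_append_right _ he⟩]
    · simp [hxdef, hydef]
    · exact lastLabel_of_mem (e := x) (by rw [hE1, insertOver_word_last]; simp)

/-- The two heads are adjacent already. The two tails become adjacent after reordering `ω`, and a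
second Reidemeister move removes both crossings. -/
theorem Reach.delete_pair {w : Fin n → List Letter} {i : Fin n} {u v : List Letter} (s : ℤˣ)
    (hw : w i = u ++ [Sum.inr s, Sum.inr (-s)] ++ v) :
    Reach w (Function.update w i (u ++ v)) := by
  intro E hE
  have h0 := (hE.word i).trans hw
  simp only [List.append_assoc, List.cons_append, List.nil_append] at h0
  obtain ⟨U, V', hi, rfl, h1⟩ := List.map_eq_append_iff.1 h0
  obtain ⟨x, V', rfl, hx, h1⟩ := List.map_eq_cons_iff.1 h1
  obtain ⟨y, V, rfl, hy, rfl⟩ := List.map_eq_cons_iff.1 h1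
  obtain ⟨hxs, hxl⟩ := letter_eq_inr hx
  obtain ⟨hys, hyl⟩ := letter_eq_inr hy
  have hxm : x ∈ E.word i.castSucc := by rw [hi]; simp
  have hym : y ∈ E.word i.castSucc := by rw [hi]; simp
  have hxo := hE.isOver_eq_false hxm hxl
  have hyo := hE.isOver_eq_false hym hyl
  have hx' := hE.partner_mem hxm hxl
  have hy' := hE.partner_mem hym hyl
  have hd := E.nodup_word i.castSucc
  rw [hi] at hd
  have hxy : x ≠ y := by
    rintro rfl
    simp [List.nodup_append] at hd
  have hlab : x.label ≠ y.label := fun h => hxy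
    (Mem.eq_of_key ⟨_, hxm⟩ ⟨_, hym⟩ (by simp [Endpoint.key, h, hxo, hyo]))
  have hxy' : x.partner ≠ y.partner := fun h => hlab (by simpa using congrArg Endpoint.label h)
  have hperm : (E.word (Fin.last n)).Perm (x.partner :: y.partner ::
      ((E.word (Fin.last n)).erase x.partner).erase y.partner) := by
    refine (List.perm_cons_erase hx').trans (.cons _ (List.perm_cons_erase ?_))
    exact (List.mem_erase_of_ne hxy'.symm).2 hy'
  obtain ⟨E1, hE1, hR1, hlast, hcast⟩ := hE.exists_last_eq hperm
  set rest := ((E.word (Fin.last n)).erase x.partner).erase y.partner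
  let p : ℕ → Bool := fun l => l ≠ x.label ∧ l ≠ y.label
  refine ⟨E1.restrict p, .trans _ _ _ hE1 (.symm _ _ (.rel _ _ (Or.inl (Or.inr (Or.inr
    (Or.inl ⟨x.partner, y.partner, by simp [hxo], by simp [hyo], hlab, by simp [hxs, hys],
      ⟨Fin.last n, rest, by rw [hlast]⟩, Or.inl ⟨i.castSucc, V ++ U, ?_⟩, fun j => rfl⟩)))))), ?_⟩
  · rw [hcast, hi, Endpoint.partner_partner, Endpoint.partner_partner]
    exact List.isRotated_append
  have hkeep : ∀ (j : Fin n), ∀ e ∈ E.word j.castSucc, p e.label = true ↔ e ≠ x ∧ e ≠ y := by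
    intro j e he
    simp only [p, decide_eq_true_eq]
    constructor
    · rintro ⟨h1, h2⟩
      constructor <;> rintro rfl
      exacts [h1 rfl, h2 rfl]
    · rintro ⟨h1, h2⟩
      constructor <;> intro h
      · rcases Mem.eq_or_eq_partner ⟨_, he⟩ ⟨_, hxm⟩ h with rfl | rfl
        exacts [h1 rfl, not_mem_last_of_mem he hx']
      · rcases Mem.eq_or_eq_partner ⟨_, he⟩ ⟨_, hym⟩ h with rfl | rfl
        exacts [h2 rfl, not_mem_last_of_mem he hy']
  have hL : ∀ l, p l = true → ((E1.restrict p).LastLabel l ↔ E.LastLabel l) := by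
    intro l hl
    unfold LastLabel
    rw [((hperm.map _).mem_iff), ← hlast]
    simp only [restrict, List.mem_map, List.mem_filter]
    constructor
    · rintro ⟨e, he, rfl⟩; exact ⟨e, he.1, rfl⟩
    · rintro ⟨e, he, rfl⟩; exact ⟨e, ⟨he, hl⟩, rfl⟩
  have hlet : ∀ e : Endpoint, p e.label = true → (E1.restrict p).letter e = E.letter e := by
    intro e he
    simp only [letter, hL _ he]
  refine ⟨fun e he => hR1.isOver e (List.mem_filter.1 he).1, fun j => ?_⟩
  have hres : (E1.restrict p).word j.castSucc =
      (E.word j.castSucc).filter (fun e => p e.label) := by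
    simp only [restrict, hcast]
  by_cases hj : j = i
  · subst hj
    have key : (E.word j.castSucc).filter (fun e => p e.label) = U ++ V := by
      have hk := hkeep j
      rw [hi] at hk ⊢
      rw [List.filter_append, List.filter_cons_of_neg, List.filter_cons_of_neg,
        List.filter_eq_self.2, List.filter_eq_self.2]
      · intro e he
        rw [hk e (by simp [he])]
        have hd' := (List.nodup_append.1 hd).2.1
        simp only [List.nodup_cons, List.mem_cons, not_or] at hd'
        constructor <;> rintro rfl
        exacts [hd'.1.2 he, hd'.2.1 he]
      · intro e he
        rw [hk e (by simp [he])]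
        have hd' := (List.nodup_append.1 hd).2.2 e he
        exact ⟨hd' x (by simp), hd' y (by simp)⟩
      · rw [hk y (by simp)]; simp
      · rw [hk x (by simp)]; simp
    have h5 : ∀ e ∈ U ++ V, p e.label = true := by
      intro e he
      rw [← key] at he
      exact (List.mem_filter.1 he).2
    rw [hres, key, Function.update_self, ← List.map_append]
    exact List.map_congr_left fun e he => hlet e (h5 e he)
  · rw [hres, Function.update_of_ne hj, ← hE.word, List.filter_eq_self.2]
    · refine List.map_congr_left fun e he => hlet e ((hkeep j e he).2 ?_)
      constructor <;> rintro rfl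
      exacts [hj (Fin.castSucc_injective n (comp_unique he hxm)),
        hj (Fin.castSucc_injective n (comp_unique he hym))]
    · intro e he
      rw [hkeep j e he]
      constructor <;> rintro rfl
      exacts [hj (Fin.castSucc_injective n (comp_unique he hxm)),
        hj (Fin.castSucc_injective n (comp_unique he hym))]

end VirtualLinkDiagram

theorem List.Nodup.append_cons_inj {α : Type*} {A A' B B' : List α} {x : α}
    (hd : (A ++ x :: B).Nodup) (h : A ++ x :: B = A' ++ x :: B') : A = A' ∧ B = B' := by
  induction A generalizing A' with
  | nil =>
    rcases A' with _ | ⟨y, A'⟩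
    · simpa using h
    · simp only [nil_append, cons_append, cons.injEq] at h hd
      obtain ⟨rfl, rfl⟩ := h
      simp at hd
  | cons z A ih =>
    rcases A' with _ | ⟨y, A'⟩
    · simp only [nil_append, cons_append, cons.injEq] at h hd
      obtain ⟨rfl, rfl⟩ := h
      simp at hd
    · simp only [cons_append, cons.injEq] at h hd
      obtain ⟨rfl, h⟩ := h
      obtain ⟨h1, h2⟩ := ih (nodup_cons.1 hd).2 h
      exact ⟨by rw [h1], h2⟩

namespace VirtualLinkDiagram

variable {n : ℕ}

/-! ### Third Reidemeister moves with the last component -/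

/-- The name and the sign of a crossing. -/
def tag (e : Endpoint) : ℕ × ℤˣ := (e.label, e.sign)

/-- Put a passage of sign `s` under the last component before the two passages through the
crossing `c`. -/
def slideIn (c : ℕ × ℤˣ) (s : ℤˣ) : Letter → List Letter
  | .inl e => if tag e = c then [.inr s, .inl e] else [.inl e]
  | .inr t => [.inr t]

/-- Put a passage of sign `s` under the last component after the two passages through the
crossing `c`. -/
def slideOut (c : ℕ × ℤˣ) (s : ℤˣ) : Letter → List Letter
  | .inl e => if tag e = c then [.inl e, .inr s] else [.inl e]
  | .inr t => [.inr t]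

/-- The letter is a passage through the crossing `c`. -/
def At (c : ℕ × ℤˣ) (z : Letter) : Prop := ∃ e, z = .inl e ∧ tag e = c

theorem slideIn_of_at {c : ℕ × ℤˣ} {s : ℤˣ} {z : Letter} (h : At c z) :
    slideIn c s z = [.inr s, z] := by
  obtain ⟨e, rfl, h⟩ := h
  simp [slideIn, h]

theorem slideOut_of_at {c : ℕ × ℤˣ} {s : ℤˣ} {z : Letter} (h : At c z) :
    slideOut c s z = [z, .inr s] := by
  obtain ⟨e, rfl, h⟩ := h
  simp [slideOut, h]

theorem slideIn_of_not_at {c : ℕ × ℤˣ} {s : ℤˣ} {z : Letter} (h : ¬ At c z) :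
    slideIn c s z = [z] := by
  rcases z with e | t
  · have : tag e ≠ c := fun h' => h ⟨e, rfl, h'⟩
    simp [slideIn, this]
  · rfl

theorem slideOut_of_not_at {c : ℕ × ℤˣ} {s : ℤˣ} {z : Letter} (h : ¬ At c z) :
    slideOut c s z = [z] := by
  rcases z with e | t
  · have : tag e ≠ c := fun h' => h ⟨e, rfl, h'⟩
    simp [slideOut, this]
  · rfl

theorem not_at_inr {c : ℕ × ℤˣ} {s : ℤˣ} : ¬ At c (.inr s) := by
  rintro ⟨e, he, -⟩
  simp at he

/-- In the image of `slideIn` a passage through `c` is always preceded by a sign from its own block.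
So a letter outside the blocks is never directly followed by a passage through `c`. -/
theorem not_at_head {c : ℕ × ℤˣ} {s : ℤˣ} {W : List Letter} {z : Letter}
    (h : z ∈ (W.flatMap (slideIn c s)).head?) : ¬ At c z := by
  rcases W with _ | ⟨y, W⟩
  · simp at h
  · by_cases hy : At c y
    · rw [List.flatMap_cons, slideIn_of_at hy] at h
      simp only [List.cons_append, List.head?_cons, Option.mem_def, Option.some.injEq] at h
      rw [← h]
      exact not_at_inr
    · rw [List.flatMap_cons, slideIn_of_not_at hy] at h
      simp only [List.cons_append, List.head?_cons, Option.mem_def, Option.some.injEq] at h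
      rwa [← h]

/-- This reads the effect of the third Reidemeister move on a word block by block: `σ` exchanges the
two entries of each block at `c` and leaves the letters of all other entries unchanged. -/
theorem map_map_eq_slideOut (π : Endpoint → Letter) (σ : Endpoint → Endpoint) (c : ℕ × ℤˣ)
    (s : ℤˣ) (W : List Letter) : ∀ L : List Endpoint, L.map π = W.flatMap (slideIn c s) →
    (∀ A y e B, L = A ++ y :: e :: B → At c (π e) → π (σ y) = π e ∧ π (σ e) = .inr s) →
    (∀ A y B, L = A ++ y :: B → ¬ At c (π y) → (∀ z ∈ B.head?, ¬ At c (π z)) → π (σ y) = π y) →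
    (L.map σ).map π = W.flatMap (slideOut c s) := by
  induction W with
  | nil =>
    intro L h _ _
    simp only [List.flatMap_nil, List.map_eq_nil_iff] at h ⊢
    exact h
  | cons z W ih =>
    intro L h h1 h2
    rw [List.flatMap_cons] at h ⊢
    by_cases hz : At c z
    · rw [slideIn_of_at hz] at h
      rw [slideOut_of_at hz]
      obtain ⟨y, L, rfl, hy, h⟩ := List.map_eq_cons_iff.1 h
      obtain ⟨e, L, rfl, he, h⟩ := List.map_eq_cons_iff.1 h
      rw [← he] at hz
      obtain ⟨h3, h4⟩ := h1 [] y e L rfl hz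
      simp only [List.map_cons, h3, h4, he, List.cons_append, List.nil_append]
      rw [ih L h (fun A y' e' B hL => h1 (y :: e :: A) y' e' B (by rw [hL]; rfl))
        (fun A y' B hL => h2 (y :: e :: A) y' B (by rw [hL]; rfl))]
    · rw [slideIn_of_not_at hz] at h
      rw [slideOut_of_not_at hz]
      obtain ⟨y, L, rfl, hy, h⟩ := List.map_eq_cons_iff.1 h
      replace h : L.map π = W.flatMap (slideIn c s) := h
      have h3 := h2 [] y L rfl (by rwa [hy]) (by
        intro z' hz'
        refine not_at_head (s := s) (W := W) ?_
        rw [← h, List.head?_map]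
        exact Option.mem_map_of_mem π hz')
      simp only [List.map_cons, h3, hy, List.cons_append, List.nil_append]
      rw [ih L h (fun A y' e' B hL => h1 (y :: A) y' e' B (by rw [hL]; rfl))
        (fun A y' B hL => h2 (y :: A) y' B (by rw [hL]; rfl))]

theorem Realizes.exists_before {E : VirtualLinkDiagram (n + 1)} {w W : Fin n → List Letter}
    {c : ℕ × ℤˣ} {s : ℤˣ} (h : Realizes E w) (hw : ∀ i, w i = (W i).flatMap (slideIn c s))
    {i : Fin n} {e : Endpoint} (he : e ∈ E.word i.castSucc) (hl : ¬ E.LastLabel e.label)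
    (hc : tag e = c) :
    ∃ A x B, E.word i.castSucc = A ++ x :: e :: B ∧ E.letter x = .inr s := by
  have h1 : Sum.inl e ∈ (W i).flatMap (slideIn c s) := by
    rw [← hw, ← h.word]
    exact List.mem_map.2 ⟨e, he, letter_of_not_lastLabel hl⟩
  obtain ⟨z, hz, hez⟩ := List.mem_flatMap.1 h1
  have hze : z = .inl e := by
    by_cases hz' : At c z
    · rw [slideIn_of_at hz'] at hez
      simpa [eq_comm] using hez
    · rw [slideIn_of_not_at hz'] at hez
      simpa [eq_comm] using hez
  subst hze
  obtain ⟨W1, W2, hW⟩ := List.append_of_mem hz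
  have h2 := (h.word i).trans (hw i)
  rw [hW, List.flatMap_append, List.flatMap_cons, slideIn_of_at ⟨e, rfl, hc⟩] at h2
  obtain ⟨A, R, hE, -, h2⟩ := List.map_eq_append_iff.1 h2
  obtain ⟨x, R, rfl, hx, h2⟩ := List.map_eq_cons_iff.1 h2
  obtain ⟨e', R, rfl, he', h2⟩ := List.map_eq_cons_iff.1 h2
  rw [(letter_eq_inl he').1] at hE
  exact ⟨A, x, R, hE, hx⟩

/-- A passage under the last component on each of the strands of a base crossing can be moved from
before the crossing to behind it. -/
theorem Reach.slide {w w' W : Fin n → List Letter} (c : ℕ × ℤˣ) (s : ℤˣ)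
    (hw : ∀ i, w i = (W i).flatMap (slideIn c s))
    (hw' : ∀ i, w' i = (W i).flatMap (slideOut c s)) : Reach w w' := by
  intro E hE
  -- If the crossing `c` does not occur, both slides do nothing.
  by_cases hex : ∃ i : Fin n, ∃ e ∈ E.word i.castSucc, ¬ E.LastLabel e.label ∧ tag e = c
  swap
  · refine ⟨E, .refl _, ?_⟩
    convert hE using 1
    funext i
    rw [hw, hw']
    refine List.flatMap_congr fun z hz => ?_
    by_cases hz' : At c z
    · exfalso
      have h1 : z ∈ w i := by
        rw [hw]
        exact List.mem_flatMap.2 ⟨z, hz, by rw [slideIn_of_at hz']; simp⟩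
      rw [← hE.word] at h1
      obtain ⟨e, he, rfl⟩ := List.mem_map.1 h1
      obtain ⟨e', h2, h3⟩ := hz'
      obtain ⟨rfl, h4⟩ := letter_eq_inl h2
      exact hex ⟨i, e, he, h4, h3⟩
    · rw [slideIn_of_not_at hz', slideOut_of_not_at hz']
  obtain ⟨o, i, j, hoi, hoj, hol, hoc, hoo⟩ : ∃ (o : Endpoint) (i j : Fin n),
      o ∈ E.word i.castSucc ∧ o.partner ∈ E.word j.castSucc ∧ ¬ E.LastLabel o.label ∧
      tag o = c ∧ o.isOver = true := by
    obtain ⟨i, e, he, hl, hc⟩ := hex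
    obtain ⟨j, hj⟩ := E.partner_mem _ e he
    induction j using Fin.lastCases with
    | last => exact absurd (lastLabel_of_mem hj) hl
    | cast j =>
      rcases ho : e.isOver
      · exact ⟨e.partner, j, i, hj, by simpa using he, hl, hc, by simp [ho]⟩
      · exact ⟨e, i, j, he, hj, hl, hc, ho⟩
  obtain ⟨A₁, x₁, B₁, hi, hx₁⟩ := hE.exists_before hw hoi hol hoc
  obtain ⟨A₂, x₂, B₂, hj, hx₂⟩ := hE.exists_before hw hoj (by exact hol) (by exact hoc)
  obtain ⟨hs₁, hl₁⟩ := letter_eq_inr hx₁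
  obtain ⟨hs₂, hl₂⟩ := letter_eq_inr hx₂
  have hm₁ : x₁ ∈ E.word i.castSucc := by rw [hi]; simp
  have hm₂ : x₂ ∈ E.word j.castSucc := by rw [hj]; simp
  have ho₁ := hE.isOver_eq_false hm₁ hl₁
  have ho₂ := hE.isOver_eq_false hm₂ hl₂
  have hp₁ := hE.partner_mem hm₁ hl₁
  have hp₂ := hE.partner_mem hm₂ hl₂
  have hoo' : o ≠ o.partner := o.partner_ne.symm
  have split_unique : ∀ {k : Fin n} {x : Endpoint} {A B A' B' : List Endpoint},
      E.word k.castSucc = A ++ x :: B → E.word k.castSucc = A' ++ x :: B' → A = A' ∧ B = B' := by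
    intro k x A B A' B' h1 h2
    have hd := E.nodup_word k.castSucc
    rw [h1] at hd
    exact hd.append_cons_inj (h1.symm.trans h2)
  have hx₁₂ : x₁ ≠ x₂ := by
    rintro rfl
    obtain rfl := Fin.castSucc_injective n (comp_unique hm₁ hm₂)
    have := (split_unique hi hj).2
    simp [hoo'] at this
  have hlab : x₁.label ≠ x₂.label := fun h => hx₁₂
    (Mem.eq_of_key ⟨_, hm₁⟩ ⟨_, hm₂⟩ (by simp [Endpoint.key, h, ho₁, ho₂]))
  have hlab₁ : x₁.label ≠ o.label := fun h => hol (h ▸ hl₁)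
  have hlab₂ : x₂.label ≠ o.label := fun h => hol (h ▸ hl₂)
  set a := x₁.partner with ha
  set b := x₂.partner with hb
  have hab : a ≠ b := fun h => hlab (by simpa [ha, hb] using congrArg Endpoint.label h)
  have hperm : ∀ u v, u ≠ v → u ∈ E.word (Fin.last n) → v ∈ E.word (Fin.last n) →
      (E.word (Fin.last n)).Perm (u :: v :: ((E.word (Fin.last n)).erase u).erase v) := by
    intro u v huv hu hv
    refine (List.perm_cons_erase hu).trans (.cons _ (List.perm_cons_erase ?_))
    exact (List.mem_erase_of_ne huv.symm).2 hv
  -- The third Reidemeister move prescribes the order of the two tails on its top strand. Here this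
  -- strand is `ω`, where the order can be chosen freely.
  obtain ⟨E1, hEE1, hR1, hab1, hcast⟩ : ∃ E1 : VirtualLinkDiagram (n + 1),
      SemiWeldedEquivalent E E1 ∧ Realizes E1 w ∧ E1.AdjSigned (s * o.sign) a b ∧
      ∀ i : Fin n, E1.word i.castSucc = E.word i.castSucc := by
    by_cases hso : s * o.sign = 1
    · obtain ⟨E1, h1, h2, h3, h4⟩ := hE.exists_last_eq (hperm a b hab hp₁ hp₂)
      refine ⟨E1, h1, h2, ?_, h4⟩
      rw [AdjSigned, if_pos hso]
      exact ⟨Fin.last n, _, by rw [h3]⟩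
    · obtain ⟨E1, h1, h2, h3, h4⟩ := hE.exists_last_eq (hperm b a hab.symm hp₂ hp₁)
      refine ⟨E1, h1, h2, ?_, h4⟩
      rw [AdjSigned, if_neg hso]
      exact ⟨Fin.last n, _, by rw [h3]⟩
  have hoi1 : E1.AdjSigned 1 a.partner o := by
    rw [AdjSigned, if_pos rfl]
    refine ⟨i.castSucc, B₁ ++ A₁, ?_⟩
    rw [hcast, hi, ha, Endpoint.partner_partner]
    exact List.isRotated_append
  have hoj1 : E1.AdjSigned 1 b.partner o.partner := by
    rw [AdjSigned, if_pos rfl]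
    refine ⟨j.castSucc, B₂ ++ A₂, ?_⟩
    rw [hcast, hj, hb, Endpoint.partner_partner]
    exact List.isRotated_append
  set σ := swap3 a b a.partner o b.partner o.partner with hσ
  have hm : ∀ i e, σ e ∈ E1.word i ↔ e ∈ E1.word i := by
    intro i e
    rw [hσ, swap3_apply, mem_map_swap (hab1.mem_word_iff i), mem_map_swap (hoi1.mem_word_iff i),
      mem_map_swap (hoj1.mem_word_iff i)]
  set E2 := E1.permute σ (fun e => exists_congr fun i => hm i e) with hE2
  have hmem2 : ∀ i e, e ∈ E2.word i ↔ e ∈ E1.word i := by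
    intro i e
    change e ∈ (E1.word i).map σ ↔ _
    rw [List.mem_map]
    constructor
    · rintro ⟨z, hz, rfl⟩; exact (hm i z).2 hz
    · intro he
      exact ⟨σ.symm e, (hm i _).1 (by simpa using he), by simp⟩
  have hss : s * s = 1 := Int.units_mul_self s
  have hL : ∀ l, E2.LastLabel l ↔ E1.LastLabel l := by
    intro l
    unfold LastLabel
    simp only [List.mem_map, hmem2]
  -- The top strand is `ω`, and `o` is the middle-bottom tail. Both crossings with `ω` have sign
  -- `s`, so `δ = s` is the choice for which they come before the crossing `c` on both strands.
  refine ⟨E2, .trans _ _ _ hEE1 (.rel _ _ (Or.inl (Or.inr (Or.inr (Or.inr ⟨a, b, o,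
    by simp [ha, ho₁], by simp [hb, ho₂], hoo, hlab, hlab₁, hlab₂, ⟨s, ?_, ?_, ?_⟩,
    fun _ => rfl⟩))))), ?_⟩
  · have : s * a.sign * b.sign * o.sign = s * o.sign := by
      simp only [ha, hb, Endpoint.sign_partner, hs₁, hs₂, hss, one_mul]
    rw [this]; exact hab1
  · have : s * a.sign = 1 := by simp only [ha, Endpoint.sign_partner, hs₁, hss]
    rw [this]; exact hoi1
  · have : s * b.sign = 1 := by simp only [hb, Endpoint.sign_partner, hs₂, hss]
    rw [this]; exact hoj1
  refine ⟨fun e he => hR1.isOver e ((hmem2 _ _).1 he), fun k => ?_⟩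
  rw [hw']
  have hlet : ∀ e, E2.letter e = E1.letter e := by
    intro e
    simp only [letter, hL]
  have hl1 : ∀ (k : Fin n), ∀ e ∈ E.word k.castSucc, E1.letter e = E.letter e := by
    intro k e he
    have : (E1.word k.castSucc).map E1.letter = (E.word k.castSucc).map E.letter :=
      (hR1.word k).trans (hE.word k).symm
    rw [hcast] at this
    exact List.map_inj_left.1 this e he
  have hfun : E2.letter = E1.letter := funext hlet
  rw [hfun]
  have hne : ∀ {k : Fin n} {y z : Endpoint}, y ∈ E.word k.castSucc →
      z ∈ E.word (Fin.last n) → y ≠ z := by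
    rintro k y z hy hz rfl
    exact not_mem_last_of_mem hy hz
  have hlne : ∀ {y z : Endpoint}, y.label ≠ z.label → y ≠ z := by
    rintro y z h rfl
    exact h rfl
  have hσe : ∀ e, σ e = Equiv.swap a b (Equiv.swap x₁ o (Equiv.swap x₂ o.partner e)) := by
    intro e
    have haa : a.partner = x₁ := by rw [ha, Endpoint.partner_partner]
    have hbb : b.partner = x₂ := by rw [hb, Endpoint.partner_partner]
    rw [hσ, swap3_apply, haa, hbb]
  have hσx₁ : σ x₁ = o := by
    rw [hσe, Equiv.swap_apply_of_ne_of_ne hx₁₂ (hlne (z := o.partner) hlab₁), Equiv.swap_apply_left,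
      Equiv.swap_apply_of_ne_of_ne (hne hoi hp₁) (hne hoi hp₂)]
  have hσo : σ o = x₁ := by
    rw [hσe, Equiv.swap_apply_of_ne_of_ne (hlne hlab₂).symm hoo', Equiv.swap_apply_right,
      Equiv.swap_apply_of_ne_of_ne (hne hm₁ hp₁) (hne hm₁ hp₂)]
  have hσx₂ : σ x₂ = o.partner := by
    rw [hσe, Equiv.swap_apply_left,
      Equiv.swap_apply_of_ne_of_ne (hlne (y := o.partner) (z := x₁) hlab₁.symm) hoo'.symm,
      Equiv.swap_apply_of_ne_of_ne (hne hoj hp₁) (hne hoj hp₂)]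
  have hσo' : σ o.partner = x₂ := by
    rw [hσe, Equiv.swap_apply_right, Equiv.swap_apply_of_ne_of_ne hx₁₂.symm (hlne hlab₂),
      Equiv.swap_apply_of_ne_of_ne (hne hm₂ hp₁) (hne hm₂ hp₂)]
  have hσy : ∀ {k : Fin n} {y : Endpoint}, y ∈ E.word k.castSucc → y ≠ x₁ → y ≠ x₂ → y ≠ o →
      y ≠ o.partner → σ y = y := by
    intro k y hy h1 h2 h3 h4
    rw [hσe, Equiv.swap_apply_of_ne_of_ne h2 h4, Equiv.swap_apply_of_ne_of_ne h1 h3,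
      Equiv.swap_apply_of_ne_of_ne (hne hy hp₁) (hne hy hp₂)]
  have e₁ := hl1 i x₁ hm₁
  have e₂ := hl1 j x₂ hm₂
  have e₃ := hl1 i o hoi
  have e₄ := hl1 j _ hoj
  have hato : At c (E1.letter o) := ⟨o, by rw [e₃, letter_of_not_lastLabel hol], hoc⟩
  have hato' : At c (E1.letter o.partner) :=
    ⟨o.partner, by rw [e₄, letter_of_not_lastLabel (by exact hol)], hoc⟩
  refine map_map_eq_slideOut _ σ c s (W k) (E1.word k.castSucc) ((hR1.word k).trans (hw k)) ?_ ?_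
  · intro A y e B hL' hat
    rw [hcast] at hL'
    have hek : e ∈ E.word k.castSucc := by rw [hL']; simp
    obtain ⟨e', he', hc'⟩ := hat
    rw [hl1 k e hek] at he'
    obtain ⟨rfl, hel⟩ := letter_eq_inl he'
    have hL'' : E.word k.castSucc = (A ++ [y]) ++ e :: B := by simpa using hL'
    rcases Mem.eq_or_eq_partner ⟨_, hek⟩ ⟨_, hoi⟩ (congrArg Prod.fst (hc'.trans hoc.symm)) with
      rfl | rfl
    · obtain rfl := Fin.castSucc_injective n (comp_unique hek hoi)
      have hi' : E.word k.castSucc = (A₁ ++ [x₁]) ++ e :: B₁ := by simpa using hi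
      have := (split_unique hL'' hi').1
      obtain rfl : y = x₁ := by simpa using congrArg List.getLast? this
      exact ⟨by rw [hσx₁], by rw [hσo, e₁, hx₁]⟩
    · obtain rfl := Fin.castSucc_injective n (comp_unique hek hoj)
      have hi' : E.word k.castSucc = (A₂ ++ [x₂]) ++ o.partner :: B₂ := by simpa using hj
      have := (split_unique hL'' hi').1
      obtain rfl : y = x₂ := by simpa using congrArg List.getLast? this
      exact ⟨by rw [hσx₂], by rw [hσo', e₂, hx₂]⟩
  · intro A y B hL' hat hB
    rw [hcast] at hL'
    have hyk : y ∈ E.word k.castSucc := by rw [hL']; simp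
    rw [hσy hyk]
    · rintro rfl
      obtain rfl := Fin.castSucc_injective n (comp_unique hyk hm₁)
      rw [(split_unique hL' hi).2] at hB
      exact hB o (by simp) hato
    · rintro rfl
      obtain rfl := Fin.castSucc_injective n (comp_unique hyk hm₂)
      rw [(split_unique hL' hj).2] at hB
      exact hB o.partner (by simp) hato'
    · rintro rfl; exact hat hato
    · rintro rfl; exact hat hato'

/-! ### Cancellation of signs -/

/-- `l'` arises from `l` by deleting two adjacent passages of opposite signs under the last
component. -/
def Cancel (l l' : List Letter) : Prop :=
  ∃ (u v : List Letter) (s : ℤˣ), l = u ++ [Sum.inr s, Sum.inr (-s)] ++ v ∧ l' = u ++ v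

/-- The equivalence relation generated by cancellations. -/
def Red (l l' : List Letter) : Prop := Relation.EqvGen Cancel l l'

theorem Red.refl (l : List Letter) : Red l l := Relation.EqvGen.refl l

theorem Red.of_eq {l l' : List Letter} (h : l = l') : Red l l' := h ▸ Red.refl l

theorem Red.symm {l l' : List Letter} (h : Red l l') : Red l' l := Relation.EqvGen.symm _ _ h

theorem Red.trans {l l' l'' : List Letter} (h : Red l l') (h' : Red l' l'') : Red l l'' :=
  Relation.EqvGen.trans _ _ _ h h'

theorem Red.append_left {l l' : List Letter} (a : List Letter) (h : Red l l') :
    Red (a ++ l) (a ++ l') := by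
  induction h with
  | rel l l' h =>
    obtain ⟨u, v, s, rfl, rfl⟩ := h
    exact .rel _ _ ⟨a ++ u, v, s, by simp, by simp⟩
  | refl l => exact .refl _
  | symm _ _ _ ih => exact ih.symm
  | trans _ _ _ _ _ ih1 ih2 => exact ih1.trans ih2

theorem Red.append_right {l l' : List Letter} (h : Red l l') (a : List Letter) :
    Red (l ++ a) (l' ++ a) := by
  induction h with
  | rel l l' h =>
    obtain ⟨u, v, s, rfl, rfl⟩ := h
    exact .rel _ _ ⟨u, v ++ a, s, by simp, by simp⟩
  | refl l => exact .refl _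
  | symm _ _ _ ih => exact ih.symm
  | trans _ _ _ _ _ ih1 ih2 => exact ih1.trans ih2

theorem Red.append {l l' m m' : List Letter} (h : Red l l') (h' : Red m m') :
    Red (l ++ m) (l' ++ m') := (h.append_right m).trans (h'.append_left l')

theorem Red.flatMap {α : Type*} {f g : α → List Letter} (l : List α)
    (h : ∀ x ∈ l, Red (f x) (g x)) : Red (l.flatMap f) (l.flatMap g) := by
  induction l with
  | nil => exact .refl _
  | cons x l ih =>
    simp only [List.flatMap_cons]
    exact (h x (by simp)).append (ih fun y hy => h y (by simp [hy]))

/-- Both directions are proved at once: `Red` is generated as an equivalence relation, and its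
symmetry step exchanges the two claims. -/
theorem Red.reach_update {l l' : List Letter} (h : Red l l') (w : Fin n → List Letter)
    (i : Fin n) : Reach (Function.update w i l) (Function.update w i l') ∧
      Reach (Function.update w i l') (Function.update w i l) := by
  induction h with
  | rel l l' h =>
    obtain ⟨u, v, s, rfl, rfl⟩ := h
    constructor
    · have := Reach.delete_pair (w := Function.update w i (u ++ [.inr s, .inr (-s)] ++ v))
        (i := i) s (Function.update_self _ _ _)
      rwa [Function.update_idem] at this
    · have := Reach.insert_pair (w := Function.update w i (u ++ v))
        (i := i) s (Function.update_self _ _ _)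
      rwa [Function.update_idem] at this
  | refl l => exact ⟨.refl _, .refl _⟩
  | symm _ _ _ ih => exact ih.symm
  | trans _ _ _ _ _ ih1 ih2 => exact ⟨ih1.1.trans ih2.1, ih2.2.trans ih1.2⟩

theorem Reach.of_red {w w' : Fin n → List Letter} (h : ∀ i, Red (w i) (w' i)) : Reach w w' := by
  have key : ∀ S : Finset (Fin n), Reach w (S.piecewise w' w) := by
    intro S
    induction S using Finset.induction_on with
    | empty => rw [Finset.piecewise_empty]; exact .refl _
    | insert i S hi ih =>
      rw [Finset.piecewise_insert]
      refine ih.trans ?_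
      have h1 := ((h i).reach_update (S.piecewise w' w) i).1
      have h2 : Function.update (S.piecewise w' w) i (w i) = S.piecewise w' w := by
        rw [Function.update_eq_self_iff, Finset.piecewise_eq_of_notMem _ _ _ hi]
      rwa [h2] at h1
  simpa using key Finset.univ

/-- `|k|` passages under the last component of the sign of `k`. -/
def rep (k : ℤ) : List Letter :=
  List.replicate k.toNat (Sum.inr 1) ++ List.replicate (-k).toNat (Sum.inr (-1))

theorem rep_zero : rep 0 = [] := rfl

theorem rep_natCast (m : ℕ) : rep m = List.replicate m (Sum.inr 1) := by simp [rep]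

theorem rep_neg_natCast (m : ℕ) : rep (-(m : ℤ)) = List.replicate m (Sum.inr (-1)) := by
  simp [rep]

theorem cancel_cons (s : ℤˣ) (l : List Letter) : Red (.inr s :: .inr (-s) :: l) l :=
  .rel _ _ ⟨[], l, s, rfl, rfl⟩

/-- Up to cancellation, words in two opposite signs form an infinite cyclic group, with normal forms
`rep k`. This is the multiplication by a generator. -/
theorem red_cons_rep (s : ℤˣ) (k : ℤ) : Red (.inr s :: rep k) (rep (k + s)) := by
  obtain ⟨m, rfl | rfl⟩ := k.eq_nat_or_neg <;> rcases Int.units_eq_one_or s with rfl | rfl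
  · have : ((m : ℤ) + ((1 : ℤˣ) : ℤ)) = ((m + 1 : ℕ) : ℤ) := by simp
    rw [this, rep_natCast, rep_natCast]
    exact .refl _
  · rcases m with _ | m
    · exact .refl _
    · have : (((m + 1 : ℕ) : ℤ) + ((-1 : ℤˣ) : ℤ)) = (m : ℤ) := by simp
      rw [this, rep_natCast, rep_natCast]
      have := cancel_cons (-1) (List.replicate m (Sum.inr 1))
      rwa [neg_neg] at this
  · rcases m with _ | m
    · exact .refl _
    · have : (-((m + 1 : ℕ) : ℤ) + ((1 : ℤˣ) : ℤ)) = -(m : ℤ) := by simp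
      rw [this, rep_neg_natCast, rep_neg_natCast]
      exact cancel_cons 1 (List.replicate m (Sum.inr (-1)))
  · have : (-(m : ℤ) + ((-1 : ℤˣ) : ℤ)) = -((m + 1 : ℕ) : ℤ) := by simp; ring
    rw [this, rep_neg_natCast, rep_neg_natCast]
    exact .refl _

theorem red_rep_append (a b : ℤ) : Red (rep a ++ rep b) (rep (a + b)) := by
  have step : ∀ (a : ℤ) (s : ℤˣ), Red (rep a ++ rep b) (rep (a + b)) →
      Red (rep (a + s) ++ rep b) (rep (a + s + b)) := by
    intro a s h
    refine ((red_cons_rep s a).symm.append_right _).trans ?_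
    refine (h.append_left [.inr s]).trans ?_
    have : a + s + b = a + b + s := by ring
    rw [this]
    exact red_cons_rep s (a + b)
  induction a using Int.induction_on with
  | zero => rw [rep_zero, zero_add]; exact .refl _
  | succ m ih => exact step _ 1 ih
  | pred m ih => exact step _ (-1) ih

theorem red_rep_neg_append (a : ℤ) : Red (rep (-a) ++ rep a) [] := by
  have := red_rep_append (-a) a
  rwa [neg_add_cancel] at this

theorem red_rep_append_neg (a : ℤ) : Red (rep a ++ rep (-a)) [] := by
  have := red_rep_append a (-a)
  rwa [add_neg_cancel] at this

theorem red_rep_one (s : ℤˣ) : Red (rep s) [.inr s] := by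
  have := (red_cons_rep s 0).symm
  rwa [zero_add] at this

/-! ### Alexander numberings of decorated words -/

/-- The label of the short arc that enters `e`, if `μ` gives the labels of the arcs that enter
the under-crossing passages. -/
def gin (μ : ℕ × ℤˣ → ℤ) (e : Endpoint) : ℤ :=
  if e.isOver = true then μ (tag e) + e.sign else μ (tag e)

/-- The label of the short arc that leaves `e`. -/
def gout (μ : ℕ × ℤˣ → ℤ) (e : Endpoint) : ℤ :=
  if e.isOver = true then μ (tag e) else μ (tag e) + e.sign

/-- Along the linear word the labels change from `g` to `g'`. -/
def Path (μ : ℕ × ℤˣ → ℤ) : ℤ → List Letter → ℤ → Prop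
  | g, [], g' => g = g'
  | g, .inl e :: l, g' => g = gin μ e ∧ Path μ (gout μ e) l g'
  | g, .inr s :: l, g' => Path μ (g + s) l g'

/-- The labels fit together along the cyclic word. -/
def Loop (μ : ℕ × ℤˣ → ℤ) (l : List Letter) : Prop := ∃ g, Path μ g l g

theorem path_append {μ : ℕ × ℤˣ → ℤ} {l l' : List Letter} {g g' : ℤ} :
    Path μ g (l ++ l') g' ↔ ∃ k, Path μ g l k ∧ Path μ k l' g' := by
  induction l generalizing g with
  | nil => simp [Path]
  | cons z l ih => rcases z with e | s <;> simp [Path, ih, and_assoc]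

theorem Path.append {μ : ℕ × ℤˣ → ℤ} {l l' : List Letter} {g k g' : ℤ} (h : Path μ g l k)
    (h' : Path μ k l' g') : Path μ g (l ++ l') g' := path_append.2 ⟨k, h, h'⟩

theorem path_replicate (μ : ℕ × ℤˣ → ℤ) (g : ℤ) (s : ℤˣ) (m : ℕ) :
    Path μ g (List.replicate m (.inr s)) (g + m * s) := by
  induction m generalizing g with
  | zero => simp [Path]
  | succ m ih =>
    rw [List.replicate_succ]
    have := ih (g + s)
    simp only [Path]
    convert this using 1
    push_cast
    ring

theorem path_rep (μ : ℕ × ℤˣ → ℤ) (g k : ℤ) : Path μ g (rep k) (g + k) := by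
  obtain ⟨m, rfl | rfl⟩ := k.eq_nat_or_neg
  · rw [rep_natCast]
    simpa using path_replicate μ g 1 m
  · rw [rep_neg_natCast]
    simpa using path_replicate μ g (-1) m

theorem path_rep_of_eq {μ : ℕ × ℤˣ → ℤ} {g k g' : ℤ} (h : g + k = g') : Path μ g (rep k) g' :=
  h ▸ path_rep μ g k

/-- The passages of a decorated word through base crossings. -/
def baseOf (l : List Letter) : List Endpoint := l.filterMap Sum.getLeft?

@[simp] theorem baseOf_nil : baseOf [] = [] := rfl
@[simp] theorem baseOf_cons_inl (e : Endpoint) (l : List Letter) :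
    baseOf (.inl e :: l) = e :: baseOf l := rfl
@[simp] theorem baseOf_cons_inr (s : ℤˣ) (l : List Letter) :
    baseOf (.inr s :: l) = baseOf l := rfl
@[simp] theorem baseOf_append (l l' : List Letter) : baseOf (l ++ l') = baseOf l ++ baseOf l' :=
  List.filterMap_append
@[simp] theorem baseOf_rep (k : ℤ) : baseOf (rep k) = [] := by
  simp [baseOf, rep, List.filterMap_replicate]
theorem baseOf_flatMap {α : Type*} (l : List α) (f : α → List Letter) :
    baseOf (l.flatMap f) = l.flatMap fun x => baseOf (f x) := by
  induction l with
  | nil => rfl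
  | cons x l ih => simp [ih]

/-- A passage with decorations that bring the labels before and after it to zero. -/
def decPiece (μ : ℕ × ℤˣ → ℤ) (e : Endpoint) : List Letter :=
  rep (gin μ e) ++ .inl e :: rep (-gout μ e)

/-- The standard decoration of a word with respect to `μ`. -/
def dec (μ : ℕ × ℤˣ → ℤ) (l : List Endpoint) : List Letter := l.flatMap (decPiece μ)

/-! ### Standard decorations and the change of labels -/

theorem path_decPiece (μ : ℕ × ℤˣ → ℤ) (e : Endpoint) : Path μ 0 (decPiece μ e) 0 := by
  refine (path_rep_of_eq (zero_add _)).append ?_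
  exact ⟨rfl, path_rep_of_eq (add_neg_cancel _)⟩

theorem loop_dec (μ : ℕ × ℤˣ → ℤ) (l : List Endpoint) : Loop μ (dec μ l) := by
  refine ⟨0, ?_⟩
  induction l with
  | nil => rfl
  | cons e l ih => exact (path_decPiece μ e).append ih

@[simp] theorem baseOf_dec (μ : ℕ × ℤˣ → ℤ) (l : List Endpoint) : baseOf (dec μ l) = l := by
  rw [dec, baseOf_flatMap]
  simp [decPiece]

/-- The labels at both ends of a run of signs determine its sum, hence the run up to cancellation.
Each run may thus be rerouted through the label 0, which produces the standard decoration between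
two correction terms at the ends of the word. -/
theorem red_of_path {μ : ℕ × ℤˣ → ℤ} {l : List Letter} {g g' : ℤ} (h : Path μ g l g') :
    Red l (rep (-g) ++ (dec μ (baseOf l) ++ rep g')) := by
  induction l generalizing g with
  | nil =>
    obtain rfl : g = g' := h
    exact (red_rep_neg_append g).symm
  | cons z l ih =>
    rcases z with e | s
    · obtain ⟨rfl, h⟩ := h
      refine ((ih h).append_left [.inl e]).trans ?_
      have := ((red_rep_neg_append (gin μ e)).append_right
        (.inl e :: (rep (-gout μ e) ++ (dec μ (baseOf l) ++ rep g')))).symm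
      refine this.trans (.of_eq ?_)
      simp [dec, decPiece]
    · refine ((ih h).append_left [.inr s]).trans ?_
      have := (red_cons_rep s (-(g + s))).append_right (dec μ (baseOf l) ++ rep g')
      have e : -(g + (s : ℤ)) + s = -g := by ring
      rw [e] at this
      simpa using this

/-- On a closed word the two correction terms of `red_of_path` are inverse to each other; a change
of base point makes them adjacent and they cancel. -/
theorem reach_dec_and_reach_of_loop {μ : ℕ × ℤˣ → ℤ} {w : Fin n → List Letter}
    (h : ∀ i, Loop μ (w i)) :
    Reach w (fun i => dec μ (baseOf (w i))) ∧ Reach (fun i => dec μ (baseOf (w i))) w := by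
  choose g hg using h
  have h1 : ∀ i, Red (w i) (rep (-g i) ++ (dec μ (baseOf (w i)) ++ rep (g i))) :=
    fun i => red_of_path (hg i)
  have h2 : ∀ i, (rep (-g i) ++ (dec μ (baseOf (w i)) ++ rep (g i))) ~r
      ((dec μ (baseOf (w i)) ++ rep (g i)) ++ rep (-g i)) := fun i => List.isRotated_append
  have h3 : ∀ i, Red ((dec μ (baseOf (w i)) ++ rep (g i)) ++ rep (-g i))
      (dec μ (baseOf (w i))) := by
    intro i
    have := (red_rep_append_neg (g i)).append_left (dec μ (baseOf (w i)))
    simpa using this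
  exact ⟨(Reach.of_red h1).trans ((Reach.of_isRotated h2).trans (Reach.of_red h3)),
    (Reach.of_red fun i => (h3 i).symm).trans
      ((Reach.of_isRotated fun i => (h2 i).symm).trans (Reach.of_red fun i => (h1 i).symm))⟩

theorem flatMap_slideIn_rep (c : ℕ × ℤˣ) (s : ℤˣ) (k : ℤ) :
    (rep k).flatMap (slideIn c s) = rep k := by
  simp [rep, List.flatMap_append, List.flatMap_replicate, slideIn]

theorem flatMap_slideOut_rep (c : ℕ × ℤˣ) (s : ℤˣ) (k : ℤ) :
    (rep k).flatMap (slideOut c s) = rep k := by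
  simp [rep, List.flatMap_append, List.flatMap_replicate, slideOut]

/-- In front of both passages through `c` a pair of signs `s`, `-s` is created, and `-s` is slid
behind the crossing. This raises all four labels at `c` by `s`. -/
theorem reach_dec_update_unit (b : Fin n → List Endpoint) (μ : ℕ × ℤˣ → ℤ) (c : ℕ × ℤˣ)
    (s : ℤˣ) : Reach (fun i => dec μ (b i))
      (fun i => dec (Function.update μ c (μ c + s)) (b i)) := by
  -- `P` contains the sign `s` that stays in front; the travelling sign `-s` is supplied by
  -- `slideIn` and `slideOut`.
  let P : Endpoint → List Letter := fun e => rep (gin μ e) ++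
    ((if tag e = c then [.inr s] else []) ++ .inl e :: rep (-gout μ e))
  refine Reach.trans (w' := fun i => ((b i).flatMap P).flatMap (slideIn c (-s))) ?_
    (Reach.trans (w' := fun i => ((b i).flatMap P).flatMap (slideOut c (-s))) ?_ ?_)
  · refine Reach.of_red fun i => ?_
    rw [List.flatMap_assoc]
    refine Red.flatMap _ fun e _ => ?_
    by_cases he : tag e = c
    · simp only [P, he, if_true, List.flatMap_append, List.flatMap_cons, flatMap_slideIn_rep,
        slideIn, List.flatMap_nil]
      exact ((cancel_cons s (.inl e :: rep (-gout μ e))).symm).append_left _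
    · simp only [P, he, if_false, List.flatMap_append, List.flatMap_cons, flatMap_slideIn_rep,
        slideIn, List.flatMap_nil]
      exact .refl _
  · exact Reach.slide c (-s) (fun _ => rfl) (fun _ => rfl)
  · refine Reach.of_red fun i => ?_
    rw [List.flatMap_assoc]
    refine Red.flatMap _ fun e _ => ?_
    by_cases he : tag e = c
    · have h1 : gin (Function.update μ c (μ c + s)) e = gin μ e + s := by
        unfold gin
        simp only [he, Function.update_self]
        split_ifs <;> ring
      have h2 : gout (Function.update μ c (μ c + s)) e = gout μ e + s := by
        unfold gout
        simp only [he, Function.update_self]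
        split_ifs <;> ring
      have h3 : Red (rep (gin μ e) ++ [.inr s]) (rep (gin μ e + s)) :=
        ((red_rep_one s).symm.append_left _).trans (red_rep_append _ _)
      have h4 : Red (.inr (-s) :: rep (-gout μ e)) (rep (-(gout μ e + s))) := by
        have := red_cons_rep (-s) (-gout μ e)
        rwa [Units.val_neg, ← neg_add] at this
      rw [decPiece, h1, h2]
      refine Red.trans (.of_eq ?_) (h3.append (h4.append_left [.inl e]))
      simp only [P, he, if_true, List.flatMap_append, List.flatMap_cons, flatMap_slideOut_rep,
        slideOut, List.flatMap_nil]
      simp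
    · have h1 : gin (Function.update μ c (μ c + s)) e = gin μ e := by
        unfold gin
        simp only [Function.update_of_ne he]
      have h2 : gout (Function.update μ c (μ c + s)) e = gout μ e := by
        unfold gout
        simp only [Function.update_of_ne he]
      rw [decPiece, h1, h2]
      simp only [P, he, if_false, List.flatMap_append, List.flatMap_cons, flatMap_slideOut_rep,
        slideOut, List.flatMap_nil]
      exact .refl _

theorem reach_dec_update (b : Fin n → List Endpoint) (μ : ℕ × ℤˣ → ℤ) (c : ℕ × ℤˣ)
    (k : ℤ) : Reach (fun i => dec μ (b i))
      (fun i => dec (Function.update μ c (μ c + k)) (b i)) := by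
  have step : ∀ (k : ℤ) (s : ℤˣ), Reach (fun i => dec (Function.update μ c (μ c + k)) (b i))
      (fun i => dec (Function.update μ c (μ c + (k + s))) (b i)) := by
    intro k s
    have := reach_dec_update_unit b (Function.update μ c (μ c + k)) c s
    rwa [Function.update_idem, Function.update_self, add_assoc] at this
  induction k using Int.induction_on with
  | zero => rw [add_zero, Function.update_eq_self]; exact .refl _
  | succ m ih => exact ih.trans (step _ 1)
  | pred m ih => exact ih.trans (step _ (-1))

theorem reach_dec_dec (b : Fin n → List Endpoint) (μ μ' : ℕ × ℤˣ → ℤ) :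
    Reach (fun i => dec μ (b i)) (fun i => dec μ' (b i)) := by
  have key : ∀ S : Finset (ℕ × ℤˣ),
      Reach (fun i => dec μ (b i)) (fun i => dec (S.piecewise μ' μ) (b i)) := by
    intro S
    induction S using Finset.induction_on with
    | empty => rw [Finset.piecewise_empty]; exact .refl _
    | insert c S hc ih =>
      rw [Finset.piecewise_insert]
      refine ih.trans ?_
      have := reach_dec_update b (S.piecewise μ' μ) c (μ' c - S.piecewise μ' μ c)
      rwa [add_sub_cancel] at this
  -- Labels are changed at one crossing at a time, so only the finitely many crossings that occur in
  -- `b` may be treated; no other values of `μ` enter.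
  have h := key (Finset.univ.biUnion fun i => ((b i).map tag).toFinset)
  convert h using 1
  funext i
  refine List.flatMap_congr fun e he => ?_
  have hm : tag e ∈ Finset.univ.biUnion fun i => ((b i).map tag).toFinset := by
    simp only [Finset.mem_biUnion, Finset.mem_univ, true_and, List.mem_toFinset, List.mem_map]
    exact ⟨i, e, he, rfl⟩
  simp only [decPiece, gin, gout, Finset.piecewise_eq_of_mem _ _ _ hm]

/-- `E` is, up to the order of the crossings along the last component, an Alexander system for
`D`. -/
def Augments (D : VirtualLinkDiagram n) (E : VirtualLinkDiagram (n + 1)) : Prop :=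
  ∃ (w : Fin n → List Letter) (μ : ℕ × ℤˣ → ℤ), Realizes E w ∧ (∀ i, baseOf (w i) = D.word i) ∧
    ∀ i, Loop μ (w i)

theorem Augments.exists_realizes {D : VirtualLinkDiagram n} {E : VirtualLinkDiagram (n + 1)}
    (h : Augments D E) {w' : Fin n → List Letter} {μ' : ℕ × ℤˣ → ℤ}
    (hb : ∀ i, baseOf (w' i) = D.word i) (hl : ∀ i, Loop μ' (w' i)) :
    ∃ E', SemiWeldedEquivalent E E' ∧ Realizes E' w' := by
  obtain ⟨w, μ, hE, hw, hμ⟩ := h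
  have h1 := (reach_dec_and_reach_of_loop hμ).1
  have h2 := (reach_dec_and_reach_of_loop hl).2
  simp only [hw] at h1
  simp only [hb] at h2
  exact (h1.trans ((reach_dec_dec _ μ μ').trans h2)) E hE

/-- Any two Alexander systems of a diagram are semi-welded equivalent. -/
theorem Augments.semiWeldedEquivalent {D : VirtualLinkDiagram n}
    {E E' : VirtualLinkDiagram (n + 1)} (h : Augments D E) (h' : Augments D E') :
    SemiWeldedEquivalent E E' := by
  obtain ⟨w, μ, hE', hw, hμ⟩ := h'
  obtain ⟨E'', h1, h2⟩ := h.exists_realizes hw hμ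
  exact .trans _ _ _ h1 (h2.semiWeldedEquivalent hE')

/-! ### Reidemeister moves of the base diagram -/

/-- `y` is the cyclic successor of `x` in the list `l`, where `x` may be the only entry. -/
def CyclicNext (l : List Endpoint) (x y : Endpoint) : Prop :=
  ∃ t, l ~r (x :: t) ∧ (t ++ [x]).head? = some y

/-- Every endpoint occurs once in a diagram, so cyclic successors and predecessors are unique. `Adj`
involves at least two entries, which excludes the circle with a single passage. -/
theorem CyclicNext.eq_iff {D : VirtualLinkDiagram n} {i : Fin n} {x y x₀ y₀ : Endpoint}
    (h : CyclicNext (D.word i) x y) (h₀ : D.Adj x₀ y₀) : x = x₀ ↔ y = y₀ := by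
  obtain ⟨t, ht, hy⟩ := h
  obtain ⟨j, t₀, h₀⟩ := h₀
  have hd := D.nodup_word i
  constructor
  · rintro rfl
    obtain rfl : i = j := comp_unique (e := x) (ht.mem_iff.2 (by simp)) (h₀.mem_iff.2 (by simp))
    have := List.Nodup.eq_of_cons_isRotated_cons (ht.nodup_iff.1 hd) (ht.symm.trans h₀)
    rw [this] at hy
    simpa using hy.symm
  · rintro rfl
    rcases t with _ | ⟨z, t⟩
    · obtain rfl : x = y := by simpa using hy
      obtain rfl : i = j := comp_unique (e := x) (ht.mem_iff.2 (by simp)) (h₀.mem_iff.2 (by simp))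
      have := (ht.symm.trans h₀).perm.length_eq
      simp at this
    · obtain rfl : z = y := by simpa using hy
      obtain rfl : i = j := comp_unique (e := z) (ht.mem_iff.2 (by simp)) (h₀.mem_iff.2 (by simp))
      have h1 : D.word i ~r (z :: (t ++ [x])) := ht.trans (List.isRotated_append (l := [x]))
      have h2 : D.word i ~r (z :: (t₀ ++ [x₀])) := h₀.trans (List.isRotated_append (l := [x₀]))
      have := List.Nodup.eq_of_cons_isRotated_cons (h1.nodup_iff.1 hd) (h1.symm.trans h2)
      simpa using congrArg List.getLast? this

theorem loop_flatMap {μ : ℕ × ℤˣ → ℤ} {νi νo : Endpoint → ℤ} {P : Endpoint → List Letter}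
    {l : List Endpoint} (hP : ∀ e ∈ l, Path μ (νi e) (P e) (νo e))
    (hc : ∀ x y, CyclicNext l x y → νo x = νi y) : Loop μ (l.flatMap P) := by
  rcases hl : l with _ | ⟨a, l'⟩
  · exact ⟨0, rfl⟩
  -- The labels are followed from `x` to the end of the list, where the cyclic condition leads back
  -- to its first entry `a`.
  have key : ∀ (t pre : List Endpoint) (x : Endpoint), l = pre ++ x :: t →
      Path μ (νi x) ((x :: t).flatMap P) (νi a) := by
    intro t
    induction t with
    | nil =>
      intro pre x h
      have h1 : νo x = νi a := by
        refine hc x a ⟨pre, h ▸ List.isRotated_append, ?_⟩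
        rw [← h, hl]
        rfl
      rw [List.flatMap_cons, List.flatMap_nil, List.append_nil, ← h1]
      exact hP x (by simp [h])
    | cons y t ih =>
      intro pre x h
      have h1 : νo x = νi y := hc x y ⟨y :: t ++ pre, h ▸ List.isRotated_append, rfl⟩
      have h2 := hP x (by simp [h])
      rw [h1] at h2
      rw [List.flatMap_cons]
      exact h2.append (ih (pre ++ [x]) y (by simp [h]))
  exact ⟨νi a, key l' [] a hl⟩

open Classical in
/-- A passage, replaced by the word `M e`, and decorated as in `decPiece`, but not after the
passages that satisfy `A` and not before those that satisfy `B`. -/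
noncomputable def partialPiece (μ : ℕ × ℤˣ → ℤ) (A B : Endpoint → Prop)
    (M : Endpoint → List Letter) (e : Endpoint) : List Letter :=
  (if B e then [] else rep (gin μ e)) ++ (M e ++ if A e then [] else rep (-gout μ e))

open Classical in
-- Between consecutive pieces the label is 0, except in the undecorated gaps after `A` and before
-- `B`; there it is `κo` seen from the left and `κi` seen from the right. Separate `μ` and `μ'`
-- allow the decoration to stay fixed while a move changes the labels.
theorem loop_partialPiece {μ μ' : ℕ × ℤˣ → ℤ} {A B : Endpoint → Prop}
    {M : Endpoint → List Letter} {κi κo : Endpoint → ℤ} {l : List Endpoint}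
    (hP : ∀ e ∈ l, Path μ' (if B e then κi e else gin μ e) (M e)
      (if A e then κo e else gout μ e))
    (hAB : ∀ x y, CyclicNext l x y → (A x ↔ B y))
    (hκ : ∀ x y, CyclicNext l x y → A x → κo x = κi y) :
    Loop μ' (l.flatMap (partialPiece μ A B M)) := by
  refine loop_flatMap (νi := fun e => if B e then κi e else 0)
    (νo := fun e => if A e then κo e else 0) (fun e he => ?_) (fun x y h => ?_)
  · refine Path.append (k := if B e then κi e else gin μ e) ?_ ((hP e he).append ?_)
    · split_ifs
      · rfl
      · exact path_rep_of_eq (zero_add _)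
    · split_ifs
      · rfl
      · exact path_rep_of_eq (add_neg_cancel _)
  · by_cases hx : A x
    · simp only [hx, (hAB x y h).1 hx, if_true]
      exact hκ x y h hx
    · simp only [hx, mt (hAB x y h).2 hx, if_false]

theorem baseOf_partialPiece (μ : ℕ × ℤˣ → ℤ) (A B : Endpoint → Prop)
    (M : Endpoint → List Letter) (e : Endpoint) :
    baseOf (partialPiece μ A B M e) = baseOf (M e) := by
  unfold partialPiece
  split_ifs <;> simp

theorem baseOf_flatMap_partialPiece (μ : ℕ × ℤˣ → ℤ) (A B : Endpoint → Prop)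
    (l : List Endpoint) :
    baseOf (l.flatMap (partialPiece μ A B fun e => [.inl e])) = l := by
  rw [baseOf_flatMap]
  simp [baseOf_partialPiece]

/-! ### Preparing an Alexander system for a move of its base -/

theorem Realizes.adj {E : VirtualLinkDiagram (n + 1)} {w : Fin n → List Letter}
    (h : Realizes E w) {i : Fin n} {x y : Endpoint} {t : List Letter}
    (hw : w i ~r (.inl x :: .inl y :: t)) :
    E.Adj x y ∧ ¬ E.LastLabel x.label ∧ ¬ E.LastLabel y.label := by
  obtain ⟨k, hk⟩ := hw
  rw [← h.word, ← List.map_rotate] at hk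
  obtain ⟨x', r, hr, hx, hk⟩ := List.map_eq_cons_iff.1 hk
  obtain ⟨y', r, rfl, hy, -⟩ := List.map_eq_cons_iff.1 hk
  obtain ⟨rfl, hx'⟩ := letter_eq_inl hx
  obtain ⟨rfl, hy'⟩ := letter_eq_inl hy
  exact ⟨⟨i.castSucc, r, k, hr⟩, hx', hy'⟩

/-- No passage under `ω` separates the two members of a pair, so the adjacency that the move
requires in `D` holds in `E` as well. -/
theorem Realizes.adj_of_partialPiece {D : VirtualLinkDiagram n} {E : VirtualLinkDiagram (n + 1)}
    {μ : ℕ × ℤˣ → ℤ} {A B : Endpoint → Prop}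
    (h : Realizes E fun i => (D.word i).flatMap (partialPiece μ A B fun e => [.inl e]))
    {x y : Endpoint} (hxy : D.Adj x y) (hx : A x) (hy : B y) :
    E.Adj x y ∧ ¬ E.LastLabel x.label ∧ ¬ E.LastLabel y.label := by
  obtain ⟨i, t, ht⟩ := hxy
  have h1 := ht.flatMap (partialPiece μ A B fun e => [.inl e])
  simp only [List.flatMap_cons, partialPiece, hx, hy, if_true, List.append_nil,
    List.nil_append, List.append_assoc] at h1
  exact h.adj (h1.trans List.isRotated_append)

/-- An arrangement of pairs of consecutive passages of `D`, where `A` holds for the first and `B`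
for the second ones, and of labels `μ` that agree between them, so that no decoration is
needed there. -/
structure Pairing (D : VirtualLinkDiagram n) (μ : ℕ × ℤˣ → ℤ) (A B : Endpoint → Prop) :
    Prop where
  iff : ∀ i x y, CyclicNext (D.word i) x y → (A x ↔ B y)
  label_eq : ∀ i x y, CyclicNext (D.word i) x y → A x → gout μ x = gin μ y

theorem Pairing.exists_realizes {D : VirtualLinkDiagram n} {E : VirtualLinkDiagram (n + 1)}
    {μ : ℕ × ℤˣ → ℤ} {A B : Endpoint → Prop} (hp : Pairing D μ A B) (h : Augments D E) :
    ∃ E', SemiWeldedEquivalent E E' ∧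
      Realizes E' fun i => (D.word i).flatMap (partialPiece μ A B fun e => [.inl e]) := by
  refine h.exists_realizes (μ' := μ) (fun i => baseOf_flatMap_partialPiece _ _ _ _) fun i => ?_
  refine loop_partialPiece (κi := gin μ) (κo := gout μ) (fun e he => ?_) (hp.iff i)
    (hp.label_eq i)
  simp [Path]

/-- Delete the base crossings whose names do not satisfy `p`. -/
def keep (p : ℕ → Bool) : Letter → Bool
  | .inl e => p e.label
  | .inr _ => true

theorem Realizes.restrict {E : VirtualLinkDiagram (n + 1)} {w : Fin n → List Letter}
    (h : Realizes E w) {p : ℕ → Bool} (hp : ∀ l, E.LastLabel l → p l = true) :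
    Realizes (E.restrict p) fun i => (w i).filter (keep p) := by
  have hlast : (E.restrict p).word (Fin.last n) = E.word (Fin.last n) :=
    List.filter_eq_self.2 fun e he => hp _ (lastLabel_of_mem he)
  have hL : ∀ l, (E.restrict p).LastLabel l ↔ E.LastLabel l := by
    intro l
    unfold LastLabel
    rw [hlast]
  have hlet : (E.restrict p).letter = E.letter := by
    funext e
    simp only [letter, hL]
  refine ⟨fun e he => h.isOver e (by rwa [hlast] at he), fun i => ?_⟩
  rw [hlet, ← h.word, List.filter_map]
  refine congrArg _ (List.filter_congr fun e _ => ?_)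
  by_cases hl : E.LastLabel e.label
  · simp [letter_of_lastLabel hl, keep, hp _ hl]
  · simp [letter_of_not_lastLabel hl, keep]

theorem filter_keep_rep (p : ℕ → Bool) (k : ℤ) : (rep k).filter (keep p) = rep k := by
  rw [List.filter_eq_self]
  intro z hz
  simp only [rep, List.mem_append, List.mem_replicate] at hz
  rcases hz with ⟨-, rfl⟩ | ⟨-, rfl⟩ <;> rfl

open Classical in
-- This is the common part of the first two Reidemeister moves. The old decoration still fits after
-- a pair `x`, `y` is deleted, because the label that enters `x` equals the one that leaves `y`.
theorem Pairing.augments_restrict {D D' : VirtualLinkDiagram n} {E : VirtualLinkDiagram (n + 1)}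
    {μ : ℕ × ℤˣ → ℤ} {A B : Endpoint → Prop} {p : ℕ → Bool} (hp : Pairing D μ A B)
    (hE : Realizes E fun i => (D.word i).flatMap (partialPiece μ A B fun e => [.inl e]))
    (hl : ∀ l, E.LastLabel l → p l = true)
    (hpt : ∀ e, D.Mem e → p e.label = true → ¬ A e ∧ ¬ B e)
    (hpf : ∀ e, D.Mem e → p e.label = false → (A e ↔ ¬ B e))
    (hAB : ∀ i x y, CyclicNext (D.word i) x y → A x → gin μ x = gout μ y)
    (hD' : ∀ i, D'.word i = (D.word i).filter fun e => p e.label) :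
    Augments D' (E.restrict p) := by
  have key : ∀ i, ((D.word i).flatMap (partialPiece μ A B fun e => [.inl e])).filter (keep p) =
      (D.word i).flatMap (partialPiece μ A B fun e => if p e.label then [.inl e] else []) := by
    intro i
    rw [List.filter_flatMap]
    refine List.flatMap_congr fun e _ => ?_
    unfold partialPiece
    rw [List.filter_append, List.filter_append]
    have h1 : (if B e then [] else rep (gin μ e)).filter (keep p) =
        if B e then [] else rep (gin μ e) := by
      split_ifs
      · rfl
      · exact filter_keep_rep _ _
    have h2 : (if A e then [] else rep (-gout μ e)).filter (keep p) =
        if A e then [] else rep (-gout μ e) := by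
      split_ifs
      · rfl
      · exact filter_keep_rep _ _
    rw [h1, h2]
    rcases hpe : p e.label <;> simp [hpe, keep]
  refine ⟨_, μ, hE.restrict hl, fun i => ?_, fun i => ?_⟩
  · rw [key, baseOf_flatMap, hD']
    simp only [baseOf_partialPiece]
    induction D.word i with
    | nil => rfl
    | cons e l ih => rcases hpe : p e.label <;> simp [hpe, ih]
  · rw [key]
    -- A deleted passage no longer changes the label: the first of a pair hands on the label that
    -- entered it, and the second receives the one that left it.
    refine loop_partialPiece (κi := gout μ) (κo := gin μ) (fun e he => ?_) (hp.iff i) (hAB i)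
    rcases hpe : p e.label
    · have := hpf e ⟨i, he⟩ hpe
      by_cases hB : B e
      · simp [hB, this, Path]
      · simp [hB, this, Path]
    · obtain ⟨h1, h2⟩ := hpt e ⟨i, he⟩ hpe
      simp [h1, h2, Path]

/-! ### Lifting the Reidemeister moves of the base diagram -/

theorem gin_partner (μ : ℕ × ℤˣ → ℤ) (e : Endpoint) : gin μ e.partner = gout μ e := by
  rcases h : e.isOver <;> simp [gin, gout, h, tag]

theorem gout_partner (μ : ℕ × ℤˣ → ℤ) (e : Endpoint) : gout μ e.partner = gin μ e := by
  rcases h : e.isOver <;> simp [gin, gout, h, tag]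

/-- By the Alexander rule the arc that leaves `x` and the one that enters its partner have equal
labels for every `μ`. So the loop needs no decoration, and `μ = 0` will do. -/
theorem Omega1.exists_augments {D D' : VirtualLinkDiagram n} (h : Omega1 D D')
    {E : VirtualLinkDiagram (n + 1)} (hE : Augments D' E) :
    ∃ E', Augments D E' ∧ SemiWeldedEquivalent E E' := by
  obtain ⟨x, hx, h⟩ := h
  have hnext : ∀ i y z, CyclicNext (D'.word i) y z → (y = x ↔ z = x.partner) :=
    fun i y z hyz => hyz.eq_iff hx
  have hp : Pairing D' 0 (· = x) (· = x.partner) := by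
    refine ⟨hnext, fun i y z hyz hy => ?_⟩
    rw [(hnext i y z hyz).1 hy, hy, gin_partner]
  obtain ⟨E', hEE', hR⟩ := hp.exists_realizes hE
  obtain ⟨hadj, hxl, -⟩ := hR.adj_of_partialPiece hx rfl rfl
  refine ⟨E'.restrict fun l => l ≠ x.label, hp.augments_restrict hR ?_ ?_ ?_ ?_ h,
    .trans _ _ _ hEE' (.symm _ _ (.rel _ _ (Or.inl (Or.inr (Or.inl ⟨x, hadj, fun _ => rfl⟩)))))⟩
  · rintro l hl
    simp only [decide_eq_true_eq]
    rintro rfl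
    exact hxl hl
  · intro e _ he
    simp only [decide_eq_true_eq] at he
    constructor <;> rintro rfl <;> exact he rfl
  · intro e he hl
    simp only [decide_eq_false_iff_not, not_not] at hl
    rcases he.eq_or_eq_partner hx.mem_left hl with rfl | rfl
    · simpa using e.partner_ne.symm
    · simpa using x.partner_ne
  · intro i y z hyz hy
    rw [(hnext i y z hyz).1 hy, hy, gout_partner]

theorem Omega2.exists_augments {D D' : VirtualLinkDiagram n} (h : Omega2 D D')
    {E : VirtualLinkDiagram (n + 1)} (hE : Augments D' E) :
    ∃ E', Augments D E' ∧ SemiWeldedEquivalent E E' := by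
  obtain ⟨a, b, ha, hb, hab, hs, h1, h2, h⟩ := h
  obtain ⟨x, y, h2', hxy⟩ : ∃ x y, D'.Adj x y ∧
      ((x = a.partner ∧ y = b.partner) ∨ (x = b.partner ∧ y = a.partner)) := by
    rcases h2 with h2 | h2
    exacts [⟨_, _, h2, Or.inl ⟨rfl, rfl⟩⟩, ⟨_, _, h2, Or.inr ⟨rfl, rfl⟩⟩]
  -- As the signs are opposite, these labels are 0 outside and `b.sign` between the two tails. At
  -- the heads the two values fit for either order of the passages, so both orientations of the move
  -- are covered.
  let μ : ℕ × ℤˣ → ℤ := fun t => if t.1 = a.label then b.sign else 0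
  have hμa : gin μ a = 0 ∧ gout μ a = b.sign := by
    simp [gin, gout, ha, μ, tag, hs]
  have hμb : gin μ b = b.sign ∧ gout μ b = 0 := by
    simp [gin, gout, hb, μ, tag, hab.symm]
  have hnext : ∀ i u v, CyclicNext (D'.word i) u v → ((u = a ∨ u = x) ↔ (v = b ∨ v = y)) :=
    fun i u v huv => or_congr (huv.eq_iff h1) (huv.eq_iff h2')
  have hgxy : gout μ x = gin μ y ∧ gin μ x = gout μ y := by
    rcases hxy with ⟨rfl, rfl⟩ | ⟨rfl, rfl⟩ <;> simp [gin_partner, gout_partner, hμa, hμb]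
  have hval : ∀ i u v, CyclicNext (D'.word i) u v → (u = a ∨ u = x) →
      gout μ u = gin μ v ∧ gin μ u = gout μ v := by
    rintro i u v huv (rfl | rfl)
    · rw [(huv.eq_iff h1).1 rfl, hμa.1, hμa.2, hμb.1, hμb.2]
      exact ⟨rfl, rfl⟩
    · rw [(huv.eq_iff h2').1 rfl]
      exact hgxy
  have hp : Pairing D' μ (fun e => e = a ∨ e = x) (fun e => e = b ∨ e = y) :=
    ⟨hnext, fun i u v huv hu => (hval i u v huv hu).1⟩
  obtain ⟨E', hEE', hR⟩ := hp.exists_realizes hE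
  obtain ⟨hadj1, hal, hbl⟩ := hR.adj_of_partialPiece h1 (Or.inl rfl) (Or.inl rfl)
  obtain ⟨hadj2, -, -⟩ := hR.adj_of_partialPiece h2' (Or.inr rfl) (Or.inr rfl)
  have hadj2' : E'.Adj a.partner b.partner ∨ E'.Adj b.partner a.partner := by
    rcases hxy with ⟨rfl, rfl⟩ | ⟨rfl, rfl⟩
    exacts [Or.inl hadj2, Or.inr hadj2]
  have hne : a ≠ b ∧ a ≠ b.partner ∧ b ≠ a.partner ∧ a.partner ≠ b.partner := by
    refine ⟨?_, ?_, ?_, ?_⟩ <;> intro h' <;> have := congrArg Endpoint.label h'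
    exacts [hab this, hab this, hab this.symm, hab this]
  have hlabel : x.label = a.label ∧ y.label = b.label ∨ x.label = b.label ∧ y.label = a.label := by
    rcases hxy with ⟨rfl, rfl⟩ | ⟨rfl, rfl⟩
    exacts [Or.inl ⟨rfl, rfl⟩, Or.inr ⟨rfl, rfl⟩]
  refine ⟨E'.restrict fun l => l ≠ a.label ∧ l ≠ b.label,
    hp.augments_restrict hR ?_ ?_ ?_ (fun i u v huv hu => (hval i u v huv hu).2) h,
    .trans _ _ _ hEE' (.symm _ _ (.rel _ _ (Or.inl (Or.inr (Or.inr (Or.inl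
      ⟨a, b, ha, hb, hab, hs, hadj1, hadj2', fun _ => rfl⟩))))))⟩
  · rintro l hl
    simp only [decide_eq_true_eq]
    constructor <;> rintro rfl
    exacts [hal hl, hbl hl]
  · intro e _ he
    simp only [decide_eq_true_eq] at he
    constructor
    · rintro (rfl | rfl)
      · exact he.1 rfl
      · rcases hlabel with hl | hl
        exacts [he.1 hl.1, he.2 hl.1]
    · rintro (rfl | rfl)
      · exact he.2 rfl
      · rcases hlabel with hl | hl
        exacts [he.2 hl.2, he.1 hl.2]
  · intro e he hl
    have hl' : e.label = a.label ∨ e.label = b.label := by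
      simp only [decide_eq_false_iff_not] at hl
      by_contra hc
      rw [not_or] at hc
      exact hl hc
    have pa := a.partner_ne
    have pb := b.partner_ne
    obtain ⟨n1, n2, n3, n4⟩ := hne
    have hcases : e = a ∨ e = a.partner ∨ e = b ∨ e = b.partner := by
      rcases hl' with hl' | hl'
      · rcases he.eq_or_eq_partner h1.mem_left hl' with h' | h'
        exacts [Or.inl h', Or.inr (Or.inl h')]
      · rcases he.eq_or_eq_partner h1.mem_right hl' with h' | h'
        exacts [Or.inr (Or.inr (Or.inl h')), Or.inr (Or.inr (Or.inr h'))]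
    rcases hxy with ⟨rfl, rfl⟩ | ⟨rfl, rfl⟩ <;> rcases hcases with rfl | rfl | rfl | rfl <;>
      simp [n1, n2, n3, n4, n1.symm, n2.symm, n3.symm, n4.symm, pa, pb, pa.symm, pb.symm]

/-- The first of two neighbours `p`, `q`, where `p` comes first if `s = 1`. -/
def fstOf (s : ℤˣ) (p q : Endpoint) : Endpoint := if s = 1 then p else q

/-- The second of two neighbours `p`, `q`, where `p` comes first if `s = 1`. -/
def sndOf (s : ℤˣ) (p q : Endpoint) : Endpoint := if s = 1 then q else p

theorem adjSigned_iff {D : VirtualLinkDiagram n} {s : ℤˣ} {p q : Endpoint} :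
    D.AdjSigned s p q ↔ D.Adj (fstOf s p q) (sndOf s p q) := by
  unfold AdjSigned fstOf sndOf
  split_ifs <;> rfl

theorem eq_fstOf_or_eq_sndOf {s : ℤˣ} {p q e : Endpoint} (h : e = p ∨ e = q) :
    e = fstOf s p q ∨ e = sndOf s p q := by
  unfold fstOf sndOf
  split_ifs
  exacts [h, h.symm]

theorem apply_fstOf {σ : Endpoint → Endpoint} {s : ℤˣ} {p q : Endpoint} (h : σ p = q ∧ σ q = p) :
    σ (fstOf s p q) = sndOf s p q ∧ σ (sndOf s p q) = fstOf s p q := by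
  unfold fstOf sndOf
  split_ifs
  exacts [h, h.symm]

/-- The labels `μ` before and `μ'` after the exchange of the consecutive passages `x`, `y` fit
together. -/
def Exchangeable (μ μ' : ℕ × ℤˣ → ℤ) (x y : Endpoint) : Prop :=
  gout μ x = gin μ y ∧ gin μ x = gin μ' y ∧ gout μ y = gout μ' x ∧ gout μ' y = gin μ' x

theorem exchangeable_fstOf {μ μ' : ℕ × ℤˣ → ℤ} {s : ℤˣ} {p q : Endpoint}
    (h : if s = 1 then Exchangeable μ μ' p q else Exchangeable μ μ' q p) :
    Exchangeable μ μ' (fstOf s p q) (sndOf s p q) := by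
  unfold fstOf sndOf
  split_ifs at h ⊢ <;> exact h

/-- The arcs outside the triangle must keep their labels, and the inner arcs need one label each,
before and after the move. The order of the crossings on the top strand in `Omega3` is what makes
the conditions on all three strands compatible. -/
theorem exists_labels_of_triangle (a b c : Endpoint) (ha : a.isOver = true) (hb : b.isOver = true)
    (hc : c.isOver = true) (hab : a.label ≠ b.label) (hac : a.label ≠ c.label)
    (hbc : b.label ≠ c.label) (δ : ℤˣ) : ∃ μ μ' : ℕ × ℤˣ → ℤ,
    (∀ t : ℕ × ℤˣ, t.1 ≠ a.label → t.1 ≠ b.label → t.1 ≠ c.label → μ t = μ' t) ∧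
    (if δ * a.sign * b.sign * c.sign = 1 then Exchangeable μ μ' a b else Exchangeable μ μ' b a) ∧
    (if δ * a.sign = 1 then Exchangeable μ μ' a.partner c else Exchangeable μ μ' c a.partner) ∧
    (if δ * b.sign = 1 then Exchangeable μ μ' b.partner c.partner
      else Exchangeable μ μ' c.partner b.partner) := by
  -- With label 0 at `c` before the move, the middle and the bottom strand determine the values at
  -- `a` and `b`. The top strand passes to the other side of `c`, which changes the label there to
  -- `-δ`. The remaining conditions are checked for all choices of the four signs.
  let f : ℤ → ℤ → ℤ → ℕ × ℤˣ → ℤ := fun x y z t =>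
    if t.1 = a.label then x else if t.1 = b.label then y else if t.1 = c.label then z else 0
  refine ⟨f (if δ * a.sign = 1 then (c.sign : ℤ) - a.sign else 0)
      (if δ * b.sign = 1 then -(b.sign : ℤ) else c.sign) 0,
    f (if δ * a.sign = 1 then -(a.sign : ℤ) else c.sign)
      (if δ * b.sign = 1 then (c.sign : ℤ) - b.sign else 0) (-(δ : ℤ)), ?_, ?_, ?_, ?_⟩
  · intro t h1 h2 h3
    simp [f, h1, h2, h3]
  all_goals
    simp only [Exchangeable, gin_partner, gout_partner]
    simp only [gin, gout, ha, hb, hc, f, tag, hab.symm, hac.symm, hbc.symm, if_true, if_false]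
    generalize a.sign = sa
    generalize b.sign = sb
    generalize c.sign = sc
    revert δ sa sb sc
    decide

theorem swap3_triangle (a b c : Endpoint) (ha : a.isOver = true) (hb : b.isOver = true)
    (hc : c.isOver = true) (hab : a.label ≠ b.label) (hac : a.label ≠ c.label)
    (hbc : b.label ≠ c.label) :
    let σ := swap3 a b a.partner c b.partner c.partner
    (σ a = b ∧ σ b = a) ∧ (σ a.partner = c ∧ σ c = a.partner) ∧
      (σ b.partner = c.partner ∧ σ c.partner = b.partner) := by
  rcases a with ⟨la, oa, sa⟩
  rcases b with ⟨lb, ob, sb⟩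
  rcases c with ⟨lc, oc, sc⟩
  simp only at ha hb hc hab hac hbc
  subst ha hb hc
  simp [swap3_apply, Equiv.swap_apply_def, Endpoint.partner, hab, hac, hbc, hab.symm, hac.symm,
    hbc.symm]

theorem map_letter_rep (σ : Endpoint → Endpoint) (k : ℤ) :
    (rep k).map (Sum.map σ id : Letter → Letter) = rep k := by
  simp [rep]

theorem map_partialPiece (σ : Endpoint → Endpoint) (μ : ℕ × ℤˣ → ℤ) (A B : Endpoint → Prop)
    (e : Endpoint) : (partialPiece μ A B (fun e => [.inl e]) e).map (Sum.map σ id) =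
      partialPiece μ A B (fun e => [.inl (σ e)]) e := by
  unfold partialPiece
  rw [List.map_append, List.map_append]
  split_ifs <;> simp [map_letter_rep]

open Classical in
-- The decoration, built from the labels `μ`, avoids the sides of the triangle. The move exchanges
-- the passages and leaves the signs in place, and the new labels `μ'` agree with `μ` on the outer
-- arcs.
theorem Omega3.exists_augments {D D' : VirtualLinkDiagram n} (h : Omega3 D D')
    {E : VirtualLinkDiagram (n + 1)} (hE : Augments D E) :
    ∃ E', Augments D' E' ∧ SemiWeldedEquivalent E E' := by
  obtain ⟨a, b, c, ha, hb, hc, hab, hac, hbc, ⟨δ, h1, h2, h3⟩, h⟩ := h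
  obtain ⟨μ, μ', hμ, e1, e2, e3⟩ := exists_labels_of_triangle a b c ha hb hc hab hac hbc δ
  obtain ⟨s1, s2, s3⟩ := swap3_triangle a b c ha hb hc hab hac hbc
  set σ := swap3 a b a.partner c b.partner c.partner with hσ
  have ma := h1.mem_left
  have mb := h1.mem_right
  have mc := h2.mem_right
  rw [adjSigned_iff] at h1 h2 h3
  replace e1 := exchangeable_fstOf e1
  replace e2 := exchangeable_fstOf e2
  replace e3 := exchangeable_fstOf e3
  have t1 := apply_fstOf (s := δ * a.sign * b.sign * c.sign) s1
  have t2 := apply_fstOf (s := δ * a.sign) s2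
  have t3 := apply_fstOf (s := δ * b.sign) s3
  -- These facts tie the ordered neighbours on the three strands to `a`, `b`, `c`, before the
  -- sign-dependent expressions for them are generalized to plain variables.
  have g1 : ∀ e, e = a ∨ e = b → _ := fun e =>
    eq_fstOf_or_eq_sndOf (s := δ * a.sign * b.sign * c.sign)
  have g2 : ∀ e, e = a.partner ∨ e = c → _ := fun e => eq_fstOf_or_eq_sndOf (s := δ * a.sign)
  have g3 : ∀ e, e = b.partner ∨ e = c.partner → _ := fun e =>
    eq_fstOf_or_eq_sndOf (s := δ * b.sign)
  have w1 : ∀ E : VirtualLinkDiagram (n + 1), E.AdjSigned (δ * a.sign * b.sign * c.sign) a b ↔ _ :=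
    fun E => adjSigned_iff
  have w2 : ∀ E : VirtualLinkDiagram (n + 1), E.AdjSigned (δ * a.sign) a.partner c ↔ _ :=
    fun E => adjSigned_iff
  have w3 : ∀ E : VirtualLinkDiagram (n + 1),
    E.AdjSigned (δ * b.sign) b.partner c.partner ↔ _ := fun E => adjSigned_iff
  generalize fstOf (δ * a.sign * b.sign * c.sign) a b = x1 at *
  generalize sndOf (δ * a.sign * b.sign * c.sign) a b = y1 at *
  generalize fstOf (δ * a.sign) a.partner c = x2 at *
  generalize sndOf (δ * a.sign) a.partner c = y2 at *
  generalize fstOf (δ * b.sign) b.partner c.partner = x3 at *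
  generalize sndOf (δ * b.sign) b.partner c.partner = y3 at *
  have hnext : ∀ i u v, CyclicNext (D.word i) u v →
      ((u = x1 ∨ u = x2 ∨ u = x3) ↔ (v = y1 ∨ v = y2 ∨ v = y3)) := fun i u v huv =>
    or_congr (huv.eq_iff h1) (or_congr (huv.eq_iff h2) (huv.eq_iff h3))
  have hval : ∀ i u v, CyclicNext (D.word i) u v → (u = x1 ∨ u = x2 ∨ u = x3) →
      Exchangeable μ μ' u v ∧ σ u = v ∧ σ v = u := by
    rintro i u v huv (rfl | rfl | rfl)
    · rw [(huv.eq_iff h1).1 rfl]; exact ⟨e1, t1⟩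
    · rw [(huv.eq_iff h2).1 rfl]; exact ⟨e2, t2⟩
    · rw [(huv.eq_iff h3).1 rfl]; exact ⟨e3, t3⟩
  have hp : Pairing D μ (fun e => e = x1 ∨ e = x2 ∨ e = x3) (fun e => e = y1 ∨ e = y2 ∨ e = y3) :=
    ⟨hnext, fun i u v huv hu => (hval i u v huv hu).1.1⟩
  have hσe : ∀ e, e ≠ a → e ≠ b → e ≠ a.partner → e ≠ c → e ≠ b.partner → e ≠ c.partner →
      σ e = e := by
    intro e n1 n2 n3 n4 n5 n6
    rw [hσ, swap3_apply, Equiv.swap_apply_of_ne_of_ne n5 n6, Equiv.swap_apply_of_ne_of_ne n3 n4,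
      Equiv.swap_apply_of_ne_of_ne n1 n2]
  have hout : ∀ e, D.Mem e → ¬ (e = x1 ∨ e = x2 ∨ e = x3) → ¬ (e = y1 ∨ e = y2 ∨ e = y3) →
      σ e = e ∧ gin μ e = gin μ' e ∧ gout μ e = gout μ' e := by
    intro e he hA hB
    simp only [not_or] at hA hB
    have n1 : ¬ (e = a ∨ e = b) := fun h' => (g1 e h').elim hA.1 hB.1
    have n2 : ¬ (e = a.partner ∨ e = c) := fun h' => (g2 e h').elim hA.2.1 hB.2.1
    have n3 : ¬ (e = b.partner ∨ e = c.partner) := fun h' => (g3 e h').elim hA.2.2 hB.2.2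
    rw [not_or] at n1 n2 n3
    have l1 : (tag e).1 ≠ a.label := fun h' => (he.eq_or_eq_partner ma h').elim n1.1 n2.1
    have l2 : (tag e).1 ≠ b.label := fun h' => (he.eq_or_eq_partner mb h').elim n1.2 n3.1
    have l3 : (tag e).1 ≠ c.label := fun h' => (he.eq_or_eq_partner mc h').elim n2.2 n3.2
    refine ⟨hσe e n1.1 n1.2 n2.1 n2.2 n3.1 n3.2, ?_, ?_⟩
    · simp only [gin, hμ _ l1 l2 l3]
    · simp only [gout, hμ _ l1 l2 l3]
  obtain ⟨E1, hEE1, hR⟩ := hp.exists_realizes hE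
  have k1 := hR.adj_of_partialPiece h1 (Or.inl rfl) (Or.inl rfl)
  have k2 := hR.adj_of_partialPiece h2 (Or.inr (Or.inl rfl)) (Or.inr (Or.inl rfl))
  have k3 := hR.adj_of_partialPiece h3 (Or.inr (Or.inr rfl)) (Or.inr (Or.inr rfl))
  have a1 := (w1 E1).2 k1.1
  have a2 := (w2 E1).2 k2.1
  have a3 := (w3 E1).2 k3.1
  have na : ¬ E1.LastLabel a.label := by
    rcases g1 a (Or.inl rfl) with h' | h'
    · rw [h']; exact k1.2.1
    · rw [h']; exact k1.2.2
  have nb : ¬ E1.LastLabel b.label := by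
    rcases g1 b (Or.inr rfl) with h' | h'
    · rw [h']; exact k1.2.1
    · rw [h']; exact k1.2.2
  have nc : ¬ E1.LastLabel c.label := by
    rcases g2 c (Or.inr rfl) with h' | h'
    · rw [h']; exact k2.2.1
    · rw [h']; exact k2.2.2
  have hm : ∀ e, E1.Mem (σ e) ↔ E1.Mem e := by
    intro e
    refine exists_congr fun i => ?_
    rw [hσ, swap3_apply, mem_map_swap (a1.mem_word_iff i), mem_map_swap (a2.mem_word_iff i),
      mem_map_swap (a3.mem_word_iff i)]
  have hσl : ∀ e, E1.LastLabel e.label → σ e = e := by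
    intro e he
    apply hσe <;> rintro rfl
    exacts [na he, nb he, na he, nc he, nb he, nc he]
  have hlast : (E1.permute σ hm).word (Fin.last n) = E1.word (Fin.last n) :=
    List.map_eq_self fun e he => hσl e (lastLabel_of_mem he)
  have hL : ∀ l, (E1.permute σ hm).LastLabel l ↔ E1.LastLabel l := by
    intro l
    unfold LastLabel
    rw [hlast]
  have hlet : (E1.permute σ hm).letter = E1.letter := by
    funext e
    simp only [letter, hL]
  have hR2 : Realizes (E1.permute σ hm) fun i => (D.word i).flatMap (partialPiece μ
      (fun e => e = x1 ∨ e = x2 ∨ e = x3) (fun e => e = y1 ∨ e = y2 ∨ e = y3)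
      fun e => [.inl (σ e)]) := by
    refine ⟨fun e he => hR.isOver e (by rwa [hlast] at he), fun i => ?_⟩
    have := congrArg (List.map (Sum.map σ id)) (hR.word i)
    rw [List.map_flatMap] at this
    simp only [map_partialPiece] at this
    rw [← this, hlet]
    change ((E1.word i.castSucc).map σ).map E1.letter = _
    rw [List.map_map, List.map_map]
    refine List.map_congr_left fun e _ => ?_
    simp only [Function.comp]
    by_cases hl : E1.LastLabel e.label
    · rw [hσl e hl, letter_of_lastLabel hl]
      rfl
    · rw [letter_of_not_lastLabel hl, letter_of_not_lastLabel]
      · rfl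
      · exact (lastLabel_swap_iff na nb nc e).not.2 hl
  refine ⟨E1.permute σ hm, ⟨_, μ', hR2, fun i => ?_, fun i => ?_⟩, .trans _ _ _ hEE1
    (.rel _ _ (Or.inl (Or.inr (Or.inr (Or.inr ⟨a, b, c, ha, hb, hc, hab, hac, hbc,
      ⟨δ, a1, a2, a3⟩, fun _ => rfl⟩)))))⟩
  · rw [baseOf_flatMap, h]
    simp only [baseOf_partialPiece, baseOf_cons_inl, baseOf_nil]
    rw [List.map_eq_flatMap]
    rfl
  -- The place of `e` is now taken by `σ e`. Within a pair this is the other member, so the label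
  -- inside the gap is read off from `μ'`.
  · refine loop_partialPiece (κi := fun e => gin μ' (σ e)) (κo := fun e => gout μ' (σ e))
      (fun e he => ?_) (hnext i) fun u v huv hu => ?_
    · refine ⟨?_, ?_⟩
      · split_ifs with hB
        · rfl
        · by_cases hA : e = x1 ∨ e = x2 ∨ e = x3
          · rcases hA with rfl | rfl | rfl
            · rw [t1.1]; exact e1.2.1
            · rw [t2.1]; exact e2.2.1
            · rw [t3.1]; exact e3.2.1
          · obtain ⟨i1, i2, -⟩ := hout e ⟨i, he⟩ hA hB
            rw [i1, i2]
      · change gout μ' (σ e) = _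
        split_ifs with hA
        · rfl
        · by_cases hB : e = y1 ∨ e = y2 ∨ e = y3
          · rcases hB with rfl | rfl | rfl
            · rw [t1.2]; exact e1.2.2.1.symm
            · rw [t2.2]; exact e2.2.2.1.symm
            · rw [t3.2]; exact e3.2.2.1.symm
          · obtain ⟨i1, -, i2⟩ := hout e ⟨i, he⟩ hA hB
            rw [i1, i2]
    · obtain ⟨i1, i2, i3⟩ := hval i u v huv hu
      simp only [i2, i3]
      exact i1.2.2.2

/-- The decoration for `μ = 0` does not depend on names, so it is compatible with renaming and with
a change of base points. -/
theorem Iso.exists_augments {D D' : VirtualLinkDiagram n} (h : Iso D D')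
    {E : VirtualLinkDiagram (n + 1)} (hE : Augments D E) :
    ∃ E', Augments D' E' ∧ SemiWeldedEquivalent E E' := by
  obtain ⟨f, h⟩ := h
  obtain ⟨E1, hEE1, hR⟩ := hE.exists_realizes (w' := fun i => dec 0 (D.word i))
    (fun i => baseOf_dec 0 _) (fun i => loop_dec 0 _)
  have hL : ∀ l, (E1.rename f).LastLabel (f l) ↔ E1.LastLabel l := by
    intro l
    simp [LastLabel, rename]
  have hR2 : Realizes (E1.rename f) fun i => dec 0 ((D.word i).map (Endpoint.relabel f)) := by
    refine ⟨fun e he => ?_, fun i => ?_⟩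
    · obtain ⟨z, hz, rfl⟩ := List.mem_map.1 he
      exact hR.isOver z hz
    · have hpiece : ∀ e, decPiece 0 (e.relabel f) =
          (decPiece 0 e).map (Sum.map (Endpoint.relabel f) id) := by
        intro e
        simp [decPiece, map_letter_rep, gin, gout]
      have := congrArg (List.map (Sum.map (Endpoint.relabel f) id)) (hR.word i)
      rw [dec, List.map_flatMap] at this
      rw [dec, List.flatMap_map]
      simp only [hpiece]
      rw [← this]
      change ((E1.word i.castSucc).map (Endpoint.relabel f)).map _ = _
      rw [List.map_map, List.map_map]
      refine List.map_congr_left fun e _ => ?_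
      simp only [Function.comp]
      by_cases hl : E1.LastLabel e.label
      · rw [letter_of_lastLabel hl, letter_of_lastLabel ((hL _).2 hl)]
        rfl
      · rw [letter_of_not_lastLabel hl, letter_of_not_lastLabel ((hL _).not.2 hl)]
        rfl
  obtain ⟨E2, h1, h2⟩ := Reach.of_isRotated (w' := fun i => dec 0 (D'.word i))
    (fun i => (h i).symm.flatMap _) _ hR2
  exact ⟨E2, ⟨_, 0, h2, fun i => baseOf_dec 0 _, fun i => loop_dec 0 _⟩, .trans _ _ _ hEE1
    (.trans _ _ _ (.rel _ _ (Or.inl (Or.inl (E1.iso_rename f)))) h1)⟩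

/-! ### The `Zh`-construction is an Alexander system -/

theorem baseOf_map_letter (E : VirtualLinkDiagram (n + 1)) (i : Fin n) :
    baseOf ((E.word i.castSucc).map E.letter) = E.base.word i := by
  simp only [base, baseOf, List.filterMap_map]
  rw [← List.filterMap_eq_filter]
  refine List.filterMap_congr fun e _ => ?_
  by_cases hl : E.LastLabel e.label
  · have hl' : e.label ∈ (E.word (Fin.last n)).map Endpoint.label := hl
    simp only [Function.comp, letter_of_lastLabel hl, Sum.getLeft?_inr]
    simp [Option.guard, hl']
  · have hl' : e.label ∉ (E.word (Fin.last n)).map Endpoint.label := hl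
    simp only [Function.comp, letter_of_not_lastLabel hl, Sum.getLeft?_inl]
    simp only [Option.guard, hl']
    simp

theorem augments_base {E : VirtualLinkDiagram (n + 1)} {μ : ℕ × ℤˣ → ℤ}
    (ho : ∀ e ∈ E.word (Fin.last n), e.isOver = true)
    (hl : ∀ i : Fin n, Loop μ ((E.word i.castSucc).map E.letter)) : Augments E.base E :=
  ⟨_, μ, ⟨ho, fun _ => rfl⟩, baseOf_map_letter E, hl⟩

/-- The arcs of `D` between the pieces all get the label 0. At each crossing `ω` separates off the
two short arcs on the chosen side, and their labels are shifted as the Alexander rule demands. -/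
theorem augments_base_zhOp (D : VirtualLinkDiagram n) (side : ℕ → Side) (ω : List Endpoint)
    (hω : ω.Perm (D.zhOvers side)) :
    Augments (D.zhOp side ω hω).base (D.zhOp side ω hω) := by
  have hlast : (D.zhOp side ω hω).word (Fin.last n) = ω := by simp [zhOp]
  -- The crossing `c` of `D` is now called `3 * c`, hence the division. On the right the labels are
  -- `m + 1 = 0` and `m = -1`, on the left `m = 0` and `m + 1 = 1`; the sign decides on which side
  -- the lower strand enters.
  refine augments_base (μ := fun t => if side (t.1 / 3) = .right then (if t.2 = 1 then -1 else 0)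
    else (if t.2 = 1 then 0 else 1)) (fun e he => ?_) fun i => ?_
  · rw [hlast] at he
    exact (over_of_mem_zhOvers (hω.mem_iff.1 he)).1
  have hcast : (D.zhOp side ω hω).word i.castSucc =
    (D.word i).flatMap (fun e => zhPiece (side e.label) e) := by simp [zhOp]
  rw [hcast, List.map_flatMap]
  refine loop_flatMap (νi := fun _ => 0) (νo := fun _ => 0) (fun e he => ?_) fun _ _ _ => rfl
  have h1 : (D.zhOp side ω hω).LastLabel (zhUnder (side e.label) e).label := by
    unfold LastLabel
    rw [hlast]
    exact List.mem_map.2 ⟨_, hω.mem_iff.2 (mem_zhOvers.2 ⟨i, e, he, rfl⟩), rfl⟩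
  have h2 : ¬ (D.zhOp side ω hω).LastLabel (e.relabel (3 * ·)).label := by
    unfold LastLabel
    rw [hlast]
    intro h
    obtain ⟨z, hz, hl⟩ := List.mem_map.1 h
    have := (over_of_mem_zhOvers (hω.mem_iff.1 hz)).2
    rw [hl] at this
    simp at this
  have h3 : 3 * e.label / 3 = e.label := by omega
  rcases Int.units_eq_one_or e.sign with hs | hs <;> rcases ho : e.isOver <;>
    rcases hside : side e.label <;>
    simp only [hside] at h1 <;>
    simp [zhPiece, sideIn, hs, ho, letter_of_lastLabel h1, letter_of_not_lastLabel h2, Path, gin,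
      gout, tag, h3, hside] <;>
    simp [zhUnder, sideIn, hs, ho]

/-- Existence is needed for the intermediate diagrams in a chain of moves. -/
theorem exists_augments (D : VirtualLinkDiagram n) : ∃ E, Augments D E := by
  obtain ⟨E, hE, -⟩ := (D.iso_base_zhOp (fun _ => .right) _ (List.Perm.refl _)).symm.exists_augments
    (D.augments_base_zhOp _ _ _)
  exact ⟨E, hE⟩

/-- Alexander systems of equivalent diagrams are semi-welded equivalent. -/
theorem Equivalent.semiWeldedEquivalent {D D' : VirtualLinkDiagram n} (h : Equivalent D D') :
    ∀ {E E'}, Augments D E → Augments D' E' → SemiWeldedEquivalent E E' := by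
  induction h with
  | rel D D' h =>
    intro E E' hE hE'
    rcases h with h | h | h | h
    · obtain ⟨F, h1, h2⟩ := h.exists_augments hE
      exact .trans _ _ _ h2 (h1.semiWeldedEquivalent hE')
    -- The first two moves are lifted only as deletions, from the larger diagram to the smaller one.
    -- Uniqueness makes this sufficient for both directions.
    · obtain ⟨F, h1, h2⟩ := h.exists_augments hE'
      exact .symm _ _ (.trans _ _ _ h2 (h1.semiWeldedEquivalent hE))
    · obtain ⟨F, h1, h2⟩ := h.exists_augments hE'
      exact .symm _ _ (.trans _ _ _ h2 (h1.semiWeldedEquivalent hE))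
    · obtain ⟨F, h1, h2⟩ := h.exists_augments hE
      exact .trans _ _ _ h2 (h1.semiWeldedEquivalent hE')
  | refl D => intro E E' hE hE'; exact hE.semiWeldedEquivalent hE'
  | symm D D' _ ih => intro E E' hE hE'; exact .symm _ _ (ih hE' hE)
  | trans D D' D'' _ _ ih1 ih2 =>
    intro E E'' hE hE''
    obtain ⟨E', hE'⟩ := D'.exists_augments
    exact .trans _ _ _ (ih1 hE hE') (ih2 hE' hE'')

/-! ### Split diagrams -/

@[simp] theorem split_word_castSucc (D : VirtualLinkDiagram n) (i : Fin n) :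
    D.split.word i.castSucc = D.word i := by simp [split]

@[simp] theorem split_word_last (D : VirtualLinkDiagram n) :
    D.split.word (Fin.last n) = [] := by simp [split]

theorem Adj.split {D : VirtualLinkDiagram n} {x y : Endpoint} (h : D.Adj x y) :
    D.split.Adj x y := by
  obtain ⟨i, l, h⟩ := h
  exact ⟨i.castSucc, l, by rwa [split_word_castSucc]⟩

theorem AdjSigned.split {D : VirtualLinkDiagram n} {s : ℤˣ} {x y : Endpoint}
    (h : D.AdjSigned s x y) : D.split.AdjSigned s x y := by
  rw [adjSigned_iff] at h ⊢
  exact h.split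

theorem ReidemeisterStep.split {D E : VirtualLinkDiagram n} (h : ReidemeisterStep D E) :
    ReidemeisterStep D.split E.split := by
  rcases h with ⟨f, h⟩ | ⟨x, hx, h⟩ | ⟨a, b, ha, hb, hab, hs, h1, h2, h⟩ |
    ⟨a, b, c, ha, hb, hc, hab, hac, hbc, ⟨δ, h1, h2, h3⟩, h⟩
  · refine Or.inl ⟨f, fun i => ?_⟩
    induction i using Fin.lastCases with
    | last => simp
    | cast i => simpa using h i
  · refine Or.inr (Or.inl ⟨x, hx.split, fun i => ?_⟩)
    induction i using Fin.lastCases with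
    | last => simp
    | cast i => rw [split_word_castSucc, split_word_castSucc, h]
  · refine Or.inr (Or.inr (Or.inl ⟨a, b, ha, hb, hab, hs, h1.split,
      h2.imp (·.split) (·.split), fun i => ?_⟩))
    induction i using Fin.lastCases with
    | last => simp
    | cast i => rw [split_word_castSucc, split_word_castSucc, h]
  · refine Or.inr (Or.inr (Or.inr ⟨a, b, c, ha, hb, hc, hab, hac, hbc,
      ⟨δ, h1.split, h2.split, h3.split⟩, fun i => ?_⟩))
    induction i using Fin.lastCases with
    | last => simp
    | cast i => rw [split_word_castSucc, split_word_castSucc, h]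

theorem Equivalent.split {D E : VirtualLinkDiagram n} (h : Equivalent D E) :
    SemiWeldedEquivalent D.split E.split := by
  induction h with
  | rel D E h => exact .rel _ _ (Or.inl h.split)
  | refl D => exact .refl _
  | symm D E _ ih => exact .symm _ _ ih
  | trans D E F _ _ ih1 ih2 => exact .trans _ _ _ ih1 ih2

/-! ### Alexander numberings and Alexander systems of split diagrams -/

/-- A position of `D`, as a position of `D ⊔ ○`. -/
def splitPosition (D : VirtualLinkDiagram n) (p : D.Position) : D.split.Position :=
  ⟨p.1.castSucc, Fin.cast (by rw [split_word_castSucc]) p.2⟩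

theorem splitPosition_ne_last (D : VirtualLinkDiagram n) (p : D.Position) :
    (D.splitPosition p).1 ≠ Fin.last n := (Fin.castSucc_lt_last p.1).ne

theorem position_split_ne_last (D : VirtualLinkDiagram n) (p : D.split.Position) :
    p.1 ≠ Fin.last n := by
  rcases p with ⟨i, k⟩
  rintro rfl
  have := k.2
  simp at this

theorem exists_splitPosition_eq (D : VirtualLinkDiagram n) (p : D.split.Position) :
    ∃ q, D.splitPosition q = p := by
  rcases p with ⟨i, k⟩
  induction i using Fin.lastCases with
  | last => exact absurd rfl (D.position_split_ne_last ⟨_, k⟩)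
  | cast i => exact ⟨⟨i, Fin.cast (by rw [split_word_castSucc]) k⟩, rfl⟩

theorem splitPosition_injective (D : VirtualLinkDiagram n) :
    Function.Injective D.splitPosition := by
  rintro ⟨i, k⟩ ⟨j, l⟩ h
  obtain rfl : i = j := Fin.castSucc_injective n (congrArg Sigma.fst h)
  simp only [splitPosition, Sigma.mk.injEq, heq_eq_eq, true_and] at h
  rw [Fin.cast_injective _ h]

theorem endpointAt_splitPosition (D : VirtualLinkDiagram n) (p : D.Position) :
    D.split.endpointAt (D.splitPosition p) = D.endpointAt p := by
  simp [endpointAt, splitPosition]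

theorem finRotate_symm_cast {m m' : ℕ} (h : m = m') (k : Fin m) :
    (finRotate m').symm (Fin.cast h k) = Fin.cast h ((finRotate m).symm k) := by
  subst h
  rfl

theorem arcIn_splitPosition (D : VirtualLinkDiagram n) (p : D.Position) :
    D.split.arcIn (D.splitPosition p) = D.splitPosition (D.arcIn p) :=
  congrArg (Sigma.mk p.1.castSucc) (finRotate_symm_cast _ p.2)

/-- Every arc and every crossing of the split diagram comes from `D`, so the conditions at
self-crossings are exactly those of an Alexander numbering. -/
theorem IsAlexanderSystem.alexanderNumerable {D : VirtualLinkDiagram n}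
    {Γ : D.split.BaseArc → ℤ} (h : IsAlexanderSystem D D.split Γ) : D.AlexanderNumerable := by
  refine ⟨fun p => Γ ⟨D.splitPosition p, D.splitPosition_ne_last p⟩, fun p q hp hq => ?_⟩
  have := h.self (D.splitPosition p) (D.splitPosition q)
    (by rwa [endpointAt_splitPosition]) (by rwa [endpointAt_splitPosition,
      endpointAt_splitPosition]) (D.splitPosition_ne_last p) (D.splitPosition_ne_last q)
  simpa only [endpointAt_splitPosition, arcIn_splitPosition, arcOut] using this

theorem AlexanderNumerable.exists_isAlexanderSystem {D : VirtualLinkDiagram n}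
    (h : D.AlexanderNumerable) : ∃ Γ : D.split.BaseArc → ℤ, IsAlexanderSystem D D.split Γ := by
  obtain ⟨f, hf⟩ := h
  choose g hg using D.exists_splitPosition_eq
  have hg' : ∀ q, g (D.splitPosition q) = q := fun q => D.splitPosition_injective (hg _)
  refine ⟨fun a => f (g a.1), D.base_split, ?_, ?_, ?_, ?_⟩
  · intro p q _ _ h
    exact h.elim id fun h => absurd h (D.position_split_ne_last q)
  · intro p q _ _ _
    exact D.position_split_ne_last q
  · intro p q _ _ h
    exact absurd h (D.position_split_ne_last p)
  · intro p q hp hq _ _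
    obtain ⟨p, rfl⟩ := D.exists_splitPosition_eq p
    obtain ⟨q, rfl⟩ := D.exists_splitPosition_eq q
    rw [endpointAt_splitPosition] at hp hq
    rw [endpointAt_splitPosition] at hq
    have := hf p q hp hq
    simpa only [endpointAt_splitPosition, arcIn_splitPosition, arcOut, hg'] using this

/-! ### From Alexander numberings to decorated words without signs -/

theorem Mem.exists_endpointAt {D : VirtualLinkDiagram n} {e : Endpoint} (h : D.Mem e) :
    ∃ p, D.endpointAt p = e := by
  obtain ⟨i, hi⟩ := h
  obtain ⟨k, hk⟩ := List.mem_iff_get.1 hi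
  exact ⟨⟨i, k⟩, hk⟩

theorem endpointAt_mem (D : VirtualLinkDiagram n) (p : D.Position) :
    D.endpointAt p ∈ D.word p.1 := List.get_mem _ _

theorem endpointAt_injective (D : VirtualLinkDiagram n) :
    Function.Injective D.endpointAt := by
  rintro ⟨i, k⟩ ⟨j, l⟩ h
  obtain rfl : i = j := comp_unique (D.endpointAt_mem ⟨i, k⟩) (h ▸ D.endpointAt_mem ⟨j, l⟩)
  obtain rfl : k = l := (D.nodup_word i).get_inj_iff.1 h
  rfl

theorem CyclicNext.exists_position {D : VirtualLinkDiagram n} {i : Fin n} {x y : Endpoint}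
    (h : CyclicNext (D.word i) x y) :
    ∃ p : D.Position, D.endpointAt p = y ∧ D.endpointAt (D.arcIn p) = x := by
  obtain ⟨t, ⟨k, hk⟩, hy⟩ := h
  have hpos : 0 < (D.word i).length := by
    have := congrArg List.length hk
    simp only [List.length_rotate, List.length_cons] at this
    omega
  have h1 : (D.word i).rotate (k + 1) = t ++ [x] := by
    rw [← List.rotate_rotate, hk]
    simp
  have hx : (D.word i)[k % (D.word i).length]'(Nat.mod_lt _ hpos) = x := by
    have h2 : ((D.word i).rotate k).head? = some x := by rw [hk]; rfl
    rw [List.head?_eq_getElem?, List.getElem?_rotate hpos, Nat.zero_add] at h2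
    exact (List.getElem?_eq_some_iff.1 h2).2
  have hy' : (D.word i)[(k + 1) % (D.word i).length]'(Nat.mod_lt _ hpos) = y := by
    rw [← h1, List.head?_eq_getElem?, List.getElem?_rotate hpos, Nat.zero_add] at hy
    exact (List.getElem?_eq_some_iff.1 hy).2
  refine ⟨⟨i, ⟨(k + 1) % (D.word i).length, Nat.mod_lt _ hpos⟩⟩, hy', ?_⟩
  -- The length is generalized so that it can be replaced by a successor, for which `finRotate` is
  -- the addition of 1.
  have key : ∀ (m : ℕ) (hm : 0 < m), (finRotate m).symm ⟨(k + 1) % m, Nat.mod_lt _ hm⟩ =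
      ⟨k % m, Nat.mod_lt _ hm⟩ := by
    intro m hm
    obtain ⟨m, rfl⟩ : ∃ m', m = m' + 1 := ⟨m - 1, by omega⟩
    rw [Equiv.symm_apply_eq, finRotate_apply]
    ext
    simp [Fin.val_add]
  have h3 : D.arcIn ⟨i, ⟨(k + 1) % (D.word i).length, Nat.mod_lt _ hpos⟩⟩ =
      ⟨i, ⟨k % (D.word i).length, Nat.mod_lt _ hpos⟩⟩ := congrArg (Sigma.mk i) (key _ hpos)
  rw [h3]
  exact hx

/-- The value of `μ` at a crossing is the label of its incoming lower arc. The Alexander rule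
recovers the other three labels, and consecutive passages share an arc, so the labels fit together
without any sign. -/
theorem AlexanderNumerable.augments_split {D : VirtualLinkDiagram n}
    (h : D.AlexanderNumerable) : Augments D D.split := by
  classical
  obtain ⟨f, hf⟩ := h
  let μ : ℕ × ℤˣ → ℤ := fun t =>
    if h : ∃ q : D.Position, D.endpointAt q = ⟨t.1, false, t.2⟩ then f (D.arcIn h.choose) else 0
  have hμ : ∀ q : D.Position, (D.endpointAt q).isOver = false →
      μ (tag (D.endpointAt q)) = f (D.arcIn q) := by
    intro q hq
    have hex : ∃ q' : D.Position, D.endpointAt q' =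
        ⟨(tag (D.endpointAt q)).1, false, (tag (D.endpointAt q)).2⟩ := by
      refine ⟨q, ?_⟩
      rw [← hq]
      rfl
    simp only [μ, dif_pos hex]
    congr 2
    refine D.endpointAt_injective (hex.choose_spec.trans ?_)
    rw [← hq]
    rfl
  have hg : ∀ p : D.Position, gin μ (D.endpointAt p) = f (D.arcIn p) ∧
      gout μ (D.endpointAt p) = f (D.arcOut p) := by
    intro p
    obtain ⟨q, hq⟩ := Mem.exists_endpointAt (Mem.partner ⟨_, D.endpointAt_mem p⟩)
    rcases ho : (D.endpointAt p).isOver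
    · have h1 := hf q p (by simp [hq, ho]) (by simp [hq])
      have h2 := hμ p ho
      simp only [hq, Endpoint.sign_partner, AlexanderRule] at h1
      simp only [gin, gout, ho, h2]
      split_ifs at h1 with hs
      · obtain ⟨m, h3, h4, h5, h6⟩ := h1
        simp [h4, h5, hs]
      · obtain ⟨m, h3, h4, h5, h6⟩ := h1
        rw [(Int.units_eq_one_or _).resolve_left hs]
        simp [h3, h6]
    · have h1 := hf p q ho hq
      have h2 := hμ q (by simp [hq, ho])
      have h3 : tag (D.endpointAt q) = tag (D.endpointAt p) := by rw [hq]; rfl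
      rw [h3] at h2
      simp only [AlexanderRule] at h1
      simp only [gin, gout, ho, h2, if_true]
      split_ifs at h1 with hs
      · obtain ⟨m, h3, h4, h5, h6⟩ := h1
        simp [h3, h5, h6, hs]
      · obtain ⟨m, h3, h4, h5, h6⟩ := h1
        rw [(Int.units_eq_one_or _).resolve_left hs]
        simp [h3, h4, h5]
  have hb : Augments D.split.base D.split := by
    refine augments_base (μ := μ) (by simp) fun i => ?_
    have hl : D.split.letter = Sum.inl := by
      funext e
      refine letter_of_not_lastLabel ?_
      simp [LastLabel]
    rw [hl, split_word_castSucc, List.map_eq_flatMap]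
    refine loop_flatMap (νi := gin μ) (νo := gout μ) (fun e _ => ?_) fun x y hxy => ?_
    · exact ⟨rfl, rfl⟩
    · obtain ⟨p, rfl, rfl⟩ := hxy.exists_position
      rw [(hg p).1, (hg _).2]
      rfl
  rwa [base_split] at hb

end VirtualLinkDiagram

/-! ### The corollary -/

theorem mainTheorem2 (n : ℕ) (D : VirtualLinkDiagram n)
    (side : ℕ → VirtualLinkDiagram.Side) (ω : List Endpoint) (hω : ω.Perm (D.zhOvers side)) :
    (D.AlmostClassical ↔
      ∃ D' : VirtualLinkDiagram n,
        VirtualLinkDiagram.SemiWeldedEquivalent (D.zhOp side ω hω) D'.split ∧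
        ∃ Γ' : D'.split.BaseArc → ℤ, VirtualLinkDiagram.IsAlexanderSystem D' D'.split Γ') ∧
    (D.AlmostClassical →
      VirtualLinkDiagram.SemiWeldedEquivalent (D.zhOp side ω hω) D.split) := by
  have hD : VirtualLinkDiagram.Equivalent D (D.zhOp side ω hω).base :=
    .rel _ _ (Or.inl (D.iso_base_zhOp side ω hω))
  -- Both sides are Alexander systems, for the equivalent diagrams `(D.zhOp side ω hω).base` and
  -- `D'`.
  have key : ∀ D' : VirtualLinkDiagram n, D.Equivalent D' → D'.AlexanderNumerable →
      VirtualLinkDiagram.SemiWeldedEquivalent (D.zhOp side ω hω) D'.split := fun D' h h' =>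
    VirtualLinkDiagram.Equivalent.semiWeldedEquivalent (.trans _ _ _ (.symm _ _ hD) h)
      (D.augments_base_zhOp side ω hω) h'.augments_split
  refine ⟨⟨?_, ?_⟩, ?_⟩
  · rintro ⟨D', h, h'⟩
    exact ⟨D', key D' h h', h'.exists_isAlexanderSystem⟩
  · rintro ⟨D', h, Γ', h'⟩
    -- Deleting the last component leads from the semi-welded equivalence to an equivalence with
    -- `D'`.
    refine ⟨D', .trans _ _ _ hD ?_, h'.alexanderNumerable⟩
    have := h.base
    rwa [VirtualLinkDiagram.base_split] at this
  · rintro ⟨D', h, h'⟩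
    -- The equivalence of `D` and `D'` persists after adding the circle, which brings `D' ⊔ ○` back
    -- to `D ⊔ ○`.
    exact .trans _ _ _ (key D' h h') (.symm _ _ h.split)
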